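/- Let $n\ge 1$ and $j\ge 1$ be integers. Let $e_{i,k}$ be the elementary $(2n+1)\times(2n+1)$ matrices, $e_1=(1,0,\dots,0)^t$, $C_n=\sum_{i=1}^{2n+1}(-1)^{n+i-1}e_{i,2n+2-i}$, and let $\mathbb R^{n+1,n}$ be $\mathbb R^{2n+1}$ with the bilinear form $\langle X,Y\rangle=X^tC_nY$; let $O(n+1,n)$ be the group preserving it and $o(n+1,n)=\{A: A^tC_n+C_nA=0\}$. Let $\mathcal M_{n+1,n}$ be the set of smooth $\gamma:\mathbb R\to\mathbb R^{n+1,n}$ such that, for every $x$, $\gamma,\gamma_x,\dots,\gamma_x^{(2n)}$ are linearly independent, the span of $\gamma,\dots,\gamma_x^{(n-1)}$ is a maximal isotropic subspace, and $\langle\gamma_x^{(n)},\gamma_x^{(n)}\rangle=1$. Put $b=\sum_{i=1}^{2n}e_{i+1,i}$ and $\beta_i=e_{n+1-i,n+i}+e_{n+2-i,n+1+i}$ $(1\le i\le n)$, and let $V_n$ be the span of $\beta_1,\dots,\beta_n$. The isotropic moving frame $g$ and the isotropic curvature $u=\sum_{i=1}^n u_i\beta_i$ along $\gamma\in\mathcal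 M_{n+1,n}$ are the smooth maps $g:\mathbb R\to O(n+1,n)$ and $u:\mathbb R\to V_n$ such that the $i$-th column of $g$ is $\gamma_x^{(i-1)}$ for $1\le i\le n+1$ and $g^{-1}g_x=b+u$. A vector field $\xi:\mathbb R\to\mathbb R^{2n+1}$ is tangent to $\mathcal M_{n+1,n}$ at $\gamma$ if $\xi(x)=\partial_t\Gamma(t,x)|_{t=0}$ for some smooth $\Gamma:\mathbb R^2\to\mathbb R^{n+1,n}$ with $\Gamma(t,\cdot)\in\mathcal M_{n+1,n}$ for all $t$ and $\Gamma(0,\cdot)=\gamma$. An equation $\gamma_t=g\,\xi(u)$ is an isotropic curve flow on $\mathcal M_{n+1,n}$ if the entries of $\xi(u)$ are real differential polynomials in $u_1,\dots,u_n$ and $g\,\xi(u)$ is tangent to $\mathcal M_{n+1,n}$ at $\gamma$ for every $\gamma\in\mathcal M_{n+1,n}$, where $g$ and $u$ are the isotropic moving frame and curvature along $\gamma$. Let $J_B=b+\beta\lambda$ with $\beta=\frac12(e_{1,2n}+e_{2,2n+1})$, and $J=b+e_{1,2n+1}\lambda$. Below, $P$ and $S$ are formal series $\sum_{i\le m}X_i(x)\lambda^i$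 with $m\in\mathbb Z$ independent of $x$ and smooth real matrix coefficients $X_i$, and "conjugate" means conjugate, for each $x$, by an invertible matrix over $\mathbb R((\lambda^{-1}))$. Then: (1) For every $u\in C^\infty(\mathbb R,V_n)$ there is a unique $P=P(u,\lambda)$ with coefficients in $o(n+1,n)$ such that $[\partial_x+J_B+u,P]=0$, $P$ is conjugate to $J_B$, and the coefficient of $\lambda$ in $P$ is $\beta$. (2) For every $u\in C^\infty(\mathbb R,V_n)$ there is a unique $S=S(u,\lambda)$ with trace-free coefficients and $C_nS(-\lambda)^tC_n+S(\lambda)=0$ such that $[\partial_x+J+u,S]=0$ and $S$ is conjugate to $J$. (3) Let $P_{2j-1,0}(u)$ and $S_{2j-1,0}(u)$ be the coefficients of $\lambda^0$ in $P(u,\lambda)^{2j-1}$ and $S(u,\lambda)^{2j-1}$. Then $$\gamma_t=g\,P_{2j-1,0}(u)\,e_1\qquad\text{and}\qquad \gamma_t=g\,S_{2j-1,0}(u)\,e_1$$ are isotropic curve flows on $\mathcal M_{n+1,n}$. They are called the $(2j-1)$-th isotropic curve flows of B-type and of A-type. -/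

import Mathlib

open scoped ContDiff Matrix

noncomputable section

namespace IsotropicFlow

/-! ### The space `ℝ^{n+1,n}` and its orthogonal group -/

/-- The vector space `ℝ^{2n+1}` (column vectors). -/
abbrev Vec (n : ℕ) : Type := Fin (2 * n + 1) → ℝ

/-- Real matrices of size `2n+1`. -/
abbrev Mat (n : ℕ) : Type := Matrix (Fin (2 * n + 1)) (Fin (2 * n + 1)) ℝ

/-- The elementary matrix `e_{i,j}`, with the usual indices `1 ≤ i, j ≤ 2n+1`. -/
def elem (n i j : ℕ) : Mat n :=
  Matrix.of fun a b => if (a : ℕ) + 1 = i ∧ (b : ℕ) + 1 = j then 1 else 0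

/-- `C_n = ∑_{i=1}^{2n+1} (-1)^{n+i-1} e_{i,2n+2-i}`. -/
def Cmat (n : ℕ) : Mat n :=
  ∑ i ∈ Finset.Icc 1 (2 * n + 1), (-1 : ℝ) ^ (n + i - 1) • elem n i (2 * n + 2 - i)

/-- The bilinear form `⟨X, Y⟩ = Xᵗ C_n Y` of index `n`. -/
def form (n : ℕ) (X Y : Vec n) : ℝ := X ⬝ᵥ (Cmat n *ᵥ Y)

/-- The group `O(n+1,n)` of the linear isomorphisms that preserve the form, as a set of matrices. -/
def orthogonal (n : ℕ) : Set (Mat n) := {A | Aᵀ * Cmat n * A = Cmat n}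

/-- The Lie algebra `o(n+1,n)`, as a set of matrices. -/
def orthogonalLie (n : ℕ) : Set (Mat n) := {A | Aᵀ * Cmat n + Cmat n * A = 0}

/-- A subspace on which the form vanishes identically. -/
def IsIsotropicSubspace (n : ℕ) (W : Submodule ℝ (Vec n)) : Prop :=
  ∀ X ∈ W, ∀ Y ∈ W, form n X Y = 0

/-! ### Isotropic curves, moving frames and curvatures -/

/-- Isotropic curves in `ℝ^{n+1,n}`. -/
structure IsIsotropicCurve (n : ℕ) (γ : ℝ → Vec n) : Prop where
  smooth : ContDiff ℝ ∞ γ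
  linearIndependent : ∀ s, LinearIndependent ℝ
    (fun k : Fin (2 * n + 1) => iteratedDeriv (k : ℕ) γ s)
  maximal_isotropic : ∀ s, Maximal (IsIsotropicSubspace n)
    (Submodule.span ℝ (Set.range fun k : Fin n => iteratedDeriv (k : ℕ) γ s))

/-- The space `M_{n+1,n}` of the isotropic curves that are parametrized by the isotropic
parameter. -/
def isotropicCurves (n : ℕ) : Set (ℝ → Vec n) :=
  {γ | IsIsotropicCurve n γ ∧ ∀ x, form n (iteratedDeriv n γ x) (iteratedDeriv n γ x) = 1}

/-- `b = ∑_{i=1}^{2n} e_{i+1,i}`. -/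
def bMat (n : ℕ) : Mat n := ∑ i ∈ Finset.Icc 1 (2 * n), elem n (i + 1) i

/-- `β_i = e_{n+1-i,n+i} + e_{n+2-i,n+1+i}`, for `1 ≤ i ≤ n`. -/
def betaMat (n i : ℕ) : Mat n := elem n (n + 1 - i) (n + i) + elem n (n + 2 - i) (n + 1 + i)

/-- The element `u = ∑_{i=1}^n u_i β_i` of `V_n` with coordinates `u_1, …, u_n`
(the coordinate `u_i` is the value of the function at `i - 1`). -/
def toV (n : ℕ) (u : Fin n → ℝ) : Mat n := ∑ k : Fin n, u k • betaMat n ((k : ℕ) + 1)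

/-- The entrywise derivative of a matrix-valued function of one real variable. -/
def matDeriv {n : ℕ} (A : ℝ → Mat n) (x : ℝ) : Mat n :=
  Matrix.of fun a b => deriv (fun y => A y a b) x

/-- `g` is the isotropic moving frame along `γ`, and `u = (u_1, …, u_n)` is its isotropic
curvature: `g` is a smooth map into `O(n+1,n)`, its `i`-th column is `γ_x^{(i-1)}` for
`1 ≤ i ≤ n+1`, and `g⁻¹ g_x = b + ∑ u_i β_i`. -/
structure IsMovingFrame (n : ℕ) (γ : ℝ → Vec n) (g : ℝ → Mat n) (u : ℝ → Fin n → ℝ) : Prop where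
  smooth_frame : ∀ a b, ContDiff ℝ ∞ (fun x => g x a b)
  smooth_curvature : ContDiff ℝ ∞ u
  mem_orthogonal : ∀ x, g x ∈ orthogonal n
  column : ∀ x, ∀ k : Fin (2 * n + 1), (k : ℕ) ≤ n →
    (fun a => g x a k) = iteratedDeriv (k : ℕ) γ x
  deriv_eq : ∀ x, (g x)⁻¹ * matDeriv g x = bMat n + toV n (u x)

/-- `ξ` is tangent to `M_{n+1,n}` at `γ`: it is the velocity at `t = 0` of a smooth
one-parameter family of curves in `M_{n+1,n}` that passes through `γ` at `t = 0`. -/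
def IsTangent (n : ℕ) (γ ξ : ℝ → Vec n) : Prop :=
  ∃ Γ : ℝ → ℝ → Vec n, ContDiff ℝ ∞ (fun p : ℝ × ℝ => Γ p.1 p.2) ∧
    (∀ t, Γ t ∈ isotropicCurves n) ∧ Γ 0 = γ ∧
    ∀ x, HasDerivAt (fun t => Γ t x) (ξ x) 0

/-- Differential polynomials in `u_1, …, u_n`: polynomials in the variables `(k, m)`, which
stand for the `m`-th derivatives of the coordinates of `u`. -/
abbrev DiffPoly (n : ℕ) : Type := MvPolynomial (Fin n × ℕ) ℝ

/-- The value at `x` of a differential polynomial in `u`. -/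
def DiffPoly.evalAt {n : ℕ} (p : DiffPoly n) (u : ℝ → Fin n → ℝ) (x : ℝ) : ℝ :=
  MvPolynomial.eval (fun v : Fin n × ℕ => iteratedDeriv v.2 (fun y => u y v.1) x) p

/-- `γ_t = g ξ(u)` is an isotropic curve flow on `M_{n+1,n}`: the operator `ξ` is a vector of
differential polynomials in `u`, and for all `γ` in `M_{n+1,n}` with isotropic moving frame `g`
and isotropic curvature `u` the right-hand side `g ξ(u)` is tangent to `M_{n+1,n}` at `γ`. -/
def IsIsotropicCurveFlow (n : ℕ) (ξ : (ℝ → Fin n → ℝ) → ℝ → Vec n) : Prop :=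
  (∃ p : Fin (2 * n + 1) → DiffPoly n, ∀ u : ℝ → Fin n → ℝ, ContDiff ℝ ∞ u →
    ∀ x a, ξ u x a = (p a).evalAt u x) ∧
  ∀ γ ∈ isotropicCurves n, ∀ g u, IsMovingFrame n γ g u →
    IsTangent n γ (fun x => g x *ᵥ ξ u x)

/-! ### Formal Laurent series in `λ⁻¹` and the two hierarchies -/

/-- Formal series `∑_{i ≤ m} ξ_i λ^i` with real matrix coefficients, as Laurent series in the
variable `λ⁻¹`. -/
abbrev Loop (n : ℕ) : Type := LaurentSeries (Mat n)

/-- The coefficient of `λ^i`. -/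
def lamCoeff {n : ℕ} (ξ : Loop n) (i : ℤ) : Mat n := HahnSeries.coeff ξ (-i)

/-- The series `A λ^i`. -/
def monomial {n : ℕ} (i : ℤ) (A : Mat n) : Loop n := HahnSeries.single (-i) A

/-- The algebra `B̂_n^{(1)}`: all coefficients lie in `o(n+1,n)`. -/
def loopB (n : ℕ) : Set (Loop n) := {ξ | ∀ i, lamCoeff ξ i ∈ orthogonalLie n}

/-- The algebra `Â_{2n}^{(2)}`: the coefficients have trace zero and
`C_n ξ(-λ)ᵗ C_n + ξ(λ) = 0`. -/
def loopA (n : ℕ) : Set (Loop n) :=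
  {ξ | ∀ i : ℤ, (lamCoeff ξ i).trace = 0 ∧
    ((-1 : ℝ) ^ i) • (Cmat n * (lamCoeff ξ i)ᵀ * Cmat n) + lamCoeff ξ i = 0}

/-- `β = (1/2) (e_{1,2n} + e_{2,2n+1})`. -/
def betaB (n : ℕ) : Mat n := (1 / 2 : ℝ) • (elem n 1 (2 * n) + elem n 2 (2 * n + 1))

/-- `J_B = b + β λ`. -/
def JB (n : ℕ) : Loop n := monomial 0 (bMat n) + monomial 1 (betaB n)

/-- `J = b + e_{1,2n+1} λ`. -/
def JA (n : ℕ) : Loop n := monomial 0 (bMat n) + monomial 1 (elem n 1 (2 * n + 1))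

/-- `X` is a smooth family of formal series, with a common bound on the powers of `λ`, that
solves `[∂_x + J + u, X] = 0` and is conjugate to `J` for every value of `x`. -/
structure IsResolvent (n : ℕ) (J : Loop n) (u : ℝ → Fin n → ℝ) (X : ℝ → Loop n) : Prop where
  bounded : ∃ m : ℤ, ∀ x i, m < i → lamCoeff (X x) i = 0
  smooth : ∀ i a b, ContDiff ℝ ∞ (fun x => lamCoeff (X x) i a b)
  commute : ∀ x i, matDeriv (fun y => lamCoeff (X y) i) x +
    lamCoeff ((J + monomial 0 (toV n (u x))) * X x - X x * (J + monomial 0 (toV n (u x)))) i = 0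
  conjugate : ∀ x, ∃ T : (Loop n)ˣ, X x = T * J * (T⁻¹ : (Loop n)ˣ)

/-- `P = P(u, λ)`. The conditions of `IsResolvent` determine `P` only up to sign, since `J_B` is
conjugate to `-J_B`; the coefficient of `λ` fixes the sign. -/
def IsP (n : ℕ) (u : ℝ → Fin n → ℝ) (P : ℝ → Loop n) : Prop :=
  IsResolvent n (JB n) u P ∧ (∀ x, P x ∈ loopB n) ∧ ∀ x, lamCoeff (P x) 1 = betaB n

/-- `S = S(u, λ)`. -/
def IsS (n : ℕ) (u : ℝ → Fin n → ℝ) (S : ℝ → Loop n) : Prop :=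
  IsResolvent n (JA n) u S ∧ ∀ x, S x ∈ loopA n

/-- The first standard basis vector `e_1`. -/
def e1 (n : ℕ) : Vec n := Pi.single 0 1

end IsotropicFlow

end

open IsotropicFlow

/-! Both hierarchies are instances of one construction (`LoopType`), with `J = b + E λ`. Put `λ = t
^ h`, where `h = 2n` in type B and `h = 2n+1` in type A, and conjugate by `diag(1, t, …, t^{2n})`.
Then `J` becomes `t L` with the constant matrix `L = b + E`, and the strictly upper triangular `u`
becomes a series in negative powers of `t`. The matrix `L` is a root of `x^{2n+1} - x` (type B) or
`x^{2n+1} - 1` (type A). These polynomials are separable, so all matrices split into the commutant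
of `L` and the image of `ad L`, with explicit formulas (`proj`, `adInv`). Hence the Drinfeld–Sokolov
dressing `T = 1 + ⋯`, which carries `∂ + t L + U` to `∂ + t L + F` with `F` commuting with `L`, can
be computed term by term (`exists_dressing`), and `T (t L) T⁻¹` solves the zero curvature equation.

For uniqueness, conjugation by `T` turns any other solution into a series that commutes with `t L`
and obeys the polynomial relation of `t L`. It equals `t L` as soon as its leading term does
(`eq_lead_of_commute`). The leading term is `a L` (`leadsWithJ_of`), and `a = 1` because a real
`(2n+1)`-th root of `1` is `1` in type A, and because the coefficient of `λ` is prescribed in type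
B. Uniqueness also forces invariance under `X(λ) ↦ -C X(ελ)ᵗ C`, hence membership in the loop
algebra (`loopInv_solution`). The construction works over any differential `ℝ`-algebra. Over the
differential polynomials it gives existence together with the polynomial form of the coefficients;
over the smooth functions it gives uniqueness.

For tangency, let `X` be an odd power of the solution and `Q` its coefficient of `λ^0`. Oddness
keeps `Q` in `o(n+1,n)`. The `λ^0` part of `[∂ + J + u, X] = 0` says that `[∂ + b + u, Q] = [X_{-1},
E]`, which is upper triangular. By `exists_gauge` it equals `[∂ + b + u, η] + v` with `η` strictly
upper triangular and `v` in `V_n`. So `Z = Q - η` satisfies `[∂ + b + u, Z] = v` and `Z e_1 = Q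
e_1`. For `N = g Z g⁻¹` this reads `N_x = g v g⁻¹`. Solving `K_x = t K N_x`, `K(t, 0) = 1` by a
series of iterated integrals, entire in `t`, makes `exp(t N(0)) K g` an orthogonal frame with
curvature `u + t v`. Its first column lies in `M_{n+1,n}` for all `t` (`column_mem_isotropicCurves`)
and has velocity `N g e_1 = g Q e_1` at `t = 0`. -/

noncomputable section

namespace IsotropicFlow

/-! ### Laurent series in `λ⁻¹` over a noncommutative ring; index `i` stands for the power `λ^{-i}`.
-/

section Laurent

variable {R : Type*} [Ring R]

/-- The coefficients of index less than `m` vanish. -/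
def VanishBelow (m : ℤ) (X : LaurentSeries R) : Prop := ∀ i, i < m → X.coeff i = 0

theorem exists_vanishBelow (X : LaurentSeries R) : ∃ m, VanishBelow m X :=
  ⟨X.order, fun _ hi => HahnSeries.coeff_eq_zero_of_lt_order hi⟩

theorem VanishBelow.mono {m k : ℤ} {X : LaurentSeries R} (h : VanishBelow m X) (hk : k ≤ m) :
    VanishBelow k X := fun i hi => h i (hi.trans_le hk)

theorem VanishBelow.add {m : ℤ} {X Y : LaurentSeries R} (hX : VanishBelow m X)
    (hY : VanishBelow m Y) : VanishBelow m (X + Y) := fun i hi => by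
  rw [HahnSeries.coeff_add, hX i hi, hY i hi, add_zero]

theorem vanishBelow_single (m : ℤ) (a : R) : VanishBelow m (HahnSeries.single m a) :=
  fun _ hi => HahnSeries.coeff_single_of_ne hi.ne

theorem vanishBelow_one : VanishBelow 0 (1 : LaurentSeries R) := vanishBelow_single 0 1

/-- The range of summation depends only on the lower bounds `p`, `q` and not on the supports, so
additive maps and reindexings can be moved through products. -/
theorem coeff_mul_Icc {X Y : LaurentSeries R} {p q : ℤ} (hX : VanishBelow p X)
    (hY : VanishBelow q Y) (a : ℤ) :
    (X * Y).coeff a = ∑ i ∈ Finset.Icc p (a - q), X.coeff i * Y.coeff (a - i) := by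
  rw [HahnSeries.coeff_mul]
  refine Finset.sum_of_injOn (fun ij => ij.1) ?_ ?_ ?_ ?_
  · rintro ⟨i, j⟩ hi ⟨i', j'⟩ hi' h
    simp only [Finset.mem_coe, Finset.mem_antidiagonal] at hi hi' h
    ext
    · exact h
    · change j = j'
      change i = i' at h
      linarith [hi.2.2, hi'.2.2]
  · rintro ⟨i, j⟩ hi
    simp only [Finset.mem_coe, Finset.mem_antidiagonal, HahnSeries.mem_support] at hi
    simp only [Finset.coe_Icc, Set.mem_Icc]
    constructor
    · by_contra h
      exact hi.1 (hX i (by linarith))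
    · by_contra h
      exact hi.2.1 (hY j (by linarith [hi.2.2]))
  · intro i _ hi
    by_contra h
    refine hi ⟨(i, a - i), ?_, rfl⟩
    simp only [Finset.mem_coe, Finset.mem_antidiagonal, HahnSeries.mem_support]
    exact ⟨left_ne_zero_of_mul h, right_ne_zero_of_mul h, by ring⟩
  · rintro ⟨i, j⟩ hi
    simp only [Finset.mem_antidiagonal] at hi
    rw [← hi.2.2]
    simp

theorem VanishBelow.mul {X Y : LaurentSeries R} {p q : ℤ} (hX : VanishBelow p X)
    (hY : VanishBelow q Y) : VanishBelow (p + q) (X * Y) := fun a ha => by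
  rw [coeff_mul_Icc hX hY, Finset.Icc_eq_empty (by linarith), Finset.sum_empty]

theorem coeff_mul_lead {X Y : LaurentSeries R} {p q : ℤ} (hX : VanishBelow p X)
    (hY : VanishBelow q Y) {a : ℤ} (ha : a = p + q) :
    (X * Y).coeff a = X.coeff p * Y.coeff q := by
  subst ha
  rw [coeff_mul_Icc hX hY]
  simp

theorem VanishBelow.pow {X : LaurentSeries R} {p : ℤ} (hX : VanishBelow p X) (k : ℕ) :
    VanishBelow (k * p) (X ^ k) := by
  induction k with
  | zero => simpa using vanishBelow_one
  | succ k ih =>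
    rw [pow_succ]
    convert ih.mul hX using 1
    push_cast
    ring

theorem coeff_pow_lead {X : LaurentSeries R} {p : ℤ} (hX : VanishBelow p X) (k : ℕ) :
    (X ^ k).coeff (k * p) = X.coeff p ^ k := by
  induction k with
  | zero => simp
  | succ k ih =>
    rw [pow_succ, coeff_mul_lead (hX.pow k) hX (by push_cast; ring), ih, pow_succ]

theorem eq_zero_of_vanishBelow {X : LaurentSeries R}
    (h : ∀ m, VanishBelow m X → X.coeff m = 0) : X = 0 := by
  by_contra hX
  exact HahnSeries.coeff_order_eq_zero.not.mpr hX
    (h X.order fun _ hi => HahnSeries.coeff_eq_zero_of_lt_order hi)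

/-- The coefficientwise extension of an additive map. -/
def coeffMap {S : Type*} [Ring S] (f : R →+ S) : LaurentSeries R →+ LaurentSeries S where
  toFun X := X.map f
  map_zero' := by ext; simp
  map_add' X Y := by ext; simp

@[simp]
theorem coeff_coeffMap {S : Type*} [Ring S] (f : R →+ S) (X : LaurentSeries R) (i : ℤ) :
    (coeffMap f X).coeff i = f (X.coeff i) := rfl

@[simp]
theorem coeffMap_single {S : Type*} [Ring S] (f : R →+ S) (i : ℤ) (a : R) :
    coeffMap f (HahnSeries.single i a) = HahnSeries.single i (f a) := by
  ext j
  rw [coeff_coeffMap]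
  by_cases h : j = i
  · subst h; simp
  · simp [HahnSeries.coeff_single_of_ne h]

theorem VanishBelow.coeffMap {S : Type*} [Ring S] (f : R →+ S) {X : LaurentSeries R} {m : ℤ}
    (h : VanishBelow m X) : VanishBelow m (coeffMap f X) := fun i hi => by
  rw [coeff_coeffMap, h i hi, map_zero]

theorem coeffMap_leibniz (D : R →+ R) (hD : ∀ a b, D (a * b) = D a * b + a * D b)
    (X Y : LaurentSeries R) :
    coeffMap D (X * Y) = coeffMap D X * Y + X * coeffMap D Y := by
  obtain ⟨p, hX⟩ := exists_vanishBelow X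
  obtain ⟨q, hY⟩ := exists_vanishBelow Y
  ext a
  rw [coeff_coeffMap, HahnSeries.coeff_add, coeff_mul_Icc hX hY, coeff_mul_Icc (hX.coeffMap D) hY,
    coeff_mul_Icc hX (hY.coeffMap D), map_sum, ← Finset.sum_add_distrib]
  exact Finset.sum_congr rfl fun i _ => by simp [hD]

/-- The coefficientwise extension of a ring homomorphism. -/
def coeffHom {S : Type*} [Ring S] (f : R →+* S) : LaurentSeries R →+* LaurentSeries S :=
  { coeffMap f.toAddMonoidHom with
    map_one' := by
      change coeffMap f.toAddMonoidHom (HahnSeries.single 0 1) = HahnSeries.single 0 1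
      rw [coeffMap_single]
      exact congrArg _ f.map_one
    map_mul' := fun X Y => by
      obtain ⟨p, hX⟩ := exists_vanishBelow X
      obtain ⟨q, hY⟩ := exists_vanishBelow Y
      ext a
      change (coeffMap f.toAddMonoidHom (X * Y)).coeff a =
        (coeffMap f.toAddMonoidHom X * coeffMap f.toAddMonoidHom Y).coeff a
      rw [coeff_coeffMap, coeff_mul_Icc hX hY, coeff_mul_Icc (hX.coeffMap _) (hY.coeffMap _)]
      simp }

@[simp]
theorem coeffHom_single {S : Type*} [Ring S] (f : R →+* S) (i : ℤ) (a : R) :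
    coeffHom f (HahnSeries.single i a) = HahnSeries.single i (f a) :=
  coeffMap_single f.toAddMonoidHom i a

theorem commute_single_one (X : LaurentSeries R) (k : ℤ) :
    Commute (HahnSeries.single k (1 : R)) X := by
  obtain ⟨p, hX⟩ := exists_vanishBelow X
  ext a
  rw [HahnSeries.coeff_single_mul, HahnSeries.coeff_mul_single, one_mul, mul_one]

/-- The twisted coefficientwise extension `∑ X_k λ^k ↦ ∑ ε^k τ(X_k) λ^k` of an additive map `τ`. -/
def twist (τ : R →+ R) (ε : ℤˣ) : LaurentSeries R →+ LaurentSeries R where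
  toFun X :=
    { coeff := fun i => ((ε ^ i : ℤˣ) : ℤ) • τ (X.coeff i)
      isPWO_support' := X.isPWO_support.mono fun i hi h0 => hi (by
        simp only [h0, map_zero, smul_zero]) }
  map_zero' := by ext; simp
  map_add' X Y := by ext; simp

@[simp]
theorem coeff_twist (τ : R →+ R) (ε : ℤˣ) (X : LaurentSeries R) (i : ℤ) :
    (twist τ ε X).coeff i = ((ε ^ i : ℤˣ) : ℤ) • τ (X.coeff i) := rfl

theorem twist_single (τ : R →+ R) (ε : ℤˣ) (i : ℤ) (a : R) :
    twist τ ε (HahnSeries.single i a) = HahnSeries.single i (((ε ^ i : ℤˣ) : ℤ) • τ a) := by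
  ext j
  rw [coeff_twist]
  by_cases h : j = i
  · subst h; simp
  · simp [HahnSeries.coeff_single_of_ne h]

theorem VanishBelow.twist (τ : R →+ R) (ε : ℤˣ) {X : LaurentSeries R} {m : ℤ}
    (h : VanishBelow m X) : VanishBelow m (twist τ ε X) := fun i hi => by
  rw [coeff_twist, h i hi, map_zero, smul_zero]

theorem twist_mul (τ : R →+ R) (hτ : ∀ a b, τ (a * b) = τ b * τ a) (ε : ℤˣ)
    (X Y : LaurentSeries R) : twist τ ε (X * Y) = twist τ ε Y * twist τ ε X := by
  obtain ⟨p, hX⟩ := exists_vanishBelow X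
  obtain ⟨q, hY⟩ := exists_vanishBelow Y
  ext a
  rw [coeff_twist, coeff_mul_Icc hX hY, coeff_mul_Icc (hY.twist τ ε) (hX.twist τ ε), map_sum,
    Finset.smul_sum]
  refine Finset.sum_bij' (fun i _ => a - i) (fun i _ => a - i) ?_ ?_ ?_ ?_ ?_
  · intro i hi
    rw [Finset.mem_Icc] at hi ⊢
    constructor <;> linarith [hi.1, hi.2]
  · intro i hi
    rw [Finset.mem_Icc] at hi ⊢
    constructor <;> linarith [hi.1, hi.2]
  · intro i _; ring
  · intro i _; ring
  · intro i _
    rw [hτ, coeff_twist, coeff_twist, smul_mul_smul_comm, ← Units.val_mul, ← zpow_add]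
    congr 4
    · ring
    · ring_nf

theorem twist_pow (τ : R →+ R) (hτ : ∀ a b, τ (a * b) = τ b * τ a) (hτ1 : τ 1 = 1) (ε : ℤˣ)
    (X : LaurentSeries R) (k : ℕ) : twist τ ε (X ^ k) = twist τ ε X ^ k := by
  induction k with
  | zero =>
    rw [pow_zero, pow_zero]
    change twist τ ε (HahnSeries.single 0 1) = HahnSeries.single 0 1
    rw [twist_single]
    simp [hτ1]
  | succ k ih => rw [pow_succ, twist_mul τ hτ, ih, pow_succ']

theorem single_add_single (i : ℤ) (a b : R) :
    HahnSeries.single i (a + b) = HahnSeries.single i a + HahnSeries.single i b := by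
  ext j
  by_cases h : j = i
  · subst h; simp
  · simp [HahnSeries.coeff_single_of_ne h]

theorem single_neg (i : ℤ) (a : R) : HahnSeries.single i (-a) = -HahnSeries.single i a := by
  ext j
  by_cases h : j = i
  · subst h; simp
  · simp [HahnSeries.coeff_single_of_ne h]

/-- The involution `∑ X_k λ^k ↦ -∑ ε^k τ(X_k) λ^k`. -/
def negTwist (τ : R →+ R) (ε : ℤˣ) : LaurentSeries R →+ LaurentSeries R := -twist τ ε

theorem negTwist_single (τ : R →+ R) (ε : ℤˣ) (i : ℤ) (a : R) :
    negTwist τ ε (HahnSeries.single i a) =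
      HahnSeries.single i (-(((ε ^ i : ℤˣ) : ℤ) • τ a)) := by
  rw [single_neg, ← twist_single]
  rfl

/-- Minus an anti-automorphism respects commutators. Since `K` is fixed and `D` commutes with `τ`,
the involution permutes the solutions of the zero curvature equation. -/
theorem negTwist_bracket (τ D : R →+ R) (hτ : ∀ a b, τ (a * b) = τ b * τ a)
    (hD : ∀ a, D (τ a) = τ (D a)) (ε : ℤˣ) {K X : LaurentSeries R} (hK : negTwist τ ε K = K)
    (hX : coeffMap D X + K * X - X * K = 0) :
    coeffMap D (negTwist τ ε X) + K * negTwist τ ε X - negTwist τ ε X * K = 0 := by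
  have hK' : twist τ ε K = -K := neg_eq_iff_eq_neg.mp hK
  have hDX : coeffMap D (twist τ ε X) = twist τ ε (coeffMap D X) := by
    ext i
    rw [coeff_coeffMap, coeff_twist, coeff_twist, coeff_coeffMap, map_zsmul, hD]
  have h1 := congrArg (twist τ ε) hX
  rw [map_sub, map_add, twist_mul _ hτ, twist_mul _ hτ, hK', map_zero] at h1
  rw [negTwist, AddMonoidHom.neg_apply, map_neg, hDX, ← neg_eq_zero, ← h1]
  simp only [mul_neg, neg_mul]
  abel

/-- The relation `X ^ N = λ (c X + 1 - c)`. -/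
def LambdaRel (N : ℕ) (c : ℤ) (X : LaurentSeries R) : Prop :=
  X ^ N = c • (HahnSeries.single (-1) (1 : R) * X) + (1 - c) • HahnSeries.single (-1) (1 : R)

theorem lambdaRel_zero {N : ℕ} {X : LaurentSeries R} :
    LambdaRel N 0 X ↔ X ^ N = HahnSeries.single (-1) (1 : R) := by
  rw [LambdaRel, zero_smul, zero_add, sub_zero, one_smul]

theorem lambdaRel_one {N : ℕ} {X : LaurentSeries R} :
    LambdaRel N 1 X ↔ X ^ N = HahnSeries.single (-1) (1 : R) * X := by
  rw [LambdaRel, one_smul, sub_self, zero_smul, add_zero]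

theorem LambdaRel.map {S : Type*} [Ring S] {N : ℕ} {c : ℤ} {X : LaurentSeries R}
    (h : LambdaRel N c X) (f : R →+* S) : LambdaRel N c (coeffHom f X) := by
  have := congrArg (coeffHom f) h
  rwa [map_pow, map_add, map_zsmul, map_zsmul, map_mul, coeffHom_single, map_one] at this

theorem LambdaRel.conj {N : ℕ} {c : ℤ} {X : LaurentSeries R} (h : LambdaRel N c X)
    (T : (LaurentSeries R)ˣ) : LambdaRel N c
      ((T : LaurentSeries R) * X * ((T⁻¹ : (LaurentSeries R)ˣ) : LaurentSeries R)) := by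
  have e : (T * X * (T⁻¹ : (LaurentSeries R)ˣ) : LaurentSeries R) ^ N =
      T * X ^ N * (T⁻¹ : (LaurentSeries R)ˣ) := Units.conj_pow T X N
  rw [LambdaRel, e, h, mul_add, add_mul, mul_smul_comm, mul_smul_comm, smul_mul_assoc,
    smul_mul_assoc, ← mul_assoc (T : LaurentSeries R), ← (commute_single_one _ _).eq,
    mul_assoc _ (T : LaurentSeries R)]
  simp only [mul_assoc, Units.mul_inv, mul_one]

/-- For odd `N` the sign of the involution survives the `N`-th power. If `X ^ N = λ` it is cancelled
by `λ ↦ -λ`; if `X ^ N = λ X` it is absorbed in the factor `X`. This is why `c` and `ε` are tied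
together. -/
theorem LambdaRel.negTwist (τ : R →+ R) (hτ : ∀ a b, τ (a * b) = τ b * τ a) (hτ1 : τ 1 = 1)
    {ε : ℤˣ} {c : ℤ} (hε : (c = 0 ∧ ε = -1) ∨ (c = 1 ∧ ε = 1)) {N : ℕ} (hN : Odd N)
    {X : LaurentSeries R} (h : LambdaRel N c X) : LambdaRel N c (negTwist τ ε X) := by
  have h1 : IsotropicFlow.negTwist τ ε X ^ N = -twist τ ε (X ^ N) := by
    rw [IsotropicFlow.negTwist, AddMonoidHom.neg_apply, hN.neg_pow, twist_pow τ hτ hτ1]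
  rcases hε with ⟨rfl, rfl⟩ | ⟨rfl, rfl⟩
  · rw [lambdaRel_zero] at h ⊢
    rw [h1, h, twist_single, hτ1, ← single_neg]
    simp
  · rw [lambdaRel_one] at h ⊢
    rw [h1, h, twist_mul τ hτ, twist_single, hτ1, one_zpow, Units.val_one, one_smul,
      (commute_single_one _ _).eq, IsotropicFlow.negTwist, AddMonoidHom.neg_apply, neg_mul]

end Laurent

/-! ### Separable elements: splitting by `ad L` and the dressing recursion. -/

theorem exists_strong_rec {X : Type*} [Inhabited X] (G : ℕ → (ℕ → X) → X)
    (hG : ∀ k f g, (∀ i < k, f i = g i) → G k f = G k g) : ∃ Z : ℕ → X, ∀ k, Z k = G k Z := by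
  let H : (k : ℕ) → ((i : ℕ) → i < k → X) → X :=
    fun k ih => G k fun i => if h : i < k then ih i h else default
  refine ⟨(wellFounded_lt (α := ℕ)).fix H, fun k => ?_⟩
  rw [WellFounded.fix_eq]
  refine hG k _ _ fun i hi => ?_
  rw [dif_pos hi]

/-- A differential ring `R`, filtered by subgroups `Gr k`, with an element `L` that is a root of
the separable polynomial `x ^ N - c x - (1 - c)`; `r` is the inverse of the derivative of this
polynomial at `L`. -/
structure SeparableDatum (R : Type*) [Ring R] where
  N : ℕ
  one_le : 1 ≤ N
  L : R
  r : R
  c : ℤ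
  Gr : ℤ → AddSubgroup R
  D : R →+ R
  leibniz : ∀ a b, D (a * b) = D a * b + a * D b
  D_L : D L = 0
  rel : L ^ N = c • L + (1 - c) • (1 : R)
  comm : Commute r L
  inv : r * (N • L ^ (N - 1) - c • (1 : R)) = 1
  one_mem : (1 : R) ∈ Gr 0
  mul_mem : ∀ {k l a b}, a ∈ Gr k → b ∈ Gr l → a * b ∈ Gr (k + l)
  D_mem : ∀ {k a}, a ∈ Gr k → D a ∈ Gr k
  L_mem : L ∈ Gr 1
  r_mem : r ∈ Gr (1 - N)
  c_smul_r_mem : c • r ∈ Gr 0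

namespace SeparableDatum

variable {R : Type*} [Ring R] (d : SeparableDatum R)

theorem pow_mem (k : ℕ) : d.L ^ k ∈ d.Gr k := by
  induction k with
  | zero => simpa using d.one_mem
  | succ k ih => rw [pow_succ]; push_cast; exact d.mul_mem ih d.L_mem

/-- The divided difference of the polynomial of `L`, as an operator. -/
def divDiff (Y : R) : R :=
  ∑ a ∈ Finset.range d.N, d.L ^ a * Y * d.L ^ (d.N - 1 - a) - d.c • Y

/-- The projection onto the commutant of `L` along the image of `ad L`. -/
def proj (Y : R) : R := d.r * d.divDiff Y

/-- A right inverse of `ad L` on the image of `ad L`. -/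
def adInv (Y : R) : R :=
  d.r * ∑ l ∈ Finset.range (d.N - 1),
    (d.N - 1 - l) • (d.L ^ (d.N - 2 - l) * Y * d.L ^ l)

/-- Let `l`, `r` be left and right multiplication by `L` and `p` the polynomial of `L`. Then
`divDiff` is `(p(l) - p(r)) / (l - r)`, so `(l - r)` times it is `p(l) - p(r)`, which vanishes. -/
theorem commute_divDiff (Y : R) : d.L * d.divDiff Y = d.divDiff Y * d.L := by
  have key : d.L * ∑ a ∈ Finset.range d.N, d.L ^ a * Y * d.L ^ (d.N - 1 - a) + Y * d.L ^ d.N =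
      (∑ a ∈ Finset.range d.N, d.L ^ a * Y * d.L ^ (d.N - 1 - a)) * d.L + d.L ^ d.N * Y := by
    have h1 := Finset.sum_range_succ' (fun a => d.L ^ a * Y * d.L ^ (d.N - a)) d.N
    have h2 := Finset.sum_range_succ (fun a => d.L ^ a * Y * d.L ^ (d.N - a)) d.N
    rw [Finset.mul_sum, Finset.sum_mul]
    have e1 : ∑ a ∈ Finset.range d.N, d.L * (d.L ^ a * Y * d.L ^ (d.N - 1 - a)) =
        ∑ a ∈ Finset.range d.N, d.L ^ (a + 1) * Y * d.L ^ (d.N - (a + 1)) :=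
      Finset.sum_congr rfl fun a _ => by
        rw [pow_succ' d.L a, show d.N - (a + 1) = d.N - 1 - a by omega]
        simp only [mul_assoc]
    have e2 : ∑ a ∈ Finset.range d.N, d.L ^ a * Y * d.L ^ (d.N - 1 - a) * d.L =
        ∑ a ∈ Finset.range d.N, d.L ^ a * Y * d.L ^ (d.N - a) :=
      Finset.sum_congr rfl fun a ha => by
        have ha := Finset.mem_range.mp ha
        rw [show d.N - a = d.N - 1 - a + 1 by omega, pow_succ]
        simp only [mul_assoc]
    rw [e1, e2]
    simp only [pow_zero, one_mul, Nat.sub_zero, Nat.sub_self, mul_one] at h1 h2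
    rw [← h1, ← h2]
  rw [d.rel] at key
  simp only [mul_add, add_mul, mul_smul_comm, smul_mul_assoc, mul_one, one_mul] at key
  rw [divDiff, mul_sub, sub_mul, mul_smul_comm, smul_mul_assoc, sub_eq_sub_iff_add_eq_add]
  have := congrArg (fun z => z - (1 - d.c) • Y) key
  simpa [← add_assoc] using this

theorem commute_proj (Y : R) : Commute d.L (d.proj Y) :=
  d.comm.symm.mul_right (d.commute_divDiff Y)

theorem divDiff_of_commute {Y : R} (h : Commute d.L Y) :
    d.divDiff Y = (d.N • d.L ^ (d.N - 1) - d.c • (1 : R)) * Y := by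
  have : ∀ a ∈ Finset.range d.N, d.L ^ a * Y * d.L ^ (d.N - 1 - a) = d.L ^ (d.N - 1) * Y := by
    intro a ha
    have ha := Finset.mem_range.mp ha
    rw [mul_assoc, ← (h.pow_left _).eq, ← mul_assoc, ← pow_add,
      show a + (d.N - 1 - a) = d.N - 1 by omega]
  rw [divDiff, Finset.sum_congr rfl this]
  simp [sub_mul, mul_assoc]

theorem proj_of_commute {Y : R} (h : Commute d.L Y) : d.proj Y = Y := by
  rw [proj, d.divDiff_of_commute h, ← mul_assoc, d.inv, one_mul]

/-- `divDiff` is a polynomial in the commuting operators of left and right multiplication by `L`,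
hence commutes with `ad L`; then `commute_divDiff` applies. -/
theorem divDiff_bracket (Y : R) : d.divDiff (d.L * Y - Y * d.L) = 0 := by
  have h := d.commute_divDiff Y
  have e : d.divDiff (d.L * Y - Y * d.L) = d.L * d.divDiff Y - d.divDiff Y * d.L := by
    simp only [divDiff, mul_sub, sub_mul, Finset.mul_sum, Finset.sum_mul, Finset.sum_sub_distrib,
      smul_sub, mul_smul_comm, smul_mul_assoc]
    have e1 : ∀ a, d.L ^ a * (d.L * Y) * d.L ^ (d.N - 1 - a) =
        d.L * (d.L ^ a * Y * d.L ^ (d.N - 1 - a)) := fun a => by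
      rw [← mul_assoc (d.L ^ a), ← pow_succ, pow_succ']
      simp only [mul_assoc]
    have e2 : ∀ a, d.L ^ a * (Y * d.L) * d.L ^ (d.N - 1 - a) =
        d.L ^ a * Y * d.L ^ (d.N - 1 - a) * d.L := fun a => by
      rw [mul_assoc (d.L ^ a * Y), ← pow_succ, pow_succ']
      simp only [mul_assoc]
    simp only [e1, e2]
    abel
  rw [e, h, sub_self]

/-- Semisimplicity of `ad L`: `proj` is the identity on the commutant and zero on the image, so the
two meet only in `0`. -/
theorem eq_zero_of_commute_bracket {Y : R} (h : Commute d.L (d.L * Y - Y * d.L)) :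
    d.L * Y - Y * d.L = 0 := by
  rw [← d.proj_of_commute h, proj, d.divDiff_bracket, mul_zero]

/-- The sum in `adInv` is a second divided difference: `l - r` times it is `p'(l)` minus the first
divided difference. Multiplication by `r = p'(L)⁻¹`, which commutes with `L`, gives `1 - proj`. -/
theorem bracket_adInv (Y : R) : d.L * d.adInv Y - d.adInv Y * d.L = Y - d.proj Y := by
  obtain ⟨m, hm⟩ : ∃ m, d.N = m + 1 := ⟨d.N - 1, by have := d.one_le; omega⟩
  have hS : ∀ m : ℕ, d.L * (∑ l ∈ Finset.range m, (m - l) • (d.L ^ (m - 1 - l) * Y * d.L ^ l)) -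
      (∑ l ∈ Finset.range m, (m - l) • (d.L ^ (m - 1 - l) * Y * d.L ^ l)) * d.L =
      (m + 1) • (d.L ^ m * Y) - ∑ a ∈ Finset.range (m + 1), d.L ^ a * Y * d.L ^ (m - a) := by
    intro m
    rw [← Finset.sum_range_reflect (fun a => d.L ^ a * Y * d.L ^ (m - a)) (m + 1)]
    have e0 : ∑ j ∈ Finset.range (m + 1), d.L ^ (m + 1 - 1 - j) * Y * d.L ^ (m - (m + 1 - 1 - j)) =
        ∑ j ∈ Finset.range (m + 1), d.L ^ (m - j) * Y * d.L ^ j :=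
      Finset.sum_congr rfl fun j hj => by
        have hj := Finset.mem_range.mp hj
        rw [show m + 1 - 1 - j = m - j by omega, show m - (m - j) = j by omega]
    rw [e0, Finset.mul_sum, Finset.sum_mul, ← Finset.sum_sub_distrib]
    -- Each bracket is a difference of consecutive weighted terms minus one unweighted term, so the
    -- sum telescopes.
    have e1 : ∀ l ∈ Finset.range m, d.L * ((m - l) • (d.L ^ (m - 1 - l) * Y * d.L ^ l)) -
        (m - l) • (d.L ^ (m - 1 - l) * Y * d.L ^ l) * d.L =
        ((m - l) • (d.L ^ (m - l) * Y * d.L ^ l) -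
          (m - (l + 1)) • (d.L ^ (m - (l + 1)) * Y * d.L ^ (l + 1))) -
          d.L ^ (m - (l + 1)) * Y * d.L ^ (l + 1) := by
      intro l hl
      have hl := Finset.mem_range.mp hl
      obtain ⟨q, hq⟩ : ∃ q, m = l + 1 + q := ⟨m - (l + 1), by omega⟩
      rw [show m - l = q + 1 by omega, show m - 1 - l = q by omega,
        show m - (l + 1) = q by omega, mul_smul_comm, smul_mul_assoc, pow_succ' d.L q,
        pow_succ d.L l]
      simp only [mul_assoc, add_smul, one_smul]
      abel
    rw [Finset.sum_congr rfl e1, Finset.sum_sub_distrib, Finset.sum_range_sub',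
      Finset.sum_range_succ' (fun j => d.L ^ (m - j) * Y * d.L ^ j)]
    simp only [Nat.sub_zero, pow_zero, mul_one, Nat.sub_self, zero_smul, sub_zero]
    rw [succ_nsmul]
    abel
  have e := hS m
  have hA : d.adInv Y = d.r *
      ∑ l ∈ Finset.range m, (m - l) • (d.L ^ (m - 1 - l) * Y * d.L ^ l) := by
    rw [adInv, hm]
    refine congrArg _ (Finset.sum_congr rfl fun l _ => ?_)
    rw [show m + 1 - 1 - l = m - l by omega, show m + 1 - 2 - l = m - 1 - l by omega]
  have hinv := congrArg (fun z => z * Y) d.inv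
  simp only [one_mul, mul_assoc] at hinv
  rw [hA, ← mul_assoc, ← d.comm.eq, mul_assoc, mul_assoc, ← mul_sub, e, proj, divDiff]
  have hY : ∀ X, Y - d.r * X = d.r * ((d.N • d.L ^ (d.N - 1) - d.c • (1 : R)) * Y - X) :=
    fun X => by rw [mul_sub, hinv]
  rw [hY, hm]
  simp only [Nat.add_sub_cancel, sub_mul, smul_mul_assoc, one_mul]
  congr 1
  abel

theorem proj_mem {k : ℤ} {Y : R} (h : Y ∈ d.Gr k) : d.proj Y ∈ d.Gr k := by
  rw [proj, divDiff, mul_sub, Finset.mul_sum]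
  refine sub_mem (sum_mem fun a ha => ?_) ?_
  · have ha := Finset.mem_range.mp ha
    convert d.mul_mem d.r_mem (d.mul_mem (d.mul_mem (d.pow_mem a) h) (d.pow_mem (d.N - 1 - a)))
      using 1
    have : ((d.N - 1 - a : ℕ) : ℤ) = d.N - 1 - a := by omega
    rw [this]
    congr 1
    ring
  · rw [mul_smul_comm, ← smul_mul_assoc]
    simpa using d.mul_mem d.c_smul_r_mem h

theorem adInv_mem {k : ℤ} {Y : R} (h : Y ∈ d.Gr k) : d.adInv Y ∈ d.Gr (k - 1) := by
  rw [adInv, Finset.mul_sum]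
  refine sum_mem fun l hl => ?_
  have hl := Finset.mem_range.mp hl
  rw [mul_smul_comm]
  refine nsmul_mem ?_ _
  convert d.mul_mem d.r_mem (d.mul_mem (d.mul_mem (d.pow_mem (d.N - 2 - l)) h) (d.pow_mem l))
    using 1
  have : ((d.N - 2 - l : ℕ) : ℤ) = d.N - 2 - l := by omega
  rw [this]
  congr 1
  ring

/-- At each order the equation has the form `[L, T_{k+1}] = F_k - Z_k`, where `Z_k` involves only
`T_i` with `i ≤ k` and `F_l` with `l < k`. The splitting gives `F_k = proj Z_k` and `T_{k+1} =
-adInv Z_k`. All steps respect the filtration. -/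
theorem exists_dressing_coeff (U : ℕ → R) (hU : ∀ k : ℕ, U k ∈ d.Gr (-k)) :
    ∃ T F : ℕ → R, T 0 = 1 ∧ (∀ k, Commute d.L (F k)) ∧ (∀ k : ℕ, T k ∈ d.Gr (-k)) ∧
      (∀ k : ℕ, F k ∈ d.Gr (-k)) ∧ ∀ k, d.D (T k) + (d.L * T (k + 1) - T (k + 1) * d.L) +
        ∑ l ∈ Finset.range (k + 1), U l * T (k - l) -
        ∑ l ∈ Finset.range (k + 1), T (k - l) * F l = 0 := by
  -- The recursion runs on the single sequence `Z`, from which both `T` and `F` are read off.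
  let T : (ℕ → R) → ℕ → R := fun f i => if i = 0 then 1 else -d.adInv (f (i - 1))
  let G : ℕ → (ℕ → R) → R := fun k f => d.D (T f k) +
    ∑ l ∈ Finset.range (k + 1), U l * T f (k - l) -
    ∑ l ∈ Finset.range k, T f (k - l) * d.proj (f l)
  have : Inhabited R := ⟨0⟩
  obtain ⟨Z, hZ⟩ := exists_strong_rec G (by
    intro k f g h
    have hT : ∀ i ≤ k, T f i = T g i := by
      intro i hi
      by_cases h0 : i = 0
      · simp [T, h0]
      · simp only [T, h0, if_false]
        rw [h (i - 1) (by omega)]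
    simp only [G]
    rw [hT k le_rfl]
    congr 1
    · congr 1
      exact Finset.sum_congr rfl fun l _ => by rw [hT (k - l) (by omega)]
    · exact Finset.sum_congr rfl fun l hl => by
        rw [hT (k - l) (by omega), h l (Finset.mem_range.mp hl)])
  have hT0 : T Z 0 = 1 := by simp [T]
  have hT1 : ∀ k, T Z (k + 1) = -d.adInv (Z k) := fun k => by simp [T]
  have hZm : ∀ k : ℕ, Z k ∈ d.Gr (-k) := by
    intro k
    induction k using Nat.strong_induction_on with
    | _ k ih =>
      have hT : ∀ i ≤ k, T Z i ∈ d.Gr (-i) := by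
        intro i hi
        cases i with
        | zero => rw [hT0]; simpa using d.one_mem
        | succ i =>
          rw [hT1]
          convert neg_mem (d.adInv_mem (ih i (by omega))) using 2
          push_cast; ring
      rw [hZ k]
      refine sub_mem (add_mem (d.D_mem (hT k le_rfl)) (sum_mem fun l hl => ?_))
        (sum_mem fun l hl => ?_)
      · have hl := Finset.mem_range.mp hl
        convert d.mul_mem (hU l) (hT (k - l) (by omega)) using 2
        omega
      · have hl := Finset.mem_range.mp hl
        convert d.mul_mem (hT (k - l) (by omega)) (d.proj_mem (ih l hl)) using 2
        omega
  refine ⟨T Z, fun k => d.proj (Z k), hT0, fun k => d.commute_proj _, fun k => ?_,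
    fun k => d.proj_mem (hZm k), fun k => ?_⟩
  · cases k with
    | zero => rw [hT0]; simpa using d.one_mem
    | succ k =>
      rw [hT1]
      convert neg_mem (d.adInv_mem (hZm k)) using 2
      push_cast; ring
  · have h1 := d.bracket_adInv (Z k)
    have h2 := hZ k
    simp only [G] at h2
    rw [Finset.sum_range_succ (fun l => T Z (k - l) * d.proj (Z l)), Nat.sub_self, hT0, hT1, one_mul]
    have h3 : d.L * -d.adInv (Z k) - -d.adInv (Z k) * d.L = -(Z k - d.proj (Z k)) := by
      rw [← h1]; simp only [mul_neg, neg_mul]; abel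
    rw [h3]
    have h4 : ∀ a b p q s : R, b = a + p - q → a + -(b - s) + p - (q + s) = 0 := by
      intro a b p q s h; rw [h]; abel
    exact h4 _ _ _ _ _ h2

end SeparableDatum

/-! ### Dressing series and uniqueness of the dressed solution. -/

namespace SeparableDatum

variable {R : Type*} [Ring R] (d : SeparableDatum R)

/-- The leading term `t L`; the series are in powers of `t⁻¹`. -/
def lead : LaurentSeries R := HahnSeries.single (-1) d.L

/-- The coefficientwise derivation. -/
def deriv : LaurentSeries R →+ LaurentSeries R := coeffMap d.D

theorem deriv_mul (X Y : LaurentSeries R) :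
    d.deriv (X * Y) = d.deriv X * Y + X * d.deriv Y := coeffMap_leibniz d.D d.leibniz X Y

variable {d} in
theorem _root_.IsotropicFlow.VanishBelow.deriv {X : LaurentSeries R} {m : ℤ}
    (h : VanishBelow m X) : VanishBelow m (d.deriv X) := h.coeffMap d.D

theorem deriv_lead : d.deriv d.lead = 0 := by
  rw [deriv, lead, coeffMap_single, d.D_L, map_zero]

theorem coeff_lead_mul (X : LaurentSeries R) (k : ℤ) :
    (d.lead * X).coeff k = d.L * X.coeff (k + 1) := by
  rw [lead, HahnSeries.coeff_single_mul, sub_neg_eq_add]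

theorem coeff_mul_lead (X : LaurentSeries R) (k : ℤ) :
    (X * d.lead).coeff k = X.coeff (k + 1) * d.L := by
  rw [lead, HahnSeries.coeff_mul_single, sub_neg_eq_add]

/-- The homogeneous Laurent series. -/
def IsGraded (X : LaurentSeries R) : Prop := ∀ k, X.coeff k ∈ d.Gr (-k)

variable {d}

variable (d)

/-- A series `T = 1 + ⋯` that conjugates `∂ + t L + U` to `∂ + t L + F`, where `F` commutes
with `L`. -/
structure Dressing (U : LaurentSeries R) where
  T : (LaurentSeries R)ˣ
  F : LaurentSeries R
  below : VanishBelow 0 (T : LaurentSeries R)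
  coeff_zero : (T : LaurentSeries R).coeff 0 = 1
  graded : d.IsGraded T
  below_inv : VanishBelow 0 ((T⁻¹ : (LaurentSeries R)ˣ) : LaurentSeries R)
  coeff_zero_inv : ((T⁻¹ : (LaurentSeries R)ˣ) : LaurentSeries R).coeff 0 = 1
  graded_inv : d.IsGraded ((T⁻¹ : (LaurentSeries R)ˣ) : LaurentSeries R)
  below_F : VanishBelow 0 F
  commute_F : Commute d.lead F
  eqn : d.deriv T + (d.lead + U) * T = T * (d.lead + F)

theorem vanishBelow_ofPowerSeries (f : PowerSeries R) :
    VanishBelow 0 (HahnSeries.ofPowerSeries ℤ R f) := fun i hi => by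
  rw [HahnSeries.ofPowerSeries_apply, HahnSeries.embDomain_of_notMem_range]
  rintro ⟨k, hk⟩
  have hk' : (k : ℤ) = i := hk
  omega

theorem exists_dressing (U : LaurentSeries R) (hU0 : VanishBelow 0 U) (hU : d.IsGraded U) :
    Nonempty (d.Dressing U) := by
  obtain ⟨T, F, hT0, hF, hTg, hFg, h⟩ := d.exists_dressing_coeff (fun k => U.coeff k)
    fun k => hU k
  have hc : PowerSeries.constantCoeff (PowerSeries.mk T) = ((1 : Rˣ) : R) := by
    rw [← PowerSeries.coeff_zero_eq_constantCoeff_apply, PowerSeries.coeff_mk, hT0, Units.val_one]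
  let S := PowerSeries.invOfUnit (PowerSeries.mk T) 1
  have hTS : PowerSeries.mk T * S = 1 := PowerSeries.mul_invOfUnit _ _ hc
  have hST : S * PowerSeries.mk T = 1 := PowerSeries.invOfUnit_mul _ _ hc
  let φ := HahnSeries.ofPowerSeries ℤ R
  let T' : (LaurentSeries R)ˣ :=
    ⟨φ (PowerSeries.mk T), φ S, by rw [← map_mul, hTS, map_one], by rw [← map_mul, hST, map_one]⟩
  have cT : ∀ k : ℕ, (φ (PowerSeries.mk T)).coeff k = T k := fun k => by
    simp only [φ, HahnSeries.ofPowerSeries_apply_coeff, PowerSeries.coeff_mk]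
  have cF : ∀ k : ℕ, (φ (PowerSeries.mk F)).coeff k = F k := fun k => by
    simp only [φ, HahnSeries.ofPowerSeries_apply_coeff, PowerSeries.coeff_mk]
  have b : ∀ f, VanishBelow 0 (φ f) := vanishBelow_ofPowerSeries
  have hS0 : (φ S).coeff 0 = 1 := by
    have := HahnSeries.ofPowerSeries_apply_coeff (Γ := ℤ) S 0
    rw [Nat.cast_zero] at this
    rw [this, PowerSeries.coeff_zero_eq_constantCoeff_apply]
    exact PowerSeries.constantCoeff_invOfUnit _ _
  have cast_sum : ∀ {X Y : LaurentSeries R}, VanishBelow 0 X → VanishBelow 0 Y → ∀ k : ℕ,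
      (X * Y).coeff k = ∑ l ∈ Finset.range (k + 1), X.coeff l * Y.coeff ((k - l : ℕ) : ℤ) := by
    intro X Y hX hY k
    rw [coeff_mul_Icc hX hY]
    symm
    refine Finset.sum_bij (fun l _ => (l : ℤ)) ?_ ?_ ?_ ?_
    · intro l hl; rw [Finset.mem_range] at hl; rw [Finset.mem_Icc]; omega
    · intro l _ l' _ e; exact_mod_cast e
    · intro i hi
      rw [Finset.mem_Icc] at hi
      exact ⟨i.toNat, by rw [Finset.mem_range]; omega, by omega⟩
    · intro l hl
      rw [Finset.mem_range] at hl
      rw [Nat.cast_sub (by omega)]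
  have gT : d.IsGraded (φ (PowerSeries.mk T)) := by
    intro k
    by_cases hk : k < 0
    · rw [b _ k hk]; exact zero_mem _
    · obtain ⟨m, rfl⟩ := Int.eq_ofNat_of_zero_le (not_lt.mp hk)
      rw [cT]; exact hTg m
  -- Homogeneity of the inverse follows recursively from the coefficients of `T S = 1`, because the
  -- constant coefficient of `T` is `1`.
  have gS : d.IsGraded (φ S) := by
    have hn : ∀ m : ℕ, (φ S).coeff m ∈ d.Gr (-m) := by
      intro m
      induction m using Nat.strong_induction_on with
      | _ m ih =>
        cases m with
        | zero => rw [Nat.cast_zero, hS0]; simpa using d.one_mem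
        | succ m =>
          have h1 : (φ (PowerSeries.mk T) * φ S).coeff ((m + 1 : ℕ) : ℤ) = 0 := by
            rw [← map_mul, hTS, map_one]
            exact HahnSeries.coeff_single_of_ne (by omega)
          rw [cast_sum (b _) (b _), Finset.sum_range_succ'] at h1
          rw [cT 0, hT0, one_mul, Nat.sub_zero] at h1
          rw [eq_neg_of_add_eq_zero_right h1]
          refine neg_mem (sum_mem fun l hl => ?_)
          have hl := Finset.mem_range.mp hl
          convert d.mul_mem (gT ((l + 1 : ℕ) : ℤ)) (ih (m + 1 - (l + 1)) (by omega)) using 2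
          omega
    intro k
    by_cases hk : k < 0
    · rw [b _ k hk]; exact zero_mem _
    · obtain ⟨m, rfl⟩ := Int.eq_ofNat_of_zero_le (not_lt.mp hk)
      exact hn m
  refine ⟨⟨T', φ (PowerSeries.mk F), b _, ?_, gT, b _, hS0, gS, b _, ?_, ?_⟩⟩
  · have := cT 0
    rw [Nat.cast_zero, hT0] at this
    exact this
  · ext k
    rw [coeff_lead_mul, coeff_mul_lead]
    by_cases hk : k + 1 < 0
    · rw [b _ _ hk, mul_zero, zero_mul]
    · obtain ⟨m, hm⟩ := Int.eq_ofNat_of_zero_le (not_lt.mp hk)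
      rw [hm]
      change d.L * (φ (PowerSeries.mk F)).coeff (m : ℤ) = (φ (PowerSeries.mk F)).coeff (m : ℤ) * d.L
      rw [cF]
      exact hF m
  · change d.deriv (φ (PowerSeries.mk T)) + (d.lead + U) * φ (PowerSeries.mk T) =
      φ (PowerSeries.mk T) * (d.lead + φ (PowerSeries.mk F))
    ext k
    rw [add_mul, mul_add, HahnSeries.coeff_add, HahnSeries.coeff_add, HahnSeries.coeff_add,
      coeff_lead_mul, coeff_mul_lead]
    by_cases hk : k < 0
    · rw [(b (PowerSeries.mk T)).deriv k hk,
        (hU0.mul (b (PowerSeries.mk T))) k (by simpa using hk),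
        ((b (PowerSeries.mk T)).mul (b (PowerSeries.mk F))) k (by simpa using hk)]
      by_cases hk1 : k = -1
      · have := cT 0
        rw [Nat.cast_zero, hT0] at this
        rw [hk1, neg_add_cancel, this]
        simp
      · rw [b _ (k + 1) (by omega)]
        simp
    · obtain ⟨m, rfl⟩ := Int.eq_ofNat_of_zero_le (not_lt.mp hk)
      change d.D ((φ (PowerSeries.mk T)).coeff (m : ℤ)) + (d.L * (φ (PowerSeries.mk T)).coeff _ +
        (U * φ (PowerSeries.mk T)).coeff (m : ℤ)) = (φ (PowerSeries.mk T)).coeff _ * d.L +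
        (φ (PowerSeries.mk T) * φ (PowerSeries.mk F)).coeff (m : ℤ)
      rw [cast_sum hU0 (b _), cast_sum (b _) (b _), cT m]
      have e1 : (φ (PowerSeries.mk T)).coeff ((m : ℤ) + 1) = T (m + 1) := by
        rw [← cT (m + 1)]; congr 1
      rw [e1]
      simp only [cT, cF]
      rw [← Finset.sum_range_reflect (fun l => T l * F (m - l))]
      have e2 : ∑ j ∈ Finset.range (m + 1), T (m + 1 - 1 - j) * F (m - (m + 1 - 1 - j)) =
          ∑ j ∈ Finset.range (m + 1), T (m - j) * F j :=
        Finset.sum_congr rfl fun j hj => by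
          have hj := Finset.mem_range.mp hj
          rw [show m + 1 - 1 - j = m - j by omega, show m - (m - j) = j by omega]
      rw [e2, ← sub_eq_zero, ← h m]
      abel

variable {d}

/-- `W = [t L, V]` solves the same equation, because `F` commutes with `t L`. Its leading
coefficient therefore commutes with `L`; it also lies in the image of `ad L`, so it is zero. -/
theorem commute_lead_of_bracket {F V : LaurentSeries R} (hF0 : VanishBelow 0 F)
    (hF : Commute d.lead F) (hV : d.deriv V + (d.lead + F) * V - V * (d.lead + F) = 0) :
    Commute d.lead V := by
  set W := d.lead * V - V * d.lead with hW
  have hV' : d.deriv V = V * (d.lead + F) - (d.lead + F) * V := by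
    rw [← sub_eq_zero, ← hV]; abel
  have e0 : F * d.lead = d.lead * F := hF.eq.symm
  have e1 : ∀ Z, F * (d.lead * Z) = d.lead * (F * Z) := fun Z => by
    rw [← mul_assoc, e0, mul_assoc]
  have hW' : d.deriv W + (d.lead + F) * W - W * (d.lead + F) = 0 := by
    rw [hW, map_sub, deriv_mul, deriv_mul, deriv_lead, hV']
    simp only [mul_add, add_mul, mul_sub, sub_mul, mul_assoc, e0, e1, zero_mul, mul_zero]
    abel
  suffices W = 0 from sub_eq_zero.mp this
  refine eq_zero_of_vanishBelow fun m hm => ?_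
  have hc : d.L * W.coeff m - W.coeff m * d.L = 0 := by
    have := congrArg (fun X => HahnSeries.coeff X (m - 1)) hW'
    simp only [add_mul, mul_add, HahnSeries.coeff_sub, HahnSeries.coeff_add, coeff_lead_mul,
      coeff_mul_lead, HahnSeries.coeff_zero] at this
    rw [hm.deriv (m - 1) (by omega), (hF0.mul hm) (m - 1) (by omega),
      (hm.mul hF0) (m - 1) (by omega), sub_add_cancel] at this
    simpa using this
  have hWm : W.coeff m = d.L * V.coeff (m + 1) - V.coeff (m + 1) * d.L := by
    rw [hW, HahnSeries.coeff_sub, coeff_lead_mul, coeff_mul_lead]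
  rw [hWm]
  refine d.eq_zero_of_commute_bracket ?_
  rw [← hWm]
  exact sub_eq_zero.mp hc

theorem commute_coeff {V : LaurentSeries R} (h : Commute d.lead V) (k : ℤ) :
    Commute d.L (V.coeff k) := by
  have := congrArg (fun X => HahnSeries.coeff X (k - 1)) h.eq
  change d.L * V.coeff k = V.coeff k * d.L
  simpa [coeff_lead_mul, coeff_mul_lead] using this

variable (d)

/-- The polynomial relation that is satisfied by `t L`. -/
def Rel (V : LaurentSeries R) : Prop :=
  V ^ d.N = d.c • (HahnSeries.single (1 - (d.N : ℤ)) (1 : R) * V) +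
    (1 - d.c) • HahnSeries.single (-(d.N : ℤ)) (1 : R)

theorem rel_lead : d.Rel d.lead := by
  rw [Rel, lead, HahnSeries.single_pow, HahnSeries.single_mul_single, d.rel, one_mul]
  have e1 : d.N • (-1 : ℤ) = -(d.N : ℤ) := by simp
  have e2 : 1 - (d.N : ℤ) + -1 = -(d.N : ℤ) := by ring
  rw [e1, e2]
  ext k
  simp only [HahnSeries.coeff_add, HahnSeries.coeff_smul]
  by_cases h : k = -(d.N : ℤ)
  · subst h; simp
  · simp [HahnSeries.coeff_single_of_ne h]

variable {d}

theorem rel_iff_of_eq_zero (hc : d.c = 0) (V : LaurentSeries R) :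
    d.Rel V ↔ V ^ d.N = HahnSeries.single (-(d.N : ℤ)) (1 : R) := by
  rw [Rel, hc, zero_smul, zero_add, sub_zero, one_smul]

theorem rel_iff_of_eq_one (hc : d.c = 1) (V : LaurentSeries R) :
    d.Rel V ↔ V ^ d.N = HahnSeries.single (1 - (d.N : ℤ)) (1 : R) * V := by
  rw [Rel, hc, one_smul, sub_self, zero_smul, add_zero]

theorem Rel.conj {V : LaurentSeries R} (h : d.Rel V) (T : (LaurentSeries R)ˣ) :
    d.Rel (T * V * (T⁻¹ : (LaurentSeries R)ˣ)) := by
  have e : (T * V * (T⁻¹ : (LaurentSeries R)ˣ) : LaurentSeries R) ^ d.N =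
      T * V ^ d.N * (T⁻¹ : (LaurentSeries R)ˣ) := Units.conj_pow T V d.N
  rw [Rel, e, h, mul_add, add_mul, mul_smul_comm, mul_smul_comm, smul_mul_assoc, smul_mul_assoc,
    ← mul_assoc (T : LaurentSeries R), ← (commute_single_one _ _).eq,
    ← (commute_single_one (T : LaurentSeries R) _).eq, mul_assoc _ (T : LaurentSeries R),
    mul_assoc _ (T : LaurentSeries R), Units.mul_inv, mul_one, mul_assoc]

/-- Two commuting roots of the same polynomial satisfy `(V - t L) Q = 0`, where `Q` is its divided
difference. The leading coefficient of `Q` is the derivative at `L`, a unit by separability, so `Q`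
can be cancelled. -/
theorem eq_lead_of_commute {V : LaurentSeries R} (hV : Commute d.lead V) (hR : d.Rel V)
    (h0 : VanishBelow 0 (V - d.lead)) : V = d.lead := by
  set Q := ∑ a ∈ Finset.range d.N, V ^ a * d.lead ^ (d.N - 1 - a) -
    d.c • HahnSeries.single (1 - (d.N : ℤ)) (1 : R) with hQ
  have hWQ : (V - d.lead) * Q = 0 := by
    rw [hQ, mul_sub, hV.symm.mul_geom_sum₂, hR, d.rel_lead, mul_smul_comm, sub_mul,
      (commute_single_one V _).eq, (commute_single_one d.lead _).eq, smul_sub]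
    abel
  have b1 : VanishBelow (-1) d.lead := vanishBelow_single _ _
  have b2 : VanishBelow (-1) V := by
    have := (h0.mono (by norm_num : (-1 : ℤ) ≤ 0)).add b1
    rwa [sub_add_cancel] at this
  have c2 : V.coeff (-1) = d.L := by
    have := h0 (-1) (by norm_num)
    rw [HahnSeries.coeff_sub, sub_eq_zero] at this
    rw [this, lead, HahnSeries.coeff_single_same]
  have hterm : ∀ a ∈ Finset.range d.N, VanishBelow (1 - (d.N : ℤ)) (V ^ a * d.lead ^ (d.N - 1 - a)) ∧
      (V ^ a * d.lead ^ (d.N - 1 - a)).coeff (1 - (d.N : ℤ)) = d.L ^ (d.N - 1) := by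
    intro a ha
    have ha := Finset.mem_range.mp ha
    have e : (1 - (d.N : ℤ)) = (a : ℤ) * (-1) + ((d.N - 1 - a : ℕ) : ℤ) * (-1) := by omega
    constructor
    · rw [e]; exact (b2.pow a).mul (b1.pow _)
    · rw [IsotropicFlow.coeff_mul_lead (b2.pow a) (b1.pow _) e, coeff_pow_lead b2,
        coeff_pow_lead b1, c2, lead, HahnSeries.coeff_single_same, ← pow_add,
        show a + (d.N - 1 - a) = d.N - 1 by omega]
  have bQ : VanishBelow (1 - (d.N : ℤ)) Q := by
    intro i hi
    rw [hQ, HahnSeries.coeff_sub, HahnSeries.coeff_sum, HahnSeries.coeff_smul,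
      HahnSeries.coeff_single_of_ne hi.ne, smul_zero, sub_zero]
    exact Finset.sum_eq_zero fun a ha => (hterm a ha).1 i hi
  have cQ : Q.coeff (1 - (d.N : ℤ)) = d.N • d.L ^ (d.N - 1) - d.c • (1 : R) := by
    rw [hQ, HahnSeries.coeff_sub, HahnSeries.coeff_sum, HahnSeries.coeff_smul,
      HahnSeries.coeff_single_same, Finset.sum_congr rfl fun a ha => (hterm a ha).2]
    simp
  have hinv : (d.N • d.L ^ (d.N - 1) - d.c • (1 : R)) * d.r = 1 := by
    have hc : Commute d.r (d.N • d.L ^ (d.N - 1) - d.c • (1 : R)) :=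
      ((d.comm.pow_right _).smul_right _).sub_right ((Commute.one_right _).smul_right _)
    rw [← hc.eq, d.inv]
  refine sub_eq_zero.mp (eq_zero_of_vanishBelow fun m hm => ?_)
  have := IsotropicFlow.coeff_mul_lead hm bQ (a := m + (1 - (d.N : ℤ))) rfl
  rw [hWQ, HahnSeries.coeff_zero, cQ] at this
  have := congrArg (fun z => z * d.r) this
  simp only [mul_assoc, hinv, mul_one, zero_mul] at this
  exact this.symm

namespace Dressing

variable {U : LaurentSeries R} (e : d.Dressing U)

theorem deriv_T : d.deriv e.T = e.T * (d.lead + e.F) - (d.lead + U) * e.T :=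
  eq_sub_of_add_eq e.eqn

/-- The solution `T (t L) T⁻¹` of the zero curvature equation. -/
def sol : LaurentSeries R := e.T * d.lead * (e.T⁻¹ : (LaurentSeries R)ˣ)

theorem sol_mul : e.sol * e.T = e.T * d.lead := by
  rw [sol, mul_assoc, Units.inv_mul, mul_one]

theorem rel_sol : d.Rel e.sol := d.rel_lead.conj e.T

theorem bracket_sol : d.deriv e.sol + (d.lead + U) * e.sol - e.sol * (d.lead + U) = 0 := by
  have h1 := congrArg d.deriv e.sol_mul
  have hF : e.F * d.lead = d.lead * e.F := e.commute_F.eq.symm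
  have h3 : ∀ Z, e.sol * (e.T * Z) = e.T * (d.lead * Z) := fun Z => by
    rw [← mul_assoc, e.sol_mul, mul_assoc]
  rw [d.deriv_mul, d.deriv_mul, d.deriv_lead, mul_zero, add_zero, e.deriv_T] at h1
  have h2 : (d.deriv e.sol + (d.lead + U) * e.sol - e.sol * (d.lead + U)) * e.T = 0 := by
    rw [sub_mul, add_mul, eq_sub_of_add_eq h1]
    simp only [mul_add, add_mul, mul_sub, sub_mul, mul_assoc, hF, h3, e.sol_mul]
    abel
  exact (Units.mul_left_eq_zero e.T).mp h2

theorem vanishBelow_conj {X : LaurentSeries R} {m : ℤ} (hX : VanishBelow m X) :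
    VanishBelow m ((e.T⁻¹ : (LaurentSeries R)ˣ) * X * e.T : LaurentSeries R) ∧
      ((e.T⁻¹ : (LaurentSeries R)ˣ) * X * e.T : LaurentSeries R).coeff m = X.coeff m := by
  have b := e.below_inv.mul hX
  constructor
  · simpa using b.mul e.below
  · rw [IsotropicFlow.coeff_mul_lead b e.below (by ring), zero_add,
      IsotropicFlow.coeff_mul_lead e.below_inv hX (by ring), e.coeff_zero, e.coeff_zero_inv,
      one_mul, mul_one]

/-- Dressing turns the equation for `∂ + t L + U` into the one for `∂ + t L + F`, to which
`commute_lead_of_bracket` applies. -/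
theorem commute_conj {X : LaurentSeries R}
    (hX : d.deriv X + (d.lead + U) * X - X * (d.lead + U) = 0) :
    Commute d.lead ((e.T⁻¹ : (LaurentSeries R)ˣ) * X * e.T) := by
  obtain ⟨V, hVdef⟩ : ∃ V : LaurentSeries R, V = (e.T⁻¹ : (LaurentSeries R)ˣ) * X * e.T := ⟨_, rfl⟩
  rw [← hVdef]
  have hTV : e.T * V = X * e.T := by rw [hVdef, ← mul_assoc, ← mul_assoc, Units.mul_inv, one_mul]
  refine commute_lead_of_bracket e.below_F e.commute_F ?_
  have h1 := congrArg d.deriv hTV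
  have hX' : d.deriv X = X * (d.lead + U) - (d.lead + U) * X := by
    rw [← sub_eq_zero, ← hX]; abel
  have h3 : ∀ Z, e.T * (V * Z) = X * (e.T * Z) := fun Z => by
    rw [← mul_assoc, hTV, mul_assoc]
  rw [d.deriv_mul, d.deriv_mul, e.deriv_T, hX'] at h1
  have h2 : (e.T : LaurentSeries R) *
      (d.deriv V + (d.lead + e.F) * V - V * (d.lead + e.F)) = 0 := by
    rw [mul_sub, mul_add, eq_sub_of_add_eq' h1]
    simp only [mul_add, add_mul, mul_sub, sub_mul, mul_assoc, h3, hTV]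
    abel
  exact (Units.mul_right_eq_zero e.T).mp h2

theorem rel_conj {X : LaurentSeries R} (h : d.Rel X) :
    d.Rel ((e.T⁻¹ : (LaurentSeries R)ˣ) * X * e.T) := by
  have := h.conj e.T⁻¹
  rwa [inv_inv] at this

theorem vanishBelow_sol_sub : VanishBelow 0 (e.sol - d.lead) := by
  have b1 : VanishBelow (-1) d.lead := vanishBelow_single _ _
  have b2 : VanishBelow (-1) e.sol := by
    have := (e.below.mul b1).mul e.below_inv
    rwa [zero_add, add_zero] at this
  have c2 : e.sol.coeff (-1) = d.L := by
    rw [sol, IsotropicFlow.coeff_mul_lead (e.below.mul b1) e.below_inv (by norm_num),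
      zero_add, IsotropicFlow.coeff_mul_lead e.below b1 (by norm_num), e.coeff_zero,
      e.coeff_zero_inv, one_mul, mul_one, lead, HahnSeries.coeff_single_same]
  intro i hi
  by_cases h : i = -1
  · rw [h, HahnSeries.coeff_sub, c2, lead, HahnSeries.coeff_single_same, sub_self]
  · rw [HahnSeries.coeff_sub, b2 i (by omega), b1 i (by omega), sub_zero]

theorem eq_sol_of_conj_eq {X : LaurentSeries R}
    (h : ((e.T⁻¹ : (LaurentSeries R)ˣ) * X * e.T : LaurentSeries R) = d.lead) : X = e.sol := by
  rw [sol, ← h]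
  simp only [mul_assoc, Units.mul_inv, mul_one]
  rw [← mul_assoc, Units.mul_inv, one_mul]

theorem eq_sol {X : LaurentSeries R}
    (hX : d.deriv X + (d.lead + U) * X - X * (d.lead + U) = 0) (hR : d.Rel X)
    (h0 : VanishBelow 0 (X - d.lead)) : X = e.sol := by
  refine e.eq_sol_of_conj_eq (eq_lead_of_commute (e.commute_conj hX) (e.rel_conj hR) ?_)
  have b1 : VanishBelow (-1) d.lead := vanishBelow_single _ _
  have b2 : VanishBelow (-1) X := by
    have := (h0.mono (by norm_num : (-1 : ℤ) ≤ 0)).add b1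
    rwa [sub_add_cancel] at this
  have := e.vanishBelow_conj b2
  intro i hi
  by_cases h : i = -1
  · have h0 := h0 i hi
    rw [h, HahnSeries.coeff_sub] at h0 ⊢
    rw [this.2, h0]
  · rw [HahnSeries.coeff_sub, this.1 i (by omega), b1 i (by omega), sub_zero]

end Dressing

end SeparableDatum

/-! ### Matrices over an algebra: cyclic vectors, gradings and the adjoint. -/

section Matrices

variable {n : ℕ}

theorem elem_apply (i j : ℕ) (a b : Fin (2 * n + 1)) :
    elem n i j a b = if (a : ℕ) + 1 = i ∧ (b : ℕ) + 1 = j then 1 else 0 := rfl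

theorem bMat_apply (i j : Fin (2 * n + 1)) :
    bMat n i j = if (i : ℕ) = j + 1 then 1 else 0 := by
  rw [bMat, Matrix.sum_apply]
  simp only [elem_apply]
  by_cases h : (i : ℕ) = j + 1
  · rw [Finset.sum_eq_single ((j : ℕ) + 1)]
    · simp [h]
    · intro k _ hk
      rw [if_neg]
      rintro ⟨_, h2⟩
      exact hk h2.symm
    · intro hk
      exfalso
      refine hk (Finset.mem_Icc.mpr ⟨by omega, ?_⟩)
      have := i.isLt
      omega
  · rw [if_neg h]
    refine Finset.sum_eq_zero fun k _ => if_neg ?_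
    rintro ⟨h1, h2⟩
    omega

theorem rev_pos (i : Fin (2 * n + 1)) : ((Fin.rev i : Fin (2 * n + 1)) : ℕ) + i = 2 * n := by
  rw [Fin.val_rev]
  have := i.isLt
  omega

theorem Cmat_apply (i j : Fin (2 * n + 1)) :
    Cmat n i j = if j = Fin.rev i then (-1) ^ (n + (i : ℕ)) else 0 := by
  rw [Cmat, Matrix.sum_apply]
  simp only [Matrix.smul_apply, elem_apply, smul_eq_mul]
  have hi := i.isLt
  have hj := j.isLt
  rw [Finset.sum_eq_single ((i : ℕ) + 1)]
  · rw [show n + ((i : ℕ) + 1) - 1 = n + i by omega]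
    by_cases h : j = Fin.rev i
    · have h' : (j : ℕ) + 1 = 2 * n + 2 - ((i : ℕ) + 1) := by
        rw [h, Fin.val_rev]
        omega
      rw [if_pos h, if_pos ⟨rfl, h'⟩, mul_one]
    · rw [if_neg h, if_neg, mul_zero]
      rintro ⟨_, h2⟩
      apply h
      ext
      rw [Fin.val_rev]
      omega
  · intro k _ hk
    rw [if_neg, mul_zero]
    rintro ⟨h1, _⟩
    exact hk h1.symm
  · intro hk
    exfalso
    exact hk (Finset.mem_Icc.mpr ⟨by omega, by omega⟩)

theorem betaMat_apply (k : ℕ) (h1 : 1 ≤ k) (hk : k ≤ n) (i j : Fin (2 * n + 1)) :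
    betaMat n k i j = if (j : ℕ) = i + (2 * k - 1) ∧ ((i : ℕ) + k = n ∨ (i : ℕ) + k = n + 1)
      then 1 else 0 := by
  rw [betaMat, Matrix.add_apply, elem_apply, elem_apply]
  split_ifs <;> first | omega | norm_num

theorem betaMat_apply_of_ne (k : ℕ) (h1 : 1 ≤ k) (hk : k ≤ n) (i j : Fin (2 * n + 1))
    (h : (j : ℕ) ≠ i + (2 * k - 1)) : betaMat n k i j = 0 := by
  rw [betaMat_apply k h1 hk, if_neg fun h' => h h'.1]

variable {A : Type*} [CommRing A]

/-- Square matrices of size `2n+1` over `A`. -/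
abbrev MatOver (n : ℕ) (A : Type*) : Type _ := Matrix (Fin (2 * n + 1)) (Fin (2 * n + 1)) A

/-- The standard basis vectors, with indices counted from `0` (zero for `k > 2n`). -/
def stdVec (n : ℕ) (A : Type*) [CommRing A] (k : ℕ) : Fin (2 * n + 1) → A :=
  fun i => if (i : ℕ) = k then 1 else 0

theorem mulVec_stdVec (M : MatOver n A) (k : Fin (2 * n + 1)) (i : Fin (2 * n + 1)) :
    (M *ᵥ stdVec n A k) i = M i k := by
  simp [Matrix.mulVec, dotProduct, stdVec, Fin.val_inj]

theorem mulVec_stdVec_zero (M : MatOver n A) (i : Fin (2 * n + 1)) :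
    (M *ᵥ stdVec n A 0) i = M i 0 := mulVec_stdVec M 0 i

theorem ext_mulVec_stdVec {M M' : MatOver n A}
    (h : ∀ k, k ≤ 2 * n → M *ᵥ stdVec n A k = M' *ᵥ stdVec n A k) : M = M' := by
  ext i k
  rw [← mulVec_stdVec M, ← mulVec_stdVec M', h k (by have := k.isLt; omega)]

/-- The first basis vector is cyclic for `L`, so an element of the commutant is determined by its
first column. The correction by `a` in the last power occurs in type B. -/
theorem eq_zero_of_commute_cyclic {L M : MatOver n A} {a : A}
    (hcol : ∀ k, k < 2 * n → L ^ k *ᵥ stdVec n A 0 = stdVec n A k)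
    (hlast : L ^ (2 * n) *ᵥ stdVec n A 0 = stdVec n A (2 * n) + a • stdVec n A 0)
    (hM : Commute L M) (h0 : M *ᵥ stdVec n A 0 = 0) : M = 0 := by
  have hk : ∀ k, M *ᵥ (L ^ k *ᵥ stdVec n A 0) = 0 := fun k => by
    rw [Matrix.mulVec_mulVec, ← (hM.pow_left k).eq, ← Matrix.mulVec_mulVec, h0, Matrix.mulVec_zero]
  refine ext_mulVec_stdVec fun k hk' => ?_
  rw [Matrix.zero_mulVec]
  rcases hk'.lt_or_eq with h | rfl
  · rw [← hcol k h, hk]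
  · have := hk (2 * n)
    rwa [hlast, Matrix.mulVec_add, Matrix.mulVec_smul, h0, smul_zero, add_zero] at this

/-- The matrices whose entries `(i, j)` vanish unless `i - j ≡ k` modulo `h`. -/
def gradedPiece (n : ℕ) (A : Type*) [CommRing A] (h : ℕ) (k : ℤ) : AddSubgroup (MatOver n A) where
  carrier := {M | ∀ i j : Fin (2 * n + 1), ¬ (h : ℤ) ∣ ((i : ℕ) : ℤ) - ((j : ℕ) : ℤ) - k → M i j = 0}
  zero_mem' := fun _ _ _ => rfl
  add_mem' := fun {M M'} hM hM' i j hij => by rw [Matrix.add_apply, hM i j hij, hM' i j hij, add_zero]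
  neg_mem' := fun {M} hM i j hij => by rw [Matrix.neg_apply, hM i j hij, neg_zero]

theorem mul_mem_gradedPiece {h : ℕ} {k l : ℤ} {M M' : MatOver n A} (hM : M ∈ gradedPiece n A h k)
    (hM' : M' ∈ gradedPiece n A h l) : M * M' ∈ gradedPiece n A h (k + l) := by
  intro i j hij
  rw [Matrix.mul_apply]
  refine Finset.sum_eq_zero fun m _ => ?_
  by_cases h1 : (h : ℤ) ∣ ((i : ℕ) : ℤ) - ((m : ℕ) : ℤ) - k
  · rw [hM' m j, mul_zero]
    intro h2
    apply hij
    obtain ⟨a, ha⟩ := h1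
    obtain ⟨b, hb⟩ := h2
    exact ⟨a + b, by linear_combination ha + hb⟩
  · rw [hM i m h1, zero_mul]

theorem one_mem_gradedPiece (h : ℕ) : (1 : MatOver n A) ∈ gradedPiece n A h 0 := by
  intro i j hij
  refine Matrix.one_apply_ne fun e => hij ?_
  rw [e]
  simp

theorem pow_mem_gradedPiece {h : ℕ} {M : MatOver n A} (hM : M ∈ gradedPiece n A h 1) (k : ℕ) :
    M ^ k ∈ gradedPiece n A h k := by
  induction k with
  | zero => simpa using one_mem_gradedPiece h
  | succ k ih => rw [pow_succ]; push_cast; exact mul_mem_gradedPiece ih hM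

theorem gradedPiece_congr {h : ℕ} {k l : ℤ} (hkl : (h : ℤ) ∣ k - l) {M : MatOver n A}
    (hM : M ∈ gradedPiece n A h k) : M ∈ gradedPiece n A h l := by
  intro i j hij
  refine hM i j fun h1 => hij ?_
  obtain ⟨a, ha⟩ := h1
  obtain ⟨b, hb⟩ := hkl
  exact ⟨a + b, by linear_combination ha + hb⟩

variable [Algebra ℝ A]

/-- Real matrices as matrices over an `ℝ`-algebra. -/
def baseChange (n : ℕ) (A : Type*) [CommRing A] [Algebra ℝ A] : Mat n →+* MatOver n A :=
  (algebraMap ℝ A).mapMatrix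

theorem baseChange_apply (M : Mat n) (i j : Fin (2 * n + 1)) :
    baseChange n A M i j = algebraMap ℝ A (M i j) := rfl

theorem baseChange_mem_gradedPiece {h : ℕ} {k : ℤ} {M : Mat n} (hM : M ∈ gradedPiece n ℝ h k) :
    baseChange n A M ∈ gradedPiece n A h k := fun i j hij => by
  rw [baseChange_apply, hM i j hij, map_zero]

theorem baseChange_mulVec_stdVec (M : Mat n) (k : ℕ) :
    baseChange n A M *ᵥ stdVec n A k = fun i => algebraMap ℝ A ((M *ᵥ stdVec n ℝ k) i) := by
  ext i
  simp only [Matrix.mulVec, dotProduct, baseChange_apply, stdVec, map_sum, map_mul]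
  refine Finset.sum_congr rfl fun j _ => ?_
  split_ifs <;> simp

/-- The adjoint `C Mᵗ C` of a matrix `M` with respect to the form. -/
def adj (n : ℕ) (A : Type*) [CommRing A] [Algebra ℝ A] : MatOver n A →+ MatOver n A where
  toFun M := baseChange n A (Cmat n) * Mᵀ * baseChange n A (Cmat n)
  map_zero' := by simp
  map_add' M M' := by simp [mul_add, add_mul]

theorem adj_apply (M : MatOver n A) (i j : Fin (2 * n + 1)) :
    adj n A M i j = (-1) ^ ((i : ℕ) + j) * M (Fin.rev j) (Fin.rev i) := by
  change (baseChange n A (Cmat n) * Mᵀ * baseChange n A (Cmat n)) i j = _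
  rw [Matrix.mul_apply, Finset.sum_eq_single (Fin.rev j)]
  · rw [Matrix.mul_apply, Finset.sum_eq_single (Fin.rev i)]
    · rw [baseChange_apply, baseChange_apply, Cmat_apply, Cmat_apply, if_pos rfl,
        if_pos (Fin.rev_rev j).symm, Matrix.transpose_apply, Fin.val_rev]
      simp only [map_pow, map_neg, map_one]
      rw [mul_right_comm, ← pow_add]
      congr 1
      have hj := j.isLt
      have e : n + (i : ℕ) + (n + (2 * n + 1 - ((j : ℕ) + 1))) + 2 * j = 2 * (2 * n) + (i + j) := by
        omega
      have h2 : ∀ m : ℕ, (-1 : A) ^ (2 * m) = 1 := fun m => by rw [pow_mul]; simp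
      have := congrArg (fun m => (-1 : A) ^ m) e
      simpa only [pow_add _ _ (2 * (j : ℕ)), pow_add _ (2 * (2 * n)), h2, mul_one, one_mul] using this
    · intro l _ hl
      rw [baseChange_apply, Cmat_apply, if_neg hl, map_zero, zero_mul]
    · simp
  · intro l _ hl
    rw [baseChange_apply, Cmat_apply, if_neg, map_zero, mul_zero]
    intro h
    apply hl
    rw [h, Fin.rev_rev]
  · simp

theorem adj_adj (M : MatOver n A) : adj n A (adj n A M) = M := by
  ext i j
  rw [adj_apply, adj_apply, Fin.rev_rev, Fin.rev_rev, Fin.val_rev, Fin.val_rev, ← mul_assoc,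
    ← pow_add]
  have hi := i.isLt
  have hj := j.isLt
  have e : (i : ℕ) + j + (2 * n + 1 - (j + 1) + (2 * n + 1 - (i + 1))) = 2 * (2 * n) := by omega
  rw [e, pow_mul]
  simp

theorem Cmat_mul_Cmat : Cmat n * Cmat n = 1 := by
  ext i j
  rw [Matrix.mul_apply, Finset.sum_eq_single (Fin.rev i)]
  · rw [Cmat_apply, Cmat_apply, if_pos rfl, Fin.rev_rev, Matrix.one_apply]
    by_cases h : j = i
    · rw [if_pos h, if_pos h.symm, ← pow_add]
      have := rev_pos i
      rw [show n + (i : ℕ) + (n + (Fin.rev i : Fin (2 * n + 1))) = 2 * (2 * n) by omega, pow_mul]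
      simp
    · rw [if_neg h, if_neg (Ne.symm h), mul_zero]
  · intro l _ hl
    rw [Cmat_apply, if_neg hl, zero_mul]
  · simp

theorem baseChange_Cmat_mul_self : baseChange n A (Cmat n) * baseChange n A (Cmat n) = 1 := by
  rw [← map_mul, Cmat_mul_Cmat, map_one]

theorem adj_mul (M M' : MatOver n A) : adj n A (M * M') = adj n A M' * adj n A M := by
  change baseChange n A (Cmat n) * (M * M')ᵀ * baseChange n A (Cmat n) =
    baseChange n A (Cmat n) * M'ᵀ * baseChange n A (Cmat n) *
      (baseChange n A (Cmat n) * Mᵀ * baseChange n A (Cmat n))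
  rw [Matrix.transpose_mul]
  simp only [Matrix.mul_assoc]
  rw [← Matrix.mul_assoc (baseChange n A (Cmat n)) (baseChange n A (Cmat n)),
    baseChange_Cmat_mul_self, Matrix.one_mul]

theorem adj_one : adj n A 1 = 1 := by
  change baseChange n A (Cmat n) * 1ᵀ * baseChange n A (Cmat n) = 1
  rw [Matrix.transpose_one, Matrix.mul_one, baseChange_Cmat_mul_self]

theorem adj_baseChange (M : Mat n) :
    adj n A (baseChange n A M) = baseChange n A (adj n ℝ M) := by
  ext i j
  rw [adj_apply, baseChange_apply, baseChange_apply, adj_apply]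
  simp

theorem mem_orthogonalLie_iff (M : Mat n) : M ∈ orthogonalLie n ↔ adj n ℝ M = -M := by
  have e : adj n ℝ M = Cmat n * Mᵀ * Cmat n := rfl
  change Mᵀ * Cmat n + Cmat n * M = 0 ↔ _
  rw [e]
  constructor
  · intro h
    rw [Matrix.mul_assoc, eq_neg_of_add_eq_zero_left h, Matrix.mul_neg, ← Matrix.mul_assoc,
      Cmat_mul_Cmat, Matrix.one_mul]
  · intro h
    have := congrArg (fun X => Cmat n * X) h
    simp only [← Matrix.mul_assoc, Cmat_mul_Cmat, Matrix.one_mul, Matrix.mul_neg] at this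
    rw [this]
    simp

theorem adj_bMat : adj n ℝ (bMat n) = -bMat n := by
  ext i j
  rw [adj_apply, Matrix.neg_apply, bMat_apply, bMat_apply]
  have hi := rev_pos i
  have hj := rev_pos j
  by_cases h : (i : ℕ) = j + 1
  · rw [if_pos (by omega), if_pos h, h, mul_one]
    exact Odd.neg_one_pow ⟨j, by omega⟩
  · rw [if_neg (by omega), if_neg h]
    simp

theorem adj_betaMat (k : ℕ) (h1 : 1 ≤ k) (hk : k ≤ n) : adj n ℝ (betaMat n k) = -betaMat n k := by
  ext i j
  rw [adj_apply, Matrix.neg_apply, betaMat_apply k h1 hk, betaMat_apply k h1 hk]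
  have hi := rev_pos i
  have hj := rev_pos j
  by_cases h : (j : ℕ) = i + (2 * k - 1) ∧ ((i : ℕ) + k = n ∨ (i : ℕ) + k = n + 1)
  · rw [if_pos (by omega), if_pos h, mul_one]
    exact Odd.neg_one_pow ⟨(i : ℕ) + k - 1, by omega⟩
  · rw [if_neg (by omega), if_neg h]
    simp

/-- The element of `V_n` with coordinates in an `ℝ`-algebra. -/
def toVOver (u : Fin n → A) : MatOver n A :=
  ∑ k : Fin n, u k • baseChange n A (betaMat n ((k : ℕ) + 1))

theorem adj_smul (a : A) (M : MatOver n A) : adj n A (a • M) = a • adj n A M := by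
  ext i j
  rw [adj_apply, Matrix.smul_apply, Matrix.smul_apply, adj_apply, smul_eq_mul, smul_eq_mul]
  ring

theorem adj_toVOver (u : Fin n → A) : adj n A (toVOver u) = -toVOver u := by
  rw [toVOver, map_sum, ← Finset.sum_neg_distrib]
  refine Finset.sum_congr rfl fun k _ => ?_
  rw [adj_smul, adj_baseChange, adj_betaMat _ (by omega) (by have := k.isLt; omega), map_neg,
    smul_neg]

theorem toVOver_apply_of_le (u : Fin n → A) (i j : Fin (2 * n + 1)) (h : j ≤ i) :
    toVOver u i j = 0 := by
  rw [toVOver, Matrix.sum_apply]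
  refine Finset.sum_eq_zero fun k _ => ?_
  have h : (j : ℕ) ≤ i := h
  rw [Matrix.smul_apply, baseChange_apply,
    betaMat_apply_of_ne _ (by omega) (by have := k.isLt; omega) _ _ (by omega), map_zero, smul_zero]

end Matrices

/-! ### The two loop algebras as instances of one structure. -/

section LoopTypes

variable {n : ℕ}

theorem bMat_mulVec_stdVec (k : ℕ) (hk : k ≤ 2 * n) :
    bMat n *ᵥ stdVec n ℝ k = stdVec n ℝ (k + 1) := by
  ext i
  rw [mulVec_stdVec (bMat n) ⟨k, by omega⟩ i, bMat_apply, stdVec]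

theorem elem_mulVec_stdVec (i j k : ℕ) (hk : k ≤ 2 * n) :
    elem n (i + 1) (j + 1) *ᵥ stdVec n ℝ k = if k = j then stdVec n ℝ i else 0 := by
  ext l
  rw [mulVec_stdVec (elem n (i + 1) (j + 1)) ⟨k, by omega⟩ l, elem_apply]
  by_cases h : k = j
  · simp [h, stdVec]
  · simp [h]

/-- The data of one of the two loop algebras: `J = b + E λ`, with `J ^ (2n+1) = λ (c J + 1 - c)`,
the Coxeter number `h` of the grading, and the inverse `r` of the derivative of
`x ^ (2n+1) - c x - (1 - c)` at `b + E`. -/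
structure LoopType (n : ℕ) where
  h : ℕ
  c : ℤ
  ε : ℤˣ
  E : Mat n
  r : Mat n
  a : ℝ
  one_le : 1 ≤ n
  kind : (c = 0 ∧ h = 2 * n + 1 ∧ ε = -1 ∧ a = 0) ∨ (c = 1 ∧ h = 2 * n ∧ ε = 1)
  E_apply : ∀ i j : Fin (2 * n + 1), ((i : ℕ) : ℤ) - ((j : ℕ) : ℤ) ≠ 1 - h → E i j = 0
  rel : (bMat n + E) ^ (2 * n + 1) = c • (bMat n + E) + (1 - c) • (1 : Mat n)
  comm : Commute r (bMat n + E)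
  inv : r * ((2 * n + 1) • (bMat n + E) ^ (2 * n + 1 - 1) - c • (1 : Mat n)) = 1
  r_mem : r ∈ gradedPiece n ℝ h (1 - ((2 * n + 1 : ℕ) : ℤ))
  col : ∀ k, k < 2 * n → (bMat n + E) ^ k *ᵥ stdVec n ℝ 0 = stdVec n ℝ k
  last : (bMat n + E) ^ (2 * n) *ᵥ stdVec n ℝ 0 = stdVec n ℝ (2 * n) + a • stdVec n ℝ 0
  adj_E : (ε : ℤ) • adj n ℝ E = -E
  trace_E : E.trace = 0

theorem bMat_mem_gradedPiece (h : ℕ) : bMat n ∈ gradedPiece n ℝ h 1 := by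
  intro i j hij
  rw [bMat_apply, if_neg]
  intro e
  apply hij
  rw [e]
  simp

theorem mem_gradedPiece_of_E_apply {h : ℕ} {E : Mat n}
    (hE : ∀ i j : Fin (2 * n + 1), ((i : ℕ) : ℤ) - ((j : ℕ) : ℤ) ≠ 1 - h → E i j = 0) :
    E ∈ gradedPiece n ℝ h 1 := by
  intro i j hij
  refine hE i j fun e => hij ?_
  rw [e]
  exact ⟨-1, by ring⟩

theorem elem_apply_of_sub_ne (i j : ℕ) (k : ℤ) (hk : (i : ℤ) - j = k) (a b : Fin (2 * n + 1))
    (h : ((a : ℕ) : ℤ) - ((b : ℕ) : ℤ) ≠ k) : elem n i j a b = 0 := by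
  rw [elem_apply, if_neg]
  omega

/-- The loop algebra `Â_{2n}^{(2)}`. -/
def typeA (n : ℕ) (hn : 1 ≤ n) : LoopType n :=
  have hL : ∀ k, k ≤ 2 * n → (bMat n + elem n 1 (2 * n + 1)) *ᵥ stdVec n ℝ k =
      if k = 2 * n then stdVec n ℝ 0 else stdVec n ℝ (k + 1) := fun k hk => by
    rw [Matrix.add_mulVec, bMat_mulVec_stdVec k hk]
    have := elem_mulVec_stdVec (n := n) 0 (2 * n) k hk
    rw [zero_add] at this
    rw [this]
    by_cases h : k = 2 * n
    · rw [if_pos h, if_pos h, h]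
      have h0 : stdVec n ℝ (2 * n + 1) = 0 := by
        ext i
        rw [stdVec, if_neg (by have := i.isLt; omega)]
        rfl
      rw [h0, zero_add]
    · rw [if_neg h, if_neg h, add_zero]
  have hcol : ∀ k, k ≤ 2 * n →
      (bMat n + elem n 1 (2 * n + 1)) ^ k *ᵥ stdVec n ℝ 0 = stdVec n ℝ k := fun k => by
    induction k with
    | zero => intro _; rw [pow_zero, Matrix.one_mulVec]
    | succ k ih =>
      intro hk
      rw [pow_succ', ← Matrix.mulVec_mulVec, ih (by omega), hL k (by omega), if_neg (by omega)]
  -- `L` permutes the basis vectors cyclically; it suffices to test on the cyclic vector.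
  have hrel : (bMat n + elem n 1 (2 * n + 1)) ^ (2 * n + 1) = 1 := by
    rw [← sub_eq_zero]
    refine eq_zero_of_commute_cyclic (a := 0) (fun k hk => hcol k hk.le) ?_
      ((Commute.pow_right (Commute.refl _) _).sub_right (Commute.one_right _)) ?_
    · rw [hcol _ le_rfl, zero_smul, add_zero]
    · rw [Matrix.sub_mulVec, pow_succ', ← Matrix.mulVec_mulVec, hcol _ le_rfl, hL _ le_rfl,
        if_pos rfl, Matrix.one_mulVec, sub_self]
  have hE : ∀ i j : Fin (2 * n + 1), ((i : ℕ) : ℤ) - ((j : ℕ) : ℤ) ≠ 1 - ((2 * n + 1 : ℕ) : ℤ) →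
      elem n 1 (2 * n + 1) i j = 0 := fun i j h =>
    elem_apply_of_sub_ne 1 (2 * n + 1) _ (by push_cast; ring) i j h
  { h := 2 * n + 1
    c := 0
    ε := -1
    E := elem n 1 (2 * n + 1)
    r := ((2 * n + 1 : ℕ) : ℝ)⁻¹ • (bMat n + elem n 1 (2 * n + 1))
    a := 0
    one_le := hn
    kind := Or.inl ⟨rfl, rfl, rfl, rfl⟩
    E_apply := hE
    rel := by rw [hrel]; simp
    comm := (Commute.refl _).smul_left _
    inv := by
      rw [zero_smul, sub_zero, smul_mul_assoc, mul_smul_comm, Nat.add_sub_cancel, ← pow_succ', hrel,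
        ← Nat.cast_smul_eq_nsmul ℝ, smul_smul, inv_mul_cancel₀ (by positivity), one_smul]
    r_mem := by
      intro i j hij
      rw [Matrix.smul_apply, gradedPiece_congr (k := 1) (l := 1 - ((2 * n + 1 : ℕ) : ℤ)) ⟨1, by ring⟩
        (add_mem (bMat_mem_gradedPiece _) (mem_gradedPiece_of_E_apply hE)) i j hij, smul_zero]
    col := fun k hk => hcol k hk.le
    last := by rw [hcol _ le_rfl, zero_smul, add_zero]
    adj_E := by
      ext i j
      have hi := rev_pos i
      have hj := rev_pos j
      rw [Matrix.smul_apply, adj_apply, Matrix.neg_apply, elem_apply, elem_apply]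
      by_cases h : (i : ℕ) + 1 = 1 ∧ (j : ℕ) + 1 = 2 * n + 1
      · rw [if_pos (by omega), if_pos h, show (i : ℕ) + j = 2 * n by omega, pow_mul]
        simp
      · rw [if_neg (by omega), if_neg h]
        simp
    trace_E := Finset.sum_eq_zero fun i _ => by
      rw [Matrix.diag_apply]
      exact if_neg (by omega) }

theorem betaB_apply_of_sub_ne (i j : Fin (2 * n + 1))
    (h : ((i : ℕ) : ℤ) - ((j : ℕ) : ℤ) ≠ 1 - ((2 * n : ℕ) : ℤ)) : betaB n i j = 0 := by
  rw [betaB, Matrix.smul_apply, Matrix.add_apply,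
    elem_apply_of_sub_ne 1 (2 * n) (1 - ((2 * n : ℕ) : ℤ)) (by push_cast; ring) i j h,
    elem_apply_of_sub_ne 2 (2 * n + 1) (1 - ((2 * n : ℕ) : ℤ)) (by push_cast; ring) i j h]
  simp

theorem betaB_mulVec_stdVec (hn : 1 ≤ n) (k : ℕ) (hk : k ≤ 2 * n) :
    betaB n *ᵥ stdVec n ℝ k = if k = 2 * n - 1 then (1 / 2 : ℝ) • stdVec n ℝ 0 else
      if k = 2 * n then (1 / 2 : ℝ) • stdVec n ℝ 1 else 0 := by
  have h1 := elem_mulVec_stdVec (n := n) 0 (2 * n - 1) k hk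
  have h2 := elem_mulVec_stdVec (n := n) 1 (2 * n) k hk
  rw [zero_add, show 2 * n - 1 + 1 = 2 * n by omega] at h1
  rw [betaB, Matrix.smul_mulVec, Matrix.add_mulVec, h1, h2]
  split_ifs <;> first | omega | simp

theorem adj_betaB (hn : 1 ≤ n) : adj n ℝ (betaB n) = -betaB n := by
  ext i j
  have hi := rev_pos i
  have hj := rev_pos j
  rw [adj_apply, Matrix.neg_apply, betaB, Matrix.smul_apply, Matrix.smul_apply, Matrix.add_apply,
    Matrix.add_apply, elem_apply, elem_apply, elem_apply, elem_apply]
  by_cases h : ((i : ℕ) + 1 = 1 ∧ (j : ℕ) + 1 = 2 * n) ∨ ((i : ℕ) + 1 = 2 ∧ (j : ℕ) + 1 = 2 * n + 1)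
  · have e : (-1 : ℝ) ^ ((i : ℕ) + j) = -1 := by
      rcases h with h | h
      · exact Odd.neg_one_pow ⟨n - 1, by omega⟩
      · exact Odd.neg_one_pow ⟨n, by omega⟩
    rw [e]
    rcases h with h | h
    · rw [if_neg (by omega), if_pos (by omega), if_pos h, if_neg (by omega)]; norm_num
    · rw [if_pos (by omega), if_neg (by omega), if_neg (by omega), if_pos h]; norm_num
  · rw [if_neg (by omega), if_neg (by omega), if_neg (by omega), if_neg (by omega)]
    simp

/-- The loop algebra `B̂_n^{(1)}`. -/
def typeB (n : ℕ) (hn : 1 ≤ n) : LoopType n :=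
  have hL : ∀ k, k < 2 * n - 1 → (bMat n + betaB n) *ᵥ stdVec n ℝ k = stdVec n ℝ (k + 1) :=
    fun k hk => by
      rw [Matrix.add_mulVec, bMat_mulVec_stdVec k (by omega), betaB_mulVec_stdVec hn k (by omega),
        if_neg (by omega), if_neg (by omega), add_zero]
  have hcol : ∀ k, k < 2 * n → (bMat n + betaB n) ^ k *ᵥ stdVec n ℝ 0 = stdVec n ℝ k :=
    fun k => by
      induction k with
      | zero => intro _; rw [pow_zero, Matrix.one_mulVec]
      | succ k ih =>
        intro hk
        rw [pow_succ', ← Matrix.mulVec_mulVec, ih (by omega), hL k (by omega)]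
  have hlast : (bMat n + betaB n) ^ (2 * n) *ᵥ stdVec n ℝ 0 =
      stdVec n ℝ (2 * n) + (1 / 2 : ℝ) • stdVec n ℝ 0 := by
    have e := pow_succ' (bMat n + betaB n) (2 * n - 1)
    rw [show 2 * n - 1 + 1 = 2 * n by omega] at e
    rw [e, ← Matrix.mulVec_mulVec, hcol _ (by omega), Matrix.add_mulVec,
      bMat_mulVec_stdVec _ (by omega), betaB_mulVec_stdVec hn _ (by omega), if_pos rfl,
      show 2 * n - 1 + 1 = 2 * n by omega]
  -- On the cyclic vector, the two summands of `L^{2n} e_0 = e_{2n} + (1/2) e_0` (indices from `0`)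
  -- are each sent by `L` to `(1/2) e_1`.
  have hrel : (bMat n + betaB n) ^ (2 * n + 1) = bMat n + betaB n := by
    rw [← sub_eq_zero]
    refine eq_zero_of_commute_cyclic (a := 1 / 2) hcol hlast
      ((Commute.pow_right (Commute.refl _) _).sub_right (Commute.refl _)) ?_
    rw [Matrix.sub_mulVec, pow_succ', ← Matrix.mulVec_mulVec, hlast, Matrix.mulVec_add,
      Matrix.mulVec_smul, hL 0 (by omega), Matrix.add_mulVec, bMat_mulVec_stdVec _ le_rfl,
      betaB_mulVec_stdVec hn _ le_rfl, if_neg (by omega), if_pos rfl]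
    have h1 : stdVec n ℝ (2 * n + 1) = 0 := by
      ext i
      rw [stdVec, if_neg (by have := i.isLt; omega)]
      rfl
    rw [h1, zero_add, zero_add, ← add_smul]
    norm_num
  have hmem : bMat n + betaB n ∈ gradedPiece n ℝ (2 * n) 1 :=
    add_mem (bMat_mem_gradedPiece _) (mem_gradedPiece_of_E_apply (betaB_apply_of_sub_ne))
  have hidem : (bMat n + betaB n) ^ (2 * n) * (bMat n + betaB n) ^ (2 * n) =
      (bMat n + betaB n) ^ (2 * n) := by
    obtain ⟨m, hm⟩ : ∃ m, 2 * n = m + 1 := ⟨2 * n - 1, by omega⟩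
    rw [← pow_add, show 2 * n + 2 * n = 2 * n + 1 + m by omega, pow_add, hrel, ← pow_succ', ← hm]
  { h := 2 * n
    c := 1
    ε := 1
    E := betaB n
    -- With the idempotent `p = L^{2n}`, the derivative `(2n+1) p - 1` is `2n` on the range of `p`
    -- and `-1` on the range of `1 - p`; `r` inverts it on each part.
    r := ((2 * n : ℕ) : ℝ)⁻¹ • (bMat n + betaB n) ^ (2 * n) -
      (1 - (bMat n + betaB n) ^ (2 * n))
    a := 1 / 2
    one_le := hn
    kind := Or.inr ⟨rfl, rfl, rfl⟩
    E_apply := betaB_apply_of_sub_ne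
    rel := by rw [hrel]; simp
    comm := ((Commute.pow_left (Commute.refl _) _).smul_left _).sub_left
      ((Commute.one_left _).sub_left (Commute.pow_left (Commute.refl _) _))
    inv := by
      rw [Nat.add_sub_cancel]
      generalize (bMat n + betaB n) ^ (2 * n) = p at hidem
      have h2n : ((2 * n : ℕ) : ℝ) ≠ 0 := by
        have : 2 * n ≠ 0 := by omega
        exact_mod_cast this
      have e1 : (2 * n + 1) • p = (((2 * n : ℕ) : ℝ) + 1) • p := by
        rw [← Nat.cast_smul_eq_nsmul ℝ]; push_cast; rfl
      rw [e1, one_smul]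
      simp only [sub_mul, mul_sub, smul_mul_assoc, mul_smul_comm, hidem, mul_one, one_mul, smul_smul,
        sub_self, sub_zero]
      rw [add_mul, mul_inv_cancel₀ h2n]
      simp only [one_smul, one_mul, add_smul]
      abel
    r_mem := by
      refine gradedPiece_congr (k := 0) (l := 1 - ((2 * n + 1 : ℕ) : ℤ)) ⟨1, by push_cast; ring⟩ ?_
      have hp : (bMat n + betaB n) ^ (2 * n) ∈ gradedPiece n ℝ (2 * n) 0 :=
        gradedPiece_congr (k := ((2 * n : ℕ) : ℤ)) ⟨1, by ring⟩ (pow_mem_gradedPiece hmem (2 * n))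
      refine sub_mem (fun i j hij => ?_) (sub_mem (one_mem_gradedPiece _) hp)
      rw [Matrix.smul_apply, hp i j hij, smul_zero]
    col := hcol
    last := hlast
    adj_E := by rw [Units.val_one, one_smul, adj_betaB hn]
    trace_E := Finset.sum_eq_zero fun i _ => by
      rw [Matrix.diag_apply]
      refine betaB_apply_of_sub_ne i i ?_
      push_cast
      omega }

namespace LoopType

variable (τ : LoopType n) (A : Type*) [CommRing A] [Algebra ℝ A]

theorem one_le_h : 1 ≤ τ.h := by
  have := τ.one_le
  rcases τ.kind with h | h <;> omega

theorem two_n_le_h : 2 * n ≤ τ.h := by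
  rcases τ.kind with h | h <;> omega

/-- The cyclic element `b + E` over an `ℝ`-algebra. -/
def L : MatOver n A := baseChange n A (bMat n + τ.E)

variable {A}

theorem L_pow_mulVec (k : ℕ) (hk : k < 2 * n) :
    τ.L A ^ k *ᵥ stdVec n A 0 = stdVec n A k := by
  rw [L, ← map_pow, baseChange_mulVec_stdVec, τ.col k hk]
  ext i
  rw [stdVec, stdVec]
  split_ifs <;> simp

theorem L_pow_last : τ.L A ^ (2 * n) *ᵥ stdVec n A 0 =
    stdVec n A (2 * n) + algebraMap ℝ A τ.a • stdVec n A 0 := by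
  rw [L, ← map_pow, baseChange_mulVec_stdVec, τ.last]
  ext i
  simp only [Pi.add_apply, Pi.smul_apply, smul_eq_mul, map_add, map_mul, stdVec]
  split_ifs <;> simp

theorem eq_of_commute {M M' : MatOver n A} (hM : Commute (τ.L A) M) (hM' : Commute (τ.L A) M')
    (h : M *ᵥ stdVec n A 0 = M' *ᵥ stdVec n A 0) : M = M' :=
  sub_eq_zero.mp (eq_zero_of_commute_cyclic (fun k hk => τ.L_pow_mulVec k hk) τ.L_pow_last
    (hM.sub_right hM') (by rw [Matrix.sub_mulVec, h, sub_self]))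

/-- The entrywise extension of a derivation. -/
def matDer (n : ℕ) (D : Derivation ℝ A A) : MatOver n A →+ MatOver n A where
  toFun M := M.map D
  map_zero' := by ext; simp
  map_add' M M' := by ext; simp

@[simp]
theorem matDer_apply (D : Derivation ℝ A A) (M : MatOver n A) (i j : Fin (2 * n + 1)) :
    matDer n D M i j = D (M i j) := rfl

theorem matDer_baseChange (D : Derivation ℝ A A) (M : Mat n) :
    matDer n D (baseChange n A M) = 0 := by
  ext i j
  rw [matDer_apply, baseChange_apply, Derivation.map_algebraMap]
  rfl

theorem matDer_mul (D : Derivation ℝ A A) (M M' : MatOver n A) :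
    matDer n D (M * M') = matDer n D M * M' + M * matDer n D M' := by
  ext i j
  rw [matDer_apply, Matrix.mul_apply, Matrix.add_apply, Matrix.mul_apply, Matrix.mul_apply, map_sum,
    ← Finset.sum_add_distrib]
  refine Finset.sum_congr rfl fun k _ => ?_
  rw [Derivation.leibniz, matDer_apply, matDer_apply, smul_eq_mul, smul_eq_mul]
  ring

theorem matDer_adj (D : Derivation ℝ A A) (M : MatOver n A) :
    matDer n D (adj n A M) = adj n A (matDer n D M) := by
  ext i j
  rw [matDer_apply, adj_apply, adj_apply, matDer_apply]
  rcases neg_one_pow_eq_or A ((i : ℕ) + j) with h | h <;> rw [h] <;> simp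

variable (D : Derivation ℝ A A)

/-- The separable datum of the cyclic element `b + E`. -/
def datum : SeparableDatum (MatOver n A) where
  N := 2 * n + 1
  one_le := by omega
  L := τ.L A
  r := baseChange n A τ.r
  c := τ.c
  Gr := gradedPiece n A τ.h
  D := matDer n D
  leibniz := matDer_mul D
  D_L := matDer_baseChange D _
  rel := by
    rw [L, ← map_pow, τ.rel, map_add, map_zsmul, map_zsmul, map_one]
  comm := τ.comm.map (baseChange n A)
  inv := by
    have := congrArg (baseChange n A) τ.inv
    rwa [map_mul, map_sub, map_nsmul, map_zsmul, map_pow, map_one] at this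
  one_mem := one_mem_gradedPiece _
  mul_mem := mul_mem_gradedPiece
  D_mem := fun {k M} hM i j hij => by rw [matDer_apply, hM i j hij, map_zero]
  L_mem := baseChange_mem_gradedPiece
    (add_mem (bMat_mem_gradedPiece _) (mem_gradedPiece_of_E_apply τ.E_apply))
  r_mem := baseChange_mem_gradedPiece τ.r_mem
  c_smul_r_mem := by
    rcases τ.kind with ⟨hc, _⟩ | ⟨hc, hh, _⟩
    · rw [hc, zero_smul]; exact zero_mem _
    · rw [hc, one_smul]
      refine baseChange_mem_gradedPiece (gradedPiece_congr ?_ τ.r_mem)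
      exact ⟨-1, by rw [hh]; push_cast; ring⟩

end LoopType

end LoopTypes

/-! ### The principal regrading `λ = t ^ h`. -/

section Regrade

variable {n : ℕ} {A : Type*} [CommRing A]

/-- The substitution `λ = t ^ h` in Laurent series. -/
def subst {R : Type*} [Ring R] (h : ℕ) (hh : 1 ≤ h) : LaurentSeries R →+* LaurentSeries R :=
  HahnSeries.embDomainRingHom (AddMonoidHom.mulLeft (h : ℤ))
    (fun a b hab => mul_left_cancel₀ (by positivity : (h : ℤ) ≠ 0) hab)
    (fun a b => mul_le_mul_iff_right₀ (by positivity : (0 : ℤ) < h))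

theorem coeff_subst_mul {R : Type*} [Ring R] (h : ℕ) (hh : 1 ≤ h) (X : LaurentSeries R) (m : ℤ) :
    (subst h hh X).coeff (h * m) = X.coeff m :=
  HahnSeries.embDomain_coeff (f := ⟨⟨AddMonoidHom.mulLeft (h : ℤ),
    fun a b hab => mul_left_cancel₀ (by positivity : (h : ℤ) ≠ 0) hab⟩,
    mul_le_mul_iff_right₀ (by positivity : (0 : ℤ) < h)⟩)

theorem coeff_subst_of_not_dvd {R : Type*} [Ring R] (h : ℕ) (hh : 1 ≤ h) (X : LaurentSeries R)
    (k : ℤ) (hk : ¬ (h : ℤ) ∣ k) : (subst h hh X).coeff k = 0 :=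
  HahnSeries.embDomain_of_notMem_range (f := ⟨⟨AddMonoidHom.mulLeft (h : ℤ),
    fun a b hab => mul_left_cancel₀ (by positivity : (h : ℤ) ≠ 0) hab⟩,
    mul_le_mul_iff_right₀ (by positivity : (0 : ℤ) < h)⟩) (by
      rintro ⟨m, rfl⟩
      exact hk ⟨m, rfl⟩)

/-- The diagonal matrix with entries `t ^ (s i)`. -/
def diagPow (n : ℕ) (A : Type*) [CommRing A] (s : ℤ) : LaurentSeries (MatOver n A) :=
  ∑ i : Fin (2 * n + 1), HahnSeries.single (-(s * ((i : ℕ) : ℤ))) (Matrix.single i i (1 : A))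

theorem coeff_diagPow_mul (s : ℤ) (X : LaurentSeries (MatOver n A)) (k : ℤ)
    (i j : Fin (2 * n + 1)) :
    (diagPow n A s * X).coeff k i j = X.coeff (k + s * ((i : ℕ) : ℤ)) i j := by
  rw [diagPow, Finset.sum_mul, HahnSeries.coeff_sum, Matrix.sum_apply, Finset.sum_eq_single i]
  · rw [HahnSeries.coeff_single_mul, sub_neg_eq_add, Matrix.single_mul_apply_same, one_mul]
  · intro l _ hl
    rw [HahnSeries.coeff_single_mul, Matrix.single_mul_apply_of_ne _ _ _ _ _ hl.symm]
  · simp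

theorem coeff_mul_diagPow (s : ℤ) (X : LaurentSeries (MatOver n A)) (k : ℤ)
    (i j : Fin (2 * n + 1)) :
    (X * diagPow n A s).coeff k i j = X.coeff (k + s * ((j : ℕ) : ℤ)) i j := by
  rw [diagPow, Finset.mul_sum, HahnSeries.coeff_sum, Matrix.sum_apply, Finset.sum_eq_single j]
  · rw [HahnSeries.coeff_mul_single, sub_neg_eq_add, Matrix.mul_single_apply_same, mul_one]
  · intro l _ hl
    rw [HahnSeries.coeff_mul_single, Matrix.mul_single_apply_of_ne _ _ _ _ _ hl.symm]
  · simp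

theorem diagPow_neg_mul (s : ℤ) : diagPow n A (-s) * diagPow n A s = 1 := by
  ext k i j
  rw [coeff_diagPow_mul]
  have : (diagPow n A s) = 1 * diagPow n A s := (one_mul _).symm
  rw [this, coeff_mul_diagPow, HahnSeries.coeff_one, HahnSeries.coeff_one]
  by_cases hij : i = j
  · subst hij
    rw [show k + -s * ((i : ℕ) : ℤ) + s * ((i : ℕ) : ℤ) = k by ring]
  · split_ifs <;> simp [Matrix.one_apply_ne hij]

/-- The substitution `λ = t ^ h` followed by conjugation with the diagonal matrix with
entries `t ^ i`. -/
def regrade (n : ℕ) (A : Type*) [CommRing A] (h : ℕ) (hh : 1 ≤ h) :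
    LaurentSeries (MatOver n A) →+* LaurentSeries (MatOver n A) where
  toFun X := diagPow n A 1 * subst h hh X * diagPow n A (-1)
  map_one' := by
    have := diagPow_neg_mul (n := n) (A := A) (-1)
    rw [neg_neg] at this
    rw [map_one, mul_one, this]
  map_mul' X Y := by
    rw [map_mul]
    simp only [mul_assoc]
    rw [← mul_assoc (diagPow n A (-1)) (diagPow n A 1), diagPow_neg_mul, one_mul]
  map_zero' := by rw [map_zero, mul_zero, zero_mul]
  map_add' X Y := by rw [map_add, mul_add, add_mul]

variable {h : ℕ} {hh : 1 ≤ h}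

theorem coeff_regrade (X : LaurentSeries (MatOver n A)) (k : ℤ) (i j : Fin (2 * n + 1)) :
    (regrade n A h hh X).coeff k i j =
      (subst h hh X).coeff (k + (((i : ℕ) : ℤ) - ((j : ℕ) : ℤ))) i j := by
  change (diagPow n A 1 * subst h hh X * diagPow n A (-1)).coeff k i j = _
  rw [coeff_mul_diagPow, coeff_diagPow_mul]
  rw [show k + -1 * ((j : ℕ) : ℤ) + 1 * ((i : ℕ) : ℤ) =
    k + (((i : ℕ) : ℤ) - ((j : ℕ) : ℤ)) by ring]

theorem coeff_regrade_of_eq (X : LaurentSeries (MatOver n A)) {k m : ℤ} (i j : Fin (2 * n + 1))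
    (hk : k = h * m - (((i : ℕ) : ℤ) - ((j : ℕ) : ℤ))) :
    (regrade n A h hh X).coeff k i j = X.coeff m i j := by
  rw [coeff_regrade, hk, sub_add_cancel, coeff_subst_mul]

theorem coeff_regrade_of_not_dvd (X : LaurentSeries (MatOver n A)) {k : ℤ} (i j : Fin (2 * n + 1))
    (hk : ¬ (h : ℤ) ∣ k + (((i : ℕ) : ℤ) - ((j : ℕ) : ℤ))) :
    (regrade n A h hh X).coeff k i j = 0 := by
  rw [coeff_regrade, coeff_subst_of_not_dvd h hh X _ hk]
  rfl

theorem regrade_injective : Function.Injective (regrade n A h hh) := by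
  intro X Y hXY
  ext m i j
  rw [← coeff_regrade_of_eq (h := h) (hh := hh) X i j rfl, hXY, coeff_regrade_of_eq Y i j rfl]

theorem regrade_coeff_mem (X : LaurentSeries (MatOver n A)) (k : ℤ) :
    (regrade n A h hh X).coeff k ∈ gradedPiece n A h (-k) := by
  intro i j hij
  refine coeff_regrade_of_not_dvd X i j fun hd => hij ?_
  rwa [sub_neg_eq_add, add_comm]

/-- In a homogeneous series the entry `(i, j)` carries only powers of `t` whose exponent is
congruent to `i - j` modulo `h`, so undoing the diagonal conjugation leaves powers of `t ^ h`. -/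
theorem exists_regrade_eq {Y : LaurentSeries (MatOver n A)}
    (hY : ∀ k, Y.coeff k ∈ gradedPiece n A h (-k)) : ∃ X, regrade n A h hh X = Y := by
  obtain ⟨p, hp⟩ := exists_vanishBelow Y
  let f : ℤ → MatOver n A := fun m => Matrix.of fun i j =>
    Y.coeff (h * m - (((i : ℕ) : ℤ) - ((j : ℕ) : ℤ))) i j
  have hf : BddBelow (Function.support f) := by
    refine ⟨min 0 (p - 2 * n), fun m hm => ?_⟩
    by_contra hlt
    rw [not_le, lt_min_iff] at hlt
    refine hm ?_
    ext i j
    change Y.coeff (h * m - (((i : ℕ) : ℤ) - ((j : ℕ) : ℤ))) i j = 0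
    rw [hp]
    · rfl
    · have h1 : (h : ℤ) * m ≤ m := by nlinarith [hlt.1, (by exact_mod_cast hh : (1 : ℤ) ≤ h)]
      have := j.isLt
      omega
  refine ⟨HahnSeries.ofSuppBddBelow f hf, ?_⟩
  ext k i j
  by_cases hd : (h : ℤ) ∣ k + (((i : ℕ) : ℤ) - ((j : ℕ) : ℤ))
  · obtain ⟨m, hm⟩ := hd
    have hk : k = h * m - (((i : ℕ) : ℤ) - ((j : ℕ) : ℤ)) := by linarith
    rw [coeff_regrade_of_eq _ i j hk, HahnSeries.coeff_ofSuppBddBelow]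
    change Y.coeff _ i j = _
    rw [← hk]
  · rw [coeff_regrade_of_not_dvd _ i j hd, hY k i j]
    rwa [sub_neg_eq_add, add_comm]

theorem regrade_single {m q : ℤ} {M : MatOver n A}
    (hM : ∀ i j : Fin (2 * n + 1), ((i : ℕ) : ℤ) - ((j : ℕ) : ℤ) ≠ q → M i j = 0) :
    regrade n A h hh (HahnSeries.single m M) = HahnSeries.single (h * m - q) M := by
  ext k i j
  by_cases hq : ((i : ℕ) : ℤ) - ((j : ℕ) : ℤ) = q
  · by_cases hd : (h : ℤ) ∣ k + (((i : ℕ) : ℤ) - ((j : ℕ) : ℤ))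
    · obtain ⟨m', hm⟩ := hd
      have hk : k = h * m' - (((i : ℕ) : ℤ) - ((j : ℕ) : ℤ)) := by linarith
      rw [coeff_regrade_of_eq _ i j hk, hk, hq]
      by_cases hm' : m' = m
      · rw [hm', HahnSeries.coeff_single_same, HahnSeries.coeff_single_same]
      · rw [HahnSeries.coeff_single_of_ne hm', HahnSeries.coeff_single_of_ne]
        intro e
        exact hm' (mul_left_cancel₀ (by positivity : (h : ℤ) ≠ 0) (sub_left_injective e))
    · rw [coeff_regrade_of_not_dvd _ i j hd, HahnSeries.coeff_single_of_ne]
      · rfl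
      · rintro rfl
        exact hd ⟨m, by rw [hq]; ring⟩
  · have h1 : ∀ (a b : ℤ), (HahnSeries.single a M).coeff b i j = 0 := by
      intro a b
      by_cases hab : b = a
      · rw [hab, HahnSeries.coeff_single_same, hM i j hq]
      · rw [HahnSeries.coeff_single_of_ne hab]; rfl
    rw [h1]
    by_cases hd : (h : ℤ) ∣ k + (((i : ℕ) : ℤ) - ((j : ℕ) : ℤ))
    · obtain ⟨m', hm⟩ := hd
      rw [coeff_regrade_of_eq (m := m') _ i j (by linarith), h1]
    · rw [coeff_regrade_of_not_dvd _ i j hd]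

theorem regrade_single_one (m : ℤ) :
    regrade n A h hh (HahnSeries.single m 1) = HahnSeries.single (h * m) 1 := by
  rw [regrade_single (q := 0), sub_zero]
  intro i j hij
  refine Matrix.one_apply_ne fun e => hij ?_
  rw [e, sub_self]

theorem vanishBelow_regrade_iff {X : LaurentSeries (MatOver n A)} {p : ℤ} :
    VanishBelow p (regrade n A h hh X) ↔ ∀ (m : ℤ) (i j : Fin (2 * n + 1)),
      h * m - (((i : ℕ) : ℤ) - ((j : ℕ) : ℤ)) < p → X.coeff m i j = 0 := by
  constructor
  · intro hX m i j hlt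
    rw [← coeff_regrade_of_eq (h := h) (hh := hh) X i j rfl, hX _ hlt]
    rfl
  · intro hX k hk
    ext i j
    by_cases hd : (h : ℤ) ∣ k + (((i : ℕ) : ℤ) - ((j : ℕ) : ℤ))
    · obtain ⟨m, hm⟩ := hd
      have hk' : k = h * m - (((i : ℕ) : ℤ) - ((j : ℕ) : ℤ)) := by linarith
      rw [coeff_regrade_of_eq X i j hk', hX m i j (hk' ▸ hk)]
      rfl
    · rw [coeff_regrade_of_not_dvd _ i j hd]
      rfl

theorem regrade_coeffMap {D : MatOver n A →+ MatOver n A} {f : A → A} (hf0 : f 0 = 0)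
    (hD : ∀ M i j, D M i j = f (M i j)) (X : LaurentSeries (MatOver n A)) :
    regrade n A h hh (coeffMap D X) = coeffMap D (regrade n A h hh X) := by
  ext k i j
  rw [coeff_coeffMap, hD]
  by_cases hd : (h : ℤ) ∣ k + (((i : ℕ) : ℤ) - ((j : ℕ) : ℤ))
  · obtain ⟨m, hm⟩ := hd
    have hk' : k = h * m - (((i : ℕ) : ℤ) - ((j : ℕ) : ℤ)) := by linarith
    rw [coeff_regrade_of_eq _ i j hk', coeff_regrade_of_eq _ i j hk', coeff_coeffMap, hD]
  · rw [coeff_regrade_of_not_dvd _ i j hd, coeff_regrade_of_not_dvd _ i j hd, hf0]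

end Regrade

/-! ### The zero curvature equation over a differential algebra. -/

namespace LoopType

variable {n : ℕ} (τ : LoopType n) {A : Type*} [CommRing A] [Algebra ℝ A]

theorem L_pow_succ : τ.L A ^ (2 * n + 1) = τ.c • τ.L A + (1 - τ.c) • (1 : MatOver n A) := by
  rw [L, ← map_pow, τ.rel, map_add, map_zsmul, map_zsmul, map_one]

/-- Among the row indices `0, …, 2n` only `1` is congruent to `1` modulo `h`. So the first column of
`M` is a multiple of that of `L`, and first columns determine elements of the commutant. -/
theorem eq_smul_of_mem_one {M : MatOver n A} (hM : Commute (τ.L A) M)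
    (hg : M ∈ gradedPiece n A τ.h 1) :
    ∃ a : A, M = a • τ.L A := by
  have hn := τ.one_le
  have hh := τ.two_n_le_h
  refine ⟨M ⟨1, by omega⟩ 0, τ.eq_of_commute hM ((Commute.refl _).smul_right _) ?_⟩
  have h1 := τ.L_pow_mulVec (A := A) 1 (by omega)
  rw [pow_one] at h1
  rw [Matrix.smul_mulVec, h1]
  ext i
  rw [mulVec_stdVec_zero, Pi.smul_apply, stdVec]
  by_cases hi : (i : ℕ) = 1
  · rw [if_pos hi, smul_eq_mul, mul_one]
    congr 1
    ext
    exact hi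
  · rw [if_neg hi, smul_zero, hg i 0]
    rw [Fin.val_zero]
    have := i.isLt
    intro hd
    by_cases h0 : (i : ℕ) = 0
    · rw [h0] at hd
      have := Int.le_of_dvd (by norm_num) ((Int.dvd_neg).mpr hd)
      push_cast at this
      omega
    · have := Int.le_of_dvd (by omega) hd
      omega

theorem idempotent_of_kind (hc : τ.c = 1) : τ.L A ^ (2 * n) * τ.L A ^ (2 * n) = τ.L A ^ (2 * n) := by
  have hn := τ.one_le
  have hrel := τ.L_pow_succ (A := A)
  rw [hc, one_smul, sub_self, zero_smul, add_zero] at hrel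
  obtain ⟨m, hm⟩ : ∃ m, 2 * n = m + 1 := ⟨2 * n - 1, by omega⟩
  rw [← pow_add, show 2 * n + 2 * n = 2 * n + 1 + m by omega, pow_add, hrel, ← pow_succ', ← hm]

omit [Algebra ℝ A] in
theorem add_smul_pow_of_idempotent {p : MatOver n A} (hp : p * p = p) (x y : A) (k : ℕ) :
    (x • (1 : MatOver n A) + y • p) ^ k =
      x ^ k • (1 : MatOver n A) + ((x + y) ^ k - x ^ k) • p := by
  induction k with
  | zero => simp
  | succ k ih =>
    rw [pow_succ, ih]
    simp only [mul_add, add_mul, smul_mul_smul_comm, hp, mul_one, one_mul]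
    rw [add_assoc, ← add_smul, ← add_smul, ← pow_succ]
    congr 2
    ring

/-- A homogeneous element of the commutant is `a L^r`, except in degree `0` of type B, where it is
`x + y p` with the idempotent `p = L^{2n}`. Its power `2n+1` involves only powers of `a`,
respectively of `x` and `x + y`, and these vanish only if the elements do, `A` being reduced. -/
theorem eq_zero_of_pow_eq_zero [IsReduced A] {M : MatOver n A} {k : ℤ}
    (hM : Commute (τ.L A) M) (hg : M ∈ gradedPiece n A τ.h k) (h0 : M ^ (2 * n + 1) = 0) :
    M = 0 := by
  have hn := τ.one_le
  have hh := τ.two_n_le_h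
  have hh0 : (τ.h : ℤ) ≠ 0 := by omega
  obtain ⟨r, hr⟩ : ∃ r : ℕ, k % (τ.h : ℤ) = r := Int.eq_ofNat_of_zero_le (Int.emod_nonneg _ hh0)
  have hrlt : (r : ℤ) < τ.h := hr ▸ Int.emod_lt_of_pos _ (by omega)
  have hcongr : ∀ i : Fin (2 * n + 1), ¬ (τ.h : ℤ) ∣ ((i : ℕ) : ℤ) - r →
      (M *ᵥ stdVec n A 0) i = 0 := by
    intro i hi
    rw [mulVec_stdVec_zero]
    refine hg i 0 fun hd => hi ?_
    rw [Fin.val_zero, Nat.cast_zero, sub_zero] at hd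
    rw [← hr]
    have h1 := Int.emod_add_mul_ediv k τ.h
    obtain ⟨q, hq⟩ := hd
    exact ⟨q + k / τ.h, by linear_combination hq - h1⟩
  have hpow : ∀ a : A, M = a • τ.L A ^ r → τ.L A ^ (r * (2 * n + 1)) *ᵥ stdVec n A 0 =
      stdVec n A (if τ.c = 0 then 0 else r) → (if τ.c = 0 then 0 else r) ≤ 2 * n → M = 0 := by
    intro a ha hv hle
    rw [ha, smul_pow, ← pow_mul] at h0
    have h1 := congrArg (fun X : MatOver n A => (X *ᵥ stdVec n A 0) ⟨if τ.c = 0 then 0 else r, by omega⟩) h0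
    simp only [Matrix.smul_mulVec, hv, Matrix.zero_mulVec, Pi.smul_apply, Pi.zero_apply,
      stdVec, if_true, smul_eq_mul, mul_one] at h1
    rw [ha, pow_eq_zero_iff (by omega) |>.mp h1, zero_smul]
  have hscal : ∀ q : ℕ, q ≤ 2 * n → (q : ℤ) = r →
      (∀ i : Fin (2 * n + 1), (i : ℕ) ≠ q → ¬ (τ.h : ℤ) ∣ ((i : ℕ) : ℤ) - r) →
      ∃ a : A, M *ᵥ stdVec n A 0 = a • stdVec n A r := by
    intro q hq hqr hne
    have e : q = r := by exact_mod_cast hqr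
    subst e
    refine ⟨(M *ᵥ stdVec n A 0) ⟨q, by omega⟩, ?_⟩
    ext i
    rw [Pi.smul_apply, stdVec]
    by_cases hi : (i : ℕ) = q
    · rw [if_pos hi, smul_eq_mul, mul_one]
      congr 1
      ext
      exact hi
    · rw [if_neg hi, smul_zero, hcongr i (hne i hi)]
  have hndvd : ∀ x : ℤ, x ≠ 0 → |x| < τ.h → ¬ (τ.h : ℤ) ∣ x := fun x hx hlt hd =>
    hx (Int.eq_zero_of_abs_lt_dvd hd hlt)
  rcases τ.kind with ⟨hc, hh', _, ha0⟩ | ⟨hc, hh', _⟩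
  · have hcol : ∀ q, q ≤ 2 * n → τ.L A ^ q *ᵥ stdVec n A 0 = stdVec n A q := by
      intro q hq
      rcases hq.lt_or_eq with h | rfl
      · exact τ.L_pow_mulVec q h
      · rw [τ.L_pow_last, ha0, map_zero, zero_smul, add_zero]
    obtain ⟨a, ha⟩ := hscal r (by omega) rfl fun i hi => hndvd _ (by omega) (by
      have := i.isLt
      rw [abs_lt]
      constructor <;> omega)
    refine hpow a (τ.eq_of_commute hM ((Commute.pow_right (Commute.refl _) _).smul_right _) ?_) ?_
      (by rw [if_pos hc]; omega)
    · rw [ha, Matrix.smul_mulVec, hcol r (by omega)]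
    · have hrel := τ.L_pow_succ (A := A)
      rw [hc, zero_smul, sub_zero, one_smul, zero_add] at hrel
      rw [if_pos hc, mul_comm r, pow_mul, hrel, one_pow, Matrix.one_mulVec]
  · have hrel := τ.L_pow_succ (A := A)
    rw [hc, one_smul, sub_self, zero_smul, add_zero] at hrel
    by_cases hr0 : r = 0
    · have hp := τ.idempotent_of_kind (A := A) hc
      set p := τ.L A ^ (2 * n) with hpdef
      have hL1 := τ.L_pow_mulVec (A := A) 1 (by omega)
      rw [pow_one] at hL1
      set c0 := (M *ᵥ stdVec n A 0) 0 with hc0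
      set c1 := (M *ᵥ stdVec n A 0) ⟨2 * n, by omega⟩ with hc1
      -- The first column of `p` is `e_{2n} + a e_0`, whence the correction of the scalar part by `a
      -- c1`.
      have hMx : M = (c0 - algebraMap ℝ A τ.a * c1) • (1 : MatOver n A) + c1 • p := by
        refine τ.eq_of_commute hM (((Commute.one_right _).smul_right _).add_right
          ((Commute.pow_right (Commute.refl _) _).smul_right _)) ?_
        rw [Matrix.add_mulVec, Matrix.smul_mulVec, Matrix.smul_mulVec, Matrix.one_mulVec, hpdef,
          τ.L_pow_last]
        ext i
        simp only [Pi.add_apply, Pi.smul_apply, smul_eq_mul, stdVec]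
        by_cases hi0 : (i : ℕ) = 0
        · rw [if_pos hi0, if_neg (by omega), show i = 0 from Fin.ext hi0, ← hc0]
          ring
        · rw [if_neg hi0]
          by_cases hi2 : (i : ℕ) = 2 * n
          · rw [if_pos hi2, show i = ⟨2 * n, by omega⟩ from Fin.ext hi2, ← hc1]
            ring
          · rw [if_neg hi2, hcongr i]
            · ring
            · refine hndvd _ (by omega) ?_
              have := i.isLt
              rw [abs_lt]
              constructor <;> omega
      generalize (c0 - algebraMap ℝ A τ.a * c1) = x at hMx
      generalize c1 = y at hMx
      rw [hMx, add_smul_pow_of_idempotent hp] at h0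
      have e1 : x + y = 0 := by
        have h1 := congrArg (fun X : MatOver n A => ((X * p * τ.L A) *ᵥ stdVec n A 0) ⟨1, by omega⟩) h0
        have hpL : p * τ.L A = τ.L A := by rw [hpdef, ← pow_succ, hrel]
        simp only [add_mul, smul_mul_assoc, hp, one_mul, hpL, Matrix.add_mulVec,
          Matrix.smul_mulVec, hL1, zero_mul, Matrix.zero_mulVec, Pi.add_apply, Pi.smul_apply,
          smul_eq_mul, stdVec, if_true, mul_one, Pi.zero_apply] at h1
        exact pow_eq_zero_iff (n := 2 * n + 1) (by omega) |>.mp (by linear_combination h1)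
      have e2 : x = 0 := by
        have h1 := congrArg (fun X : MatOver n A => ((X * (1 - p)) *ᵥ stdVec n A 0) ⟨2 * n, by omega⟩) h0
        have hp1 : p * (1 - p) = 0 := by rw [mul_sub, mul_one, hp, sub_self]
        simp only [add_mul, smul_mul_assoc, hp1, one_mul, smul_zero, add_zero, zero_mul,
          Matrix.zero_mulVec, Matrix.smul_mulVec, Matrix.sub_mulVec, Matrix.one_mulVec,
          Pi.smul_apply, Pi.sub_apply, Pi.zero_apply, smul_eq_mul] at h1
        rw [hpdef, τ.L_pow_last] at h1
        simp only [Pi.add_apply, Pi.smul_apply, stdVec, if_true, smul_eq_mul] at h1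
        rw [if_neg (by omega)] at h1
        exact pow_eq_zero_iff (n := 2 * n + 1) (by omega) |>.mp (by linear_combination -h1)
      rw [hMx, e2, zero_smul, zero_add, show y = 0 by linear_combination e1 - e2, zero_smul]
    · obtain ⟨a, ha⟩ := hscal r (by omega) rfl fun i hi => hndvd _ (by omega) (by
        have := i.isLt
        rw [abs_lt]
        constructor <;> omega)
      refine hpow a (τ.eq_of_commute hM ((Commute.pow_right (Commute.refl _) _).smul_right _) ?_) ?_
        (by rw [if_neg (by omega)]; omega)
      · rw [ha, Matrix.smul_mulVec, τ.L_pow_mulVec r (by omega)]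
      · rw [if_neg (by omega), mul_comm r, pow_mul, hrel, τ.L_pow_mulVec r (by omega)]

variable (A) in
/-- The element `J = b + E λ`. -/
def loopJ : LaurentSeries (MatOver n A) :=
  HahnSeries.single 0 (baseChange n A (bMat n)) + HahnSeries.single (-1) (baseChange n A τ.E)

/-- The relation `X ^ (2n+1) = λ (c X + 1 - c)`. -/
def LoopRel (X : LaurentSeries (MatOver n A)) : Prop := LambdaRel (2 * n + 1) τ.c X

/-- The equation `[∂ + J + u, X] = 0`. -/
def ZeroCurvature (D : Derivation ℝ A A) (u : Fin n → A) (X : LaurentSeries (MatOver n A)) : Prop :=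
  coeffMap (matDer n D) X + (τ.loopJ A + HahnSeries.single 0 (toVOver u)) * X -
    X * (τ.loopJ A + HahnSeries.single 0 (toVOver u)) = 0

/-- The difference of `X` and `J` has only terms of degree at most zero. -/
def LeadsWithJ (X : LaurentSeries (MatOver n A)) : Prop :=
  ∀ (m : ℤ) (i j : Fin (2 * n + 1)), τ.h * m - (((i : ℕ) : ℤ) - ((j : ℕ) : ℤ)) < 0 →
    (X - τ.loopJ A).coeff m i j = 0

variable (D : Derivation ℝ A A) (u : Fin n → A)

theorem regrade_loopJ :
    regrade n A τ.h τ.one_le_h (τ.loopJ A) = (τ.datum D).lead := by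
  rw [loopJ, map_add, regrade_single (q := 1), regrade_single (q := 1 - τ.h),
    mul_zero, zero_sub, mul_neg, mul_one, SeparableDatum.lead]
  · change _ = HahnSeries.single (-1) (baseChange n A (bMat n + τ.E))
    rw [show -(τ.h : ℤ) - (1 - τ.h) = -1 by ring, ← single_add_single, (baseChange n A).map_add]
  · intro i j hij
    rw [baseChange_apply, τ.E_apply i j hij, map_zero]
  · intro i j hij
    rw [baseChange_apply, bMat_apply, if_neg (by omega), map_zero]

theorem loopRel_iff (X : LaurentSeries (MatOver n A)) :
    τ.LoopRel X ↔ (τ.datum D).Rel (regrade n A τ.h τ.one_le_h X) := by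
  have hN : (τ.datum D).N = 2 * n + 1 := rfl
  rcases τ.kind with ⟨hc, hh, _⟩ | ⟨hc, hh, _⟩
  · have e : -(τ.h : ℤ) = -((2 * n + 1 : ℕ) : ℤ) := by rw [hh]
    rw [LoopRel, hc, lambdaRel_zero, SeparableDatum.rel_iff_of_eq_zero hc,
      ← (regrade_injective (h := τ.h) (hh := τ.one_le_h)).eq_iff, map_pow, regrade_single_one, hN,
      mul_neg, mul_one, e]
  · have e : -(τ.h : ℤ) = 1 - ((2 * n + 1 : ℕ) : ℤ) := by rw [hh]; push_cast; ring
    rw [LoopRel, hc, lambdaRel_one, SeparableDatum.rel_iff_of_eq_one hc,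
      ← (regrade_injective (h := τ.h) (hh := τ.one_le_h)).eq_iff, map_pow, map_mul,
      regrade_single_one, hN, mul_neg, mul_one, e]

theorem zeroCurvature_iff (X : LaurentSeries (MatOver n A)) :
    τ.ZeroCurvature D u X ↔ (τ.datum D).deriv (regrade n A τ.h τ.one_le_h X) +
      ((τ.datum D).lead + regrade n A τ.h τ.one_le_h (HahnSeries.single 0 (toVOver u))) *
        regrade n A τ.h τ.one_le_h X - regrade n A τ.h τ.one_le_h X *
      ((τ.datum D).lead + regrade n A τ.h τ.one_le_h (HahnSeries.single 0 (toVOver u))) = 0 := by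
  rw [ZeroCurvature, ← (regrade_injective (h := τ.h) (hh := τ.one_le_h)).eq_iff, map_sub, map_add,
    map_mul, map_mul, map_add, regrade_loopJ τ D, map_zero,
    regrade_coeffMap (f := D) (map_zero D) fun M i j => rfl]
  rfl

theorem leadsWithJ_iff (X : LaurentSeries (MatOver n A)) :
    τ.LeadsWithJ X ↔ VanishBelow 0 (regrade n A τ.h τ.one_le_h X - (τ.datum D).lead) := by
  rw [LeadsWithJ, ← regrade_loopJ τ D, ← map_sub, vanishBelow_regrade_iff]

/-- Strict upper triangularity of `u` is what makes it a lower order perturbation of `t L` in the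
principal grading. -/
theorem exists_regraded_dressing : Nonempty ((τ.datum D).Dressing
    (regrade n A τ.h τ.one_le_h (HahnSeries.single 0 (toVOver u)))) := by
  refine (τ.datum D).exists_dressing _ ?_ fun k => regrade_coeff_mem _ k
  rw [vanishBelow_regrade_iff]
  intro m i j hlt
  by_cases hm : m = 0
  · rw [hm, HahnSeries.coeff_single_same]
    refine toVOver_apply_of_le u i j ?_
    change (j : ℕ) ≤ i
    rw [hm] at hlt
    omega
  · rw [HahnSeries.coeff_single_of_ne hm]
    rfl

/-- The dressing and its inverse are homogeneous, so both are regradings of series in `λ`; this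
makes the solution conjugate to `J` by a series in `λ`. -/
theorem exists_solution : ∃ T : (LaurentSeries (MatOver n A))ˣ,
    τ.ZeroCurvature D u ((T : LaurentSeries (MatOver n A)) * τ.loopJ A *
      ((T⁻¹ : (LaurentSeries (MatOver n A))ˣ) : LaurentSeries (MatOver n A))) ∧
    τ.LoopRel ((T : LaurentSeries (MatOver n A)) * τ.loopJ A *
      ((T⁻¹ : (LaurentSeries (MatOver n A))ˣ) : LaurentSeries (MatOver n A))) ∧
    τ.LeadsWithJ ((T : LaurentSeries (MatOver n A)) * τ.loopJ A *
      ((T⁻¹ : (LaurentSeries (MatOver n A))ˣ) : LaurentSeries (MatOver n A))) := by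
  obtain ⟨e⟩ := τ.exists_regraded_dressing D u
  obtain ⟨T, hT⟩ := exists_regrade_eq (h := τ.h) (hh := τ.one_le_h) e.graded
  obtain ⟨S, hS⟩ := exists_regrade_eq (h := τ.h) (hh := τ.one_le_h) e.graded_inv
  have hTS : T * S = 1 := regrade_injective (h := τ.h) (hh := τ.one_le_h)
    (by rw [map_mul, hT, hS, Units.mul_inv, map_one])
  have hST : S * T = 1 := regrade_injective (h := τ.h) (hh := τ.one_le_h)
    (by rw [map_mul, hT, hS, Units.inv_mul, map_one])
  have hsol : regrade n A τ.h τ.one_le_h (T * τ.loopJ A * S) = e.sol := by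
    rw [map_mul, map_mul, hT, hS, regrade_loopJ τ D]
    rfl
  refine ⟨⟨T, S, hTS, hST⟩, ?_, ?_, ?_⟩
  · rw [zeroCurvature_iff]
    change (τ.datum D).deriv (regrade n A τ.h τ.one_le_h (T * τ.loopJ A * S)) + _ *
      regrade n A τ.h τ.one_le_h (T * τ.loopJ A * S) -
      regrade n A τ.h τ.one_le_h (T * τ.loopJ A * S) * _ = 0
    rw [hsol, e.bracket_sol]
  · rw [loopRel_iff τ D]
    change (τ.datum D).Rel (regrade n A τ.h τ.one_le_h (T * τ.loopJ A * S))
    rw [hsol]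
    exact e.rel_sol
  · rw [leadsWithJ_iff τ D]
    change VanishBelow 0 (regrade n A τ.h τ.one_le_h (T * τ.loopJ A * S) - _)
    rw [hsol]
    exact e.vanishBelow_sol_sub

variable {D u}

theorem solution_unique {X Y : LaurentSeries (MatOver n A)} (hX : τ.ZeroCurvature D u X)
    (hX' : τ.LoopRel X) (hX'' : τ.LeadsWithJ X) (hY : τ.ZeroCurvature D u Y)
    (hY' : τ.LoopRel Y) (hY'' : τ.LeadsWithJ Y) : X = Y := by
  obtain ⟨e⟩ := τ.exists_regraded_dressing D u
  refine regrade_injective (h := τ.h) (hh := τ.one_le_h) ?_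
  rw [e.eq_sol ((τ.zeroCurvature_iff D u X).mp hX) ((τ.loopRel_iff D X).mp hX')
      ((τ.leadsWithJ_iff D X).mp hX''),
    e.eq_sol ((τ.zeroCurvature_iff D u Y).mp hY) ((τ.loopRel_iff D Y).mp hY')
      ((τ.leadsWithJ_iff D Y).mp hY'')]

/-- After dressing, the leading coefficient commutes with `L` and is homogeneous. A degree in `t`
above one would make its power `2n+1` vanish. A degree below one contradicts `X ^ (2n+1) = λ` in
type A and the nonzero entry of `hB` in type B. In degree one the coefficient is `a L`, and `hA` or
`hB` fixes `a = 1`. -/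
theorem leadsWithJ_of [IsReduced A] [Nontrivial A] {X : LaurentSeries (MatOver n A)}
    (hX : τ.ZeroCurvature D u X) (hX' : τ.LoopRel X)
    (hA : τ.c = 0 → ∀ a : A, a ^ (2 * n + 1) = 1 → a = 1)
    (hB : τ.c ≠ 0 → ∃ i j : Fin (2 * n + 1), ((i : ℕ) : ℤ) - ((j : ℕ) : ℤ) = 1 - τ.h ∧
      τ.L A i j ≠ 0 ∧ (∀ a : A, a * τ.L A i j = τ.L A i j → a = 1) ∧
      X.coeff (-1) i j = τ.L A i j) : τ.LeadsWithJ X := by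
  have hn := τ.one_le
  obtain ⟨e⟩ := τ.exists_regraded_dressing D u
  rw [leadsWithJ_iff τ D]
  rw [zeroCurvature_iff] at hX
  rw [loopRel_iff τ D] at hX'
  set Y := regrade n A τ.h τ.one_le_h X with hYdef
  have hY0 : Y ≠ 0 := by
    intro h0
    by_cases hc : τ.c = 0
    · rw [h0, SeparableDatum.Rel] at hX'
      have h1 := congrArg (fun Z => (HahnSeries.coeff Z (-((2 * n + 1 : ℕ) : ℤ))) 0 0) hX'
      have hc' : (τ.datum D).c = 0 := hc
      have hN : (τ.datum D).N = 2 * n + 1 := rfl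
      rw [hc', hN, zero_pow (by omega)] at h1
      simp at h1
    · obtain ⟨i, j, hij, hL, _, hXij⟩ := hB hc
      refine hL ?_
      rw [← hXij, ← coeff_regrade_of_eq (h := τ.h) (hh := τ.one_le_h) X i j rfl, ← hYdef, h0]
      rfl
  set k := Y.order with hk
  have hYk : VanishBelow k Y := fun i hi => HahnSeries.coeff_eq_zero_of_lt_order hi
  obtain ⟨hVk, hVc⟩ := e.vanishBelow_conj hYk
  have hcomm := e.commute_conj hX
  have hrel := e.rel_conj hX'
  generalize ((e.T⁻¹ : (LaurentSeries (MatOver n A))ˣ) * Y * e.T :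
    LaurentSeries (MatOver n A)) = V at hVk hVc hcomm hrel
  have hM0 : Y.coeff k ≠ 0 := HahnSeries.coeff_order_eq_zero.not.mpr hY0
  have hMg : Y.coeff k ∈ gradedPiece n A τ.h (-k) := regrade_coeff_mem X k
  have hMc : Commute (τ.L A) (Y.coeff k) := hVc ▸ SeparableDatum.commute_coeff hcomm k
  have hN : (τ.datum D).N = 2 * n + 1 := rfl
  have hc' : (τ.datum D).c = τ.c := rfl
  rw [SeparableDatum.Rel, hN, hc'] at hrel
  have hcoef : ∀ a : ℤ, (V ^ (2 * n + 1)).coeff a =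
      τ.c • V.coeff (a + (2 * n : ℕ)) +
      (1 - τ.c) • (HahnSeries.single (-((2 * n + 1 : ℕ) : ℤ)) (1 : MatOver n A)).coeff a := by
    intro a
    rw [hrel, HahnSeries.coeff_add, HahnSeries.coeff_smul, HahnSeries.coeff_smul,
      HahnSeries.coeff_single_mul, one_mul]
    congr 3
    push_cast
    ring
  -- For `k < -1` the left side of the relation reaches further down than the right side: `(2n+1) k
  -- < k - 2n` and `(2n+1) k < -(2n+1)`.
  have hk1 : ¬ k < -1 := by
    intro hlt
    refine hM0 (τ.eq_zero_of_pow_eq_zero hMc hMg ?_)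
    have h1 := coeff_pow_lead hVk (2 * n + 1)
    rw [hcoef, hVk, HahnSeries.coeff_single_of_ne, smul_zero, smul_zero, add_zero, hVc] at h1
    · exact h1.symm
    · push_cast
      intro h2
      nlinarith
    · push_cast
      nlinarith
  have hk2 : ¬ -1 < k := by
    intro hlt
    by_cases hc : τ.c = 0
    · have h1 := (hVk.pow (2 * n + 1)) (-((2 * n + 1 : ℕ) : ℤ)) (by push_cast; nlinarith)
      rw [hcoef, hc, zero_smul, zero_add, sub_zero, one_smul, HahnSeries.coeff_single_same] at h1
      exact one_ne_zero h1
    · obtain ⟨i, j, hij, hL, _, hXij⟩ := hB hc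
      refine hL ?_
      rw [← hXij, ← coeff_regrade_of_eq (h := τ.h) (hh := τ.one_le_h) X i j
        (show -1 = (τ.h : ℤ) * (-1) - _ by rw [hij]; ring), ← hYdef, hYk _ hlt]
      rfl
  have hkeq : k = -1 := by omega
  rw [hkeq] at hVk hVc hMc hMg hYk
  rw [neg_neg] at hMg
  obtain ⟨a, ha⟩ := τ.eq_smul_of_mem_one hMc hMg
  have ha1 : a = 1 := by
    by_cases hc : τ.c = 0
    · refine hA hc a ?_
      have h1 := coeff_pow_lead hVk (2 * n + 1)
      rw [hcoef, hc, zero_smul, zero_add, sub_zero, one_smul, mul_neg_one,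
        HahnSeries.coeff_single_same, hVc, ha, smul_pow, L_pow_succ, hc, zero_smul, zero_add,
        sub_zero, one_smul] at h1
      have h2 := congrFun (congrFun h1 0) 0
      rw [Matrix.smul_apply, Matrix.one_apply_eq, smul_eq_mul, mul_one] at h2
      exact h2.symm
    · obtain ⟨i, j, hij, hL, hinj, hXij⟩ := hB hc
      refine hinj a ?_
      rw [← smul_eq_mul, ← Matrix.smul_apply, ← ha, hYdef, coeff_regrade_of_eq (m := -1) X i j, hXij]
      rw [hij]; ring
  have hlead : ∀ i : ℤ, (τ.datum D).lead.coeff i = if i = -1 then τ.L A else 0 := by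
    intro i
    by_cases hi : i = -1
    · rw [if_pos hi, hi, SeparableDatum.lead, HahnSeries.coeff_single_same]; rfl
    · rw [if_neg hi, SeparableDatum.lead, HahnSeries.coeff_single_of_ne hi]
  intro i hi
  rw [HahnSeries.coeff_sub, hlead]
  by_cases h1 : i = -1
  · rw [if_pos h1, h1, ha, ha1, one_smul, sub_self]
  · rw [if_neg h1, hYk i (by omega), sub_zero]

/-- The involution `X(λ) ↦ -C X(ελ)ᵗ C`. -/
def loopInv : LaurentSeries (MatOver n A) →+ LaurentSeries (MatOver n A) :=
  negTwist (adj n A) τ.ε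

theorem coeff_loopInv (X : LaurentSeries (MatOver n A)) (i : ℤ) :
    (τ.loopInv X).coeff i = -(((τ.ε ^ i : ℤˣ) : ℤ) • adj n A (X.coeff i)) := rfl

theorem loopInv_loopJ : τ.loopInv (τ.loopJ A) = τ.loopJ A := by
  have h1 : τ.ε ^ (-1 : ℤ) = τ.ε := by
    rcases τ.kind with ⟨_, _, h, _⟩ | ⟨_, _, h⟩ <;> rw [h] <;> rfl
  rw [loopInv, loopJ, map_add, negTwist_single, negTwist_single, adj_baseChange, adj_baseChange,
    adj_bMat, zpow_zero, Units.val_one, one_smul, h1, ← map_zsmul, τ.adj_E,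
    map_neg (baseChange n A), map_neg (baseChange n A), neg_neg, neg_neg]

/-- The involution fixes `J + u` and preserves the equation, the polynomial relation and the leading
term, so `solution_unique` applies to `X` and its image. -/
theorem loopInv_solution {X : LaurentSeries (MatOver n A)} (hX : τ.ZeroCurvature D u X)
    (hX' : τ.LoopRel X) (hX'' : τ.LeadsWithJ X) : τ.loopInv X = X := by
  have hK : τ.loopInv (τ.loopJ A + HahnSeries.single 0 (toVOver u)) =
      τ.loopJ A + HahnSeries.single 0 (toVOver u) := by
    rw [map_add, loopInv_loopJ, loopInv, negTwist_single, adj_toVOver, zpow_zero, Units.val_one,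
      one_smul, neg_neg]
  refine τ.solution_unique (D := D) (u := u)
    (negTwist_bracket (adj n A) (matDer n D) adj_mul (fun M => matDer_adj D M) τ.ε hK hX)
    (LambdaRel.negTwist (adj n A) adj_mul adj_one ?_ ⟨n, rfl⟩ hX') ?_ hX hX' hX''
  · rcases τ.kind with ⟨hc, _, hε, _⟩ | ⟨hc, _, hε⟩
    · exact Or.inl ⟨hc, hε⟩
    · exact Or.inr ⟨hc, hε⟩
  · intro m i j hlt
    rw [← loopInv_loopJ, ← map_sub, coeff_loopInv, Matrix.neg_apply, Matrix.smul_apply, adj_apply,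
      hX'' m (Fin.rev j) (Fin.rev i), mul_zero, smul_zero, neg_zero]
    have := rev_pos i
    have := rev_pos j
    rw [show ((((Fin.rev j : Fin (2 * n + 1)) : ℕ) : ℤ) - ((Fin.rev i : Fin (2 * n + 1)) : ℕ)) =
      (i : ℕ) - (j : ℕ) by omega]
    exact hlt

end LoopType

section Coefficients

theorem coeffHom_bracket {R S : Type*} [Ring R] [Ring S] (f : R →+* S) (W K X : LaurentSeries R) :
    coeffHom f (W + K * X - X * K) =
      coeffHom f W + coeffHom f K * coeffHom f X - coeffHom f X * coeffHom f K := by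
  rw [map_sub, map_add, map_mul, map_mul]

theorem coeff_bracket {R : Type*} [Ring R] (W K X : LaurentSeries R) (i : ℤ) :
    (W + K * X - X * K).coeff i = W.coeff i + (K * X - X * K).coeff i := by
  rw [add_sub_assoc, HahnSeries.coeff_add]

theorem coeffHom_lambdaRel {R S : Type*} [Ring R] [Ring S] (f : R →+* S) {N : ℕ} {c : ℤ}
    {X : LaurentSeries R} (h : LambdaRel N c (coeffHom f X)) :
    coeffHom f (X ^ N) = coeffHom f (c • (HahnSeries.single (-1) 1 * X) +
      (1 - c) • HahnSeries.single (-1) 1) := by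
  rw [map_pow, map_add, map_zsmul, map_zsmul, map_mul, coeffHom_single, map_one]
  exact h

end Coefficients

/-! ### Smooth functions as a differential algebra, and evaluation at a point. -/

section Smooth

/-- The algebra of smooth functions on the line. -/
def SmoothFn : Subalgebra ℝ (ℝ → ℝ) where
  carrier := {f | ContDiff ℝ ∞ f}
  mul_mem' := fun {f g} hf hg =>
    show ContDiff ℝ ∞ (f * g) from
      ContDiff.mul (show ContDiff ℝ ∞ f from hf) (show ContDiff ℝ ∞ g from hg)
  add_mem' := fun {f g} hf hg =>
    show ContDiff ℝ ∞ (f + g) from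
      ContDiff.add (show ContDiff ℝ ∞ f from hf) (show ContDiff ℝ ∞ g from hg)
  algebraMap_mem' := fun c => show ContDiff ℝ ∞ (fun _ : ℝ => c) from contDiff_const

theorem SmoothFn.contDiff (f : SmoothFn) : ContDiff ℝ ∞ (f : ℝ → ℝ) := f.2

theorem SmoothFn.differentiable (f : SmoothFn) : Differentiable ℝ (f : ℝ → ℝ) :=
  (SmoothFn.contDiff f).differentiable (by simp)

theorem contDiff_deriv {f : ℝ → ℝ} (hf : ContDiff ℝ ∞ f) : ContDiff ℝ ∞ (deriv f) :=
  (contDiff_infty_iff_deriv.mp hf).2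

/-- The derivative as a derivation of the algebra of smooth functions. -/
def SmoothFn.der : Derivation ℝ SmoothFn SmoothFn :=
  Derivation.mk'
    { toFun := fun f => ⟨deriv (f : ℝ → ℝ), contDiff_deriv (SmoothFn.contDiff f)⟩
      map_add' := fun f g => Subtype.ext (funext fun x =>
        deriv_add (SmoothFn.differentiable f x) (SmoothFn.differentiable g x))
      map_smul' := fun c f => Subtype.ext (funext fun x =>
        deriv_const_smul c (SmoothFn.differentiable f x)) }
    fun f g => Subtype.ext (funext fun x => by
      have h := deriv_mul (SmoothFn.differentiable f x) (SmoothFn.differentiable g x)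
      change deriv ((f : ℝ → ℝ) * (g : ℝ → ℝ)) x =
        (f : ℝ → ℝ) x * deriv (g : ℝ → ℝ) x + (g : ℝ → ℝ) x * deriv (f : ℝ → ℝ) x
      rw [h]
      ring)

/-- Evaluation of smooth functions at a point. -/
def SmoothFn.eval (x : ℝ) : SmoothFn →ₐ[ℝ] ℝ := (Pi.evalAlgHom ℝ (fun _ : ℝ => ℝ) x).comp SmoothFn.val

theorem SmoothFn.ext_eval {f g : SmoothFn} (h : ∀ x, SmoothFn.eval x f = SmoothFn.eval x g) : f = g :=
  Subtype.ext (funext h)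

instance : IsReduced SmoothFn where
  eq_zero := fun f ⟨k, hk⟩ => SmoothFn.ext_eval fun x => by
    have h : SmoothFn.eval x f ^ k = 0 := by rw [← map_pow, hk, map_zero]
    rw [map_zero]
    exact eq_zero_of_pow_eq_zero h

instance : Nontrivial SmoothFn :=
  ⟨0, 1, fun h => zero_ne_one ((congrArg (SmoothFn.eval 0) h : (0 : ℝ) = 1))⟩

end Smooth

section Evaluation

variable {n : ℕ} {A : Type*} [CommRing A] [Algebra ℝ A] (e : A →ₐ[ℝ] ℝ)

/-- Entrywise evaluation of matrices. -/
def evalMat (n : ℕ) (e : A →ₐ[ℝ] ℝ) : MatOver n A →+* Mat n := (e : A →+* ℝ).mapMatrix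

theorem evalMat_apply (M : MatOver n A) (i j : Fin (2 * n + 1)) : evalMat n e M i j = e (M i j) := rfl

theorem evalMat_baseChange (M : Mat n) : evalMat n e (baseChange n A M) = M := by
  ext i j
  rw [evalMat_apply, baseChange_apply, AlgHom.commutes]
  rfl

theorem evalMat_adj (M : MatOver n A) : evalMat n e (adj n A M) = adj n ℝ (evalMat n e M) := by
  ext i j
  rw [evalMat_apply, adj_apply, adj_apply, evalMat_apply]
  simp

theorem evalMat_toVOver (u : Fin n → A) : evalMat n e (toVOver u) = toV n fun k => e (u k) := by
  rw [toVOver, toV, map_sum]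
  refine Finset.sum_congr rfl fun k _ => ?_
  ext i j
  rw [evalMat_apply, Matrix.smul_apply, Matrix.smul_apply, smul_eq_mul, map_mul, baseChange_apply,
    AlgHom.commutes]
  rfl

/-- Coefficientwise evaluation of formal series. -/
def evalLoop (n : ℕ) (e : A →ₐ[ℝ] ℝ) : LaurentSeries (MatOver n A) →+* Loop n :=
  coeffHom (evalMat n e)

theorem coeff_evalLoop (X : LaurentSeries (MatOver n A)) (k : ℤ) :
    (evalLoop n e X).coeff k = evalMat n e (X.coeff k) := rfl

/-- The element `J = b + E λ` of the loop algebra. -/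
def LoopType.J (τ : LoopType n) : Loop n := monomial 0 (bMat n) + monomial 1 τ.E

theorem evalLoop_loopJ (τ : LoopType n) : evalLoop n e (τ.loopJ A) = τ.J := by
  rw [LoopType.loopJ, LoopType.J, evalLoop, map_add, coeffHom_single, coeffHom_single,
    evalMat_baseChange, evalMat_baseChange, monomial, monomial, neg_zero]

theorem evalLoop_loopJ_add (τ : LoopType n) (u : Fin n → A) :
    evalLoop n e (τ.loopJ A + HahnSeries.single 0 (toVOver u)) =
      τ.J + monomial 0 (toV n fun k => e (u k)) := by
  rw [map_add, evalLoop_loopJ, evalLoop, coeffHom_single, evalMat_toVOver, monomial, neg_zero]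

end Evaluation

/-! ### Invariance of traces under conjugation, and the polynomial relation of `J`. -/

section Trace

variable {n : ℕ}

theorem trace_coeff_mul_comm (X Y : Loop n) (k : ℤ) :
    ((X * Y).coeff k).trace = ((Y * X).coeff k).trace := by
  obtain ⟨p, hX⟩ := exists_vanishBelow X
  obtain ⟨q, hY⟩ := exists_vanishBelow Y
  rw [coeff_mul_Icc hX hY, coeff_mul_Icc hY hX, Matrix.trace_sum, Matrix.trace_sum]
  refine Finset.sum_bij' (fun i _ => k - i) (fun i _ => k - i) ?_ ?_ ?_ ?_ ?_
  · intro i hi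
    rw [Finset.mem_Icc] at hi ⊢
    constructor <;> linarith [hi.1, hi.2]
  · intro i hi
    rw [Finset.mem_Icc] at hi ⊢
    constructor <;> linarith [hi.1, hi.2]
  · intro i _; ring
  · intro i _; ring
  · intro i _
    rw [Matrix.trace_mul_comm, sub_sub_cancel]

theorem trace_coeff_conj (T : (Loop n)ˣ) (X : Loop n) (k : ℤ) :
    (((T : Loop n) * X * ((T⁻¹ : (Loop n)ˣ) : Loop n)).coeff k).trace = (X.coeff k).trace := by
  rw [trace_coeff_mul_comm, ← mul_assoc, Units.inv_mul, one_mul]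

theorem LoopType.trace_J (τ : LoopType n) (k : ℤ) : (τ.J.coeff k).trace = 0 := by
  have hb : (bMat n).trace = 0 := Finset.sum_eq_zero fun i _ => by
    rw [Matrix.diag_apply, bMat_apply, if_neg (by omega)]
  rw [J, HahnSeries.coeff_add, Matrix.trace_add, monomial, monomial]
  have h : ∀ (m : ℤ) (M : Mat n), M.trace = 0 → ((HahnSeries.single m M).coeff k).trace = 0 := by
    intro m M hM
    by_cases hk : k = m
    · rw [hk, HahnSeries.coeff_single_same, hM]
    · rw [HahnSeries.coeff_single_of_ne hk, Matrix.trace_zero]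
  rw [h _ _ hb, h _ _ τ.trace_E, add_zero]

theorem LoopType.lambdaRel_J (τ : LoopType n) : LambdaRel (2 * n + 1) τ.c τ.J := by
  have h : τ.LoopRel (τ.loopJ ℝ) := by
    rw [τ.loopRel_iff (0 : Derivation ℝ ℝ ℝ), τ.regrade_loopJ (0 : Derivation ℝ ℝ ℝ)]
    exact SeparableDatum.rel_lead _
  have := LambdaRel.map h (evalMat n (AlgHom.id ℝ ℝ))
  rwa [show coeffHom (evalMat n (AlgHom.id ℝ ℝ)) (τ.loopJ ℝ) = τ.J from evalLoop_loopJ _ τ] at this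

end Trace

/-! ### Uniqueness over the smooth functions. -/

section Uniqueness

variable {n : ℕ}

/-- The coordinates of a smooth curvature function. -/
def smoothCoord (u : ℝ → Fin n → ℝ) (hu : ContDiff ℝ ∞ u) (k : Fin n) : SmoothFn :=
  ⟨fun x => u x k, contDiff_pi.mp hu k⟩

theorem exists_smooth_loop {X : ℝ → Loop n} (hb : ∃ m : ℤ, ∀ x i, m < i → lamCoeff (X x) i = 0)
    (hs : ∀ i a b, ContDiff ℝ ∞ (fun x => lamCoeff (X x) i a b)) :
    ∃ Z : LaurentSeries (MatOver n SmoothFn), ∀ x, evalLoop n (SmoothFn.eval x) Z = X x := by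
  obtain ⟨m, hm⟩ := hb
  have hs' : ∀ k a b, ContDiff ℝ ∞ (fun x => (X x).coeff k a b) := fun k a b => by
    have := hs (-k) a b
    simpa only [lamCoeff, neg_neg] using this
  let f : ℤ → MatOver n SmoothFn := fun k => Matrix.of fun a b =>
    ⟨fun x => (X x).coeff k a b, hs' k a b⟩
  have hf : BddBelow (Function.support f) := by
    refine ⟨-m, fun k hk => ?_⟩
    by_contra hlt
    refine hk (Matrix.ext fun a b => SmoothFn.ext_eval fun x => ?_)
    change (X x).coeff k a b = 0
    have := hm x (-k) (by linarith)
    rw [lamCoeff, neg_neg] at this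
    rw [this]
    rfl
  refine ⟨HahnSeries.ofSuppBddBelow f hf, fun x => ?_⟩
  ext k a b
  rw [coeff_evalLoop, HahnSeries.coeff_ofSuppBddBelow]
  rfl

theorem ext_evalLoop {X Y : LaurentSeries (MatOver n SmoothFn)}
    (h : ∀ x, evalLoop n (SmoothFn.eval x) X = evalLoop n (SmoothFn.eval x) Y) : X = Y := by
  ext k a b
  refine congrFun (congrArg Subtype.val (SmoothFn.ext_eval fun x => ?_)) _
  exact congrFun (congrFun (congrArg (fun Z => HahnSeries.coeff Z k) (h x)) a) b

theorem matDeriv_evalLoop (Z : LaurentSeries (MatOver n SmoothFn)) (k : ℤ) (x : ℝ) :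
    matDeriv (fun y => (evalLoop n (SmoothFn.eval y) Z).coeff k) x =
      (evalLoop n (SmoothFn.eval x) (coeffMap (LoopType.matDer n SmoothFn.der) Z)).coeff k := by
  ext a b
  rfl

variable (τ : LoopType n)

/-- A family of series with a common degree bound is one series over the smooth functions. Pointwise
conjugacy enters only through the polynomial relation, so no smoothness of the conjugating matrices
in `x` is needed. -/
theorem exists_zeroCurvature_of_isResolvent {u : ℝ → Fin n → ℝ} (hu : ContDiff ℝ ∞ u)
    {X : ℝ → Loop n} (hX : IsResolvent n τ.J u X)
    (hE : τ.c ≠ 0 → τ.E ≠ 0 ∧ ∀ x, lamCoeff (X x) 1 = τ.E) :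
    ∃ Z : LaurentSeries (MatOver n SmoothFn), (∀ x, evalLoop n (SmoothFn.eval x) Z = X x) ∧
      τ.ZeroCurvature SmoothFn.der (smoothCoord u hu) Z ∧ τ.LoopRel Z ∧ τ.LeadsWithJ Z := by
  obtain ⟨Z, hZ⟩ := exists_smooth_loop hX.bounded hX.smooth
  have hZC : τ.ZeroCurvature SmoothFn.der (smoothCoord u hu) Z := by
    refine ext_evalLoop fun x => ?_
    refine (coeffHom_bracket _ _ _ _).trans ?_
    change evalLoop n _ _ + evalLoop n _ _ * evalLoop n _ _ - evalLoop n _ _ * evalLoop n _ _ = _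
    rw [evalLoop_loopJ_add, hZ]
    refine HahnSeries.ext (funext fun k => ?_)
    have h := hX.commute x (-k)
    simp only [lamCoeff, neg_neg] at h
    simp only [← hZ] at h
    rw [matDeriv_evalLoop, hZ] at h
    exact (coeff_bracket _ _ _ _).trans h
  have hZR : τ.LoopRel Z := by
    refine ext_evalLoop fun x => ?_
    obtain ⟨T, hT⟩ := hX.conjugate x
    have h := τ.lambdaRel_J.conj T
    rw [← hT, ← hZ] at h
    exact coeffHom_lambdaRel _ h
  refine ⟨Z, hZ, hZC, hZR, τ.leadsWithJ_of hZC hZR (fun _ a ha => ?_) fun hc => ?_⟩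
  · refine SmoothFn.ext_eval fun x => ?_
    have h : SmoothFn.eval x a ^ (2 * n + 1) = 1 := by rw [← map_pow, ha, map_one]
    have hodd : Odd (2 * n + 1) := ⟨n, rfl⟩
    -- Odd powers are injective on `ℝ`; in type A this removes the sign ambiguity.
    rw [map_one]
    exact hodd.strictMono_pow.injective (by simpa using h)
  · obtain ⟨hE0, hXE⟩ := hE hc
    have hn := τ.one_le
    have hh := τ.two_n_le_h
    obtain ⟨i, j, hij⟩ : ∃ i j, τ.E i j ≠ 0 := by
      by_contra! h
      exact hE0 (Matrix.ext h)
    have hsub : ((i : ℕ) : ℤ) - ((j : ℕ) : ℤ) = 1 - τ.h := by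
      by_contra h
      exact hij (τ.E_apply i j h)
    have hL : τ.L SmoothFn i j = algebraMap ℝ SmoothFn (τ.E i j) := by
      rw [LoopType.L, baseChange_apply, Matrix.add_apply, bMat_apply, if_neg (by omega), zero_add]
    have hLx : ∀ x, SmoothFn.eval x (τ.L SmoothFn i j) = τ.E i j := fun x => by
      rw [hL, AlgHom.commutes]; rfl
    refine ⟨i, j, hsub, fun h0 => hij ?_, fun a ha => SmoothFn.ext_eval fun x => ?_,
      SmoothFn.ext_eval fun x => ?_⟩
    · rw [← hLx 0, h0, map_zero]
    · have h := congrArg (SmoothFn.eval x) ha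
      rw [map_mul, hLx] at h
      rw [map_one]
      exact mul_right_cancel₀ hij (by rw [h, one_mul])
    · rw [hLx, ← hXE x, ← hZ x]
      rfl

theorem resolvent_unique {u : ℝ → Fin n → ℝ} (hu : ContDiff ℝ ∞ u)
    {X Y : ℝ → Loop n} (hX : IsResolvent n τ.J u X) (hY : IsResolvent n τ.J u Y)
    (hXE : τ.c ≠ 0 → τ.E ≠ 0 ∧ ∀ x, lamCoeff (X x) 1 = τ.E)
    (hYE : τ.c ≠ 0 → τ.E ≠ 0 ∧ ∀ x, lamCoeff (Y x) 1 = τ.E) : X = Y := by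
  obtain ⟨Z, hZ, h1, h2, h3⟩ := exists_zeroCurvature_of_isResolvent τ hu hX hXE
  obtain ⟨W, hW, h4, h5, h6⟩ := exists_zeroCurvature_of_isResolvent τ hu hY hYE
  funext x
  rw [← hZ, ← hW, τ.solution_unique h1 h2 h3 h4 h5 h6]

end Uniqueness

/-! ### Existence over the differential polynomials. -/

section DiffPoly

variable {n : ℕ}

/-- The total derivative of differential polynomials. -/
def DiffPoly.der (n : ℕ) : Derivation ℝ (DiffPoly n) (DiffPoly n) :=
  MvPolynomial.mkDerivation ℝ fun v => MvPolynomial.X (v.1, v.2 + 1)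

/-- Evaluation of differential polynomials, as a homomorphism. -/
def DiffPoly.evalHom (u : ℝ → Fin n → ℝ) (x : ℝ) : DiffPoly n →ₐ[ℝ] ℝ :=
  MvPolynomial.aeval fun v : Fin n × ℕ => iteratedDeriv v.2 (fun y => u y v.1) x

theorem DiffPoly.evalHom_apply (u : ℝ → Fin n → ℝ) (x : ℝ) (p : DiffPoly n) :
    DiffPoly.evalHom u x p = p.evalAt u x := by
  rfl

theorem contDiff_iteratedDeriv {f : ℝ → ℝ} (hf : ContDiff ℝ ∞ f) (m : ℕ) :
    ContDiff ℝ ∞ (iteratedDeriv m f) := by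
  induction m with
  | zero => rwa [iteratedDeriv_zero]
  | succ m ih => rw [iteratedDeriv_succ]; exact contDiff_deriv ih

theorem DiffPoly.contDiff_evalHom {u : ℝ → Fin n → ℝ} (hu : ContDiff ℝ ∞ u) (p : DiffPoly n) :
    ContDiff ℝ ∞ fun x => DiffPoly.evalHom u x p := by
  induction p using MvPolynomial.induction_on with
  | C a => simpa [DiffPoly.evalHom] using contDiff_const
  | add p q hp hq => simpa only [map_add] using hp.add hq
  | mul_X p v hp =>
    have hv := contDiff_iteratedDeriv (contDiff_pi.mp hu v.1) v.2
    simpa only [map_mul, DiffPoly.evalHom, MvPolynomial.aeval_X] using hp.mul hv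

theorem DiffPoly.hasDerivAt_evalHom {u : ℝ → Fin n → ℝ} (hu : ContDiff ℝ ∞ u) (p : DiffPoly n)
    (x : ℝ) : HasDerivAt (fun y => DiffPoly.evalHom u y p)
      (DiffPoly.evalHom u x (DiffPoly.der n p)) x := by
  induction p using MvPolynomial.induction_on with
  | C a =>
    have h : DiffPoly.der n (MvPolynomial.C a) = 0 := (DiffPoly.der n).map_algebraMap a
    rw [h, map_zero]
    simpa [DiffPoly.evalHom] using hasDerivAt_const x a
  | add p q hp hq => simpa only [map_add] using hp.fun_add hq
  | mul_X p v hp =>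
    have hv : HasDerivAt (fun y => DiffPoly.evalHom u y (MvPolynomial.X v))
        (DiffPoly.evalHom u x (MvPolynomial.X (v.1, v.2 + 1))) x := by
      simp only [DiffPoly.evalHom, MvPolynomial.aeval_X, iteratedDeriv_succ]
      exact ((contDiff_iteratedDeriv (contDiff_pi.mp hu v.1) v.2).differentiable
        (by simp) x).hasDerivAt
    have hX : DiffPoly.der n (MvPolynomial.X v) = MvPolynomial.X (v.1, v.2 + 1) :=
      MvPolynomial.mkDerivation_X _ _ _
    simp only [map_mul, Derivation.leibniz, hX, map_add, smul_eq_mul]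
    exact (hp.fun_mul hv).congr_deriv (by ring)

/-- The equation is solved once for the generic curvature with coordinates the variables `(k, 0)`.
Evaluation along `u` intertwines the total derivative with `d/dx`, so it yields solutions whose
coefficients are differential polynomials. -/
theorem exists_diffPoly_resolvent (τ : LoopType n) :
    ∃ P : LaurentSeries (MatOver n (DiffPoly n)), ∀ u : ℝ → Fin n → ℝ, ContDiff ℝ ∞ u →
      IsResolvent n τ.J u (fun x => evalLoop n (DiffPoly.evalHom u x) P) ∧
      (∀ x i, ((τ.ε ^ (-i) : ℤˣ) : ℤ) •
        adj n ℝ (lamCoeff (evalLoop n (DiffPoly.evalHom u x) P) i) =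
          -lamCoeff (evalLoop n (DiffPoly.evalHom u x) P) i) ∧
      ∀ (x : ℝ) (m : ℤ) (i j : Fin (2 * n + 1)),
        τ.h * m - (((i : ℕ) : ℤ) - ((j : ℕ) : ℤ)) < 0 →
        (evalLoop n (DiffPoly.evalHom u x) P - τ.J).coeff m i j = 0 := by
  obtain ⟨T, h1, h2, h3⟩ := τ.exists_solution (DiffPoly.der n) fun k => MvPolynomial.X (k, 0)
  set P : LaurentSeries (MatOver n (DiffPoly n)) := (T : LaurentSeries (MatOver n (DiffPoly n))) *
    τ.loopJ (DiffPoly n) * ((T⁻¹ : (LaurentSeries (MatOver n (DiffPoly n)))ˣ) :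
      LaurentSeries (MatOver n (DiffPoly n))) with hP
  refine ⟨P, fun u hu => ⟨⟨?_, ?_, ?_, ?_⟩, ?_, ?_⟩⟩
  · obtain ⟨p, hp⟩ := exists_vanishBelow P
    refine ⟨-p, fun x i hi => ?_⟩
    rw [lamCoeff, coeff_evalLoop, hp _ (by linarith), map_zero]
  · intro i a b
    exact DiffPoly.contDiff_evalHom hu _
  · intro x i
    have hux : (fun k => DiffPoly.evalHom u x (MvPolynomial.X (k, 0))) = u x := by
      funext k
      simp [DiffPoly.evalHom]
    have h := congrArg (fun Z => HahnSeries.coeff (evalLoop n (DiffPoly.evalHom u x) Z) (-i)) h1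
    have h' := ((coeff_bracket _ _ _ _).symm.trans (congrArg (fun Z => HahnSeries.coeff Z (-i))
      (coeffHom_bracket (evalMat n (DiffPoly.evalHom u x)) (coeffMap (LoopType.matDer n
        (DiffPoly.der n)) P) _ P).symm)).trans h
    change _ + (evalLoop n _ _ * evalLoop n _ _ - evalLoop n _ _ * evalLoop n _ _).coeff _ = _ at h'
    rw [evalLoop_loopJ_add, hux] at h'
    have hd : matDeriv (fun y => lamCoeff (evalLoop n (DiffPoly.evalHom u y) P) i) x =
        (evalLoop n (DiffPoly.evalHom u x)
          (coeffMap (LoopType.matDer n (DiffPoly.der n)) P)).coeff (-i) := by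
      ext a b
      exact (DiffPoly.hasDerivAt_evalHom hu _ x).deriv
    rw [hd]
    exact h'
  · intro x
    refine ⟨Units.map (evalLoop n (DiffPoly.evalHom u x) : _ →* _) T, ?_⟩
    rw [hP, map_mul, map_mul, evalLoop_loopJ]
    rfl
  · intro x i
    have h := congrArg (fun Z => evalMat n (DiffPoly.evalHom u x) (HahnSeries.coeff Z (-i)))
      (τ.loopInv_solution h1 h2 h3)
    simp only [LoopType.coeff_loopInv, map_neg, map_zsmul, evalMat_adj] at h
    exact neg_eq_iff_eq_neg.mp h
  · intro x m i j hlt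
    rw [← evalLoop_loopJ (DiffPoly.evalHom u x) τ, ← map_sub, coeff_evalLoop, evalMat_apply,
      h3 m i j hlt, map_zero]

end DiffPoly

/-! ### Powers of the solution and their coefficient of `λ^0`. -/

section PowerBracket

variable {R : Type*} [Ring R]

theorem bracket_pow (D : R →+ R) (hD : ∀ a b, D (a * b) = D a * b + a * D b)
    {K X : LaurentSeries R} (h : coeffMap D X + K * X - X * K = 0) (k : ℕ) :
    coeffMap D (X ^ k) + K * X ^ k - X ^ k * K = 0 := by
  have hX : coeffMap D X = X * K - K * X := by
    rw [eq_sub_iff_add_eq]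
    exact sub_eq_zero.mp h
  have h1 : coeffMap D (1 : LaurentSeries R) = 0 := by
    have := coeffMap_leibniz D hD 1 1
    rw [mul_one, mul_one, one_mul] at this
    exact left_eq_add.mp this
  induction k with
  | zero => rw [pow_zero, h1, mul_one, one_mul, zero_add, sub_self]
  | succ k ih =>
    have hk : coeffMap D (X ^ k) = X ^ k * K - K * X ^ k := by
      rw [eq_sub_iff_add_eq]
      exact sub_eq_zero.mp ih
    rw [pow_succ, coeffMap_leibniz D hD, hk, hX]
    noncomm_ring

/-- Comparison of the coefficients of `λ^0`; `X.coeff 1` belongs to `λ^{-1}` and meets the factor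
`λ` of `E`. -/
theorem coeff_zero_bracket (D : R →+ R) {b v e : R} {X : LaurentSeries R}
    (h : coeffMap D X + (HahnSeries.single 0 b + HahnSeries.single (-1) e + HahnSeries.single 0 v) *
      X - X * (HahnSeries.single 0 b + HahnSeries.single (-1) e + HahnSeries.single 0 v) = 0) :
    D (X.coeff 0) + (b + v) * X.coeff 0 - X.coeff 0 * (b + v) = X.coeff 1 * e - e * X.coeff 1 := by
  have h0 := congrArg (fun Y => HahnSeries.coeff Y 0) h
  simp only [add_mul, mul_add, HahnSeries.coeff_add, HahnSeries.coeff_sub, coeff_coeffMap,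
    HahnSeries.coeff_single_mul, HahnSeries.coeff_mul_single, sub_zero, sub_neg_eq_add, zero_add,
    HahnSeries.coeff_zero] at h0
  rw [← sub_eq_zero, ← h0]
  noncomm_ring

end PowerBracket

namespace LoopType

variable {n : ℕ} (τ : LoopType n) {A : Type*} [CommRing A] [Algebra ℝ A]

theorem eq_zero_of_eq_neg {c : A} (h : c = -c) : c = 0 := by
  have h2 : c + c = 0 := by
    nth_rewrite 2 [h]
    exact add_neg_cancel c
  have h3 : (2 : ℝ) • c = 0 := by rw [two_smul, h2]
  rw [← one_smul ℝ c, show (1 : ℝ) = 2⁻¹ * 2 by norm_num, mul_smul, h3, smul_zero]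

/-- The adjoint reflects in the antidiagonal, and on it the sign `(-1)^{i+j}` is `1`; so
antidiagonal entries of elements of `o(n+1,n)` equal their negatives. -/
theorem adj_corner {M : MatOver n A} (hM : adj n A M = -M) (i j : Fin (2 * n + 1))
    (hij : j = Fin.rev i) : M i j = 0 := by
  have h := congrFun (congrFun hM i) j
  rw [adj_apply, Matrix.neg_apply, hij, Fin.rev_rev] at h
  have := rev_pos i
  rw [show (i : ℕ) + (Fin.rev i : Fin (2 * n + 1)) = 2 * n by omega, pow_mul, neg_one_sq, one_pow,
    one_mul] at h
  rw [hij]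
  exact eq_zero_of_eq_neg h

theorem loopInv_pow {X : LaurentSeries (MatOver n A)} (h : τ.loopInv X = X) {k : ℕ} (hk : Odd k) :
    τ.loopInv (X ^ k) = X ^ k := by
  have h1 : twist (adj n A) τ.ε X = -X := by
    rw [← neg_eq_iff_eq_neg]
    exact h
  have h2 : twist (adj n A) τ.ε (X ^ k) = -X ^ k := by
    rw [twist_pow (adj n A) adj_mul adj_one, h1, hk.neg_pow]
  change -twist (adj n A) τ.ε (X ^ k) = X ^ k
  rw [h2]
  exact neg_neg (X ^ k)

theorem adj_coeff_zero {X : LaurentSeries (MatOver n A)} (h : τ.loopInv X = X) :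
    adj n A (X.coeff 0) = -X.coeff 0 := by
  have h0 := congrArg (fun Y => HahnSeries.coeff Y 0) h
  simp only [coeff_loopInv, zpow_zero, Units.val_one, one_smul] at h0
  exact neg_eq_iff_eq_neg.mp h0

/-- The left side is `[X_{-1}, E]`. As `E` sits in the upper right corner, a lower entry of this
bracket can only involve the lower left corner entry of `X_{-1}`, and only in type B. There `X_{-1}`
is in `o(n+1,n)`, so that entry is zero by `adj_corner`. -/
theorem coeff_zero_bracket_upper (D : Derivation ℝ A A) {u : Fin n → A}
    {X : LaurentSeries (MatOver n A)} (hX : τ.ZeroCurvature D u X) (h : τ.loopInv X = X)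
    (i j : Fin (2 * n + 1)) (hij : j < i) :
    (matDer n D (X.coeff 0) + (baseChange n A (bMat n) + toVOver u) * X.coeff 0 -
      X.coeff 0 * (baseChange n A (bMat n) + toVOver u)) i j = 0 := by
  rw [coeff_zero_bracket (matDer n D) hX, Matrix.sub_apply, Matrix.mul_apply, Matrix.mul_apply]
  have hij : (j : ℕ) < i := hij
  have hi := i.isLt
  have hn := τ.one_le
  have key : ∀ p q : Fin (2 * n + 1), τ.h = 2 * n → (p : ℕ) = 2 * n → (q : ℕ) = 0 →
      X.coeff 1 p q = 0 := fun p q hh hp hq => by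
    refine adj_corner (n := n) ?_ p q (Fin.ext (by rw [Fin.val_rev]; omega))
    have h1 := congrArg (fun Y => HahnSeries.coeff Y 1) h
    have hε : τ.ε = 1 := by
      rcases τ.kind with ⟨_, h, _⟩ | ⟨_, _, h⟩
      · omega
      · exact h
    simp only [coeff_loopInv, hε, one_zpow, Units.val_one, one_smul] at h1
    exact neg_eq_iff_eq_neg.mp h1
  have hE : ∀ p q : Fin (2 * n + 1), ((p : ℕ) : ℤ) - ((q : ℕ) : ℤ) ≠ 1 - τ.h →
      baseChange n A τ.E p q = 0 := fun p q hpq => by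
    rw [baseChange_apply, τ.E_apply p q hpq, map_zero]
  have hh : τ.h = 2 * n + 1 ∨ τ.h = 2 * n := by
    rcases τ.kind with ⟨_, h, _⟩ | ⟨_, h, _⟩ <;> omega
  rw [Finset.sum_eq_zero, Finset.sum_eq_zero, sub_zero]
  · intro k _
    by_cases hk : ((i : ℕ) : ℤ) - ((k : ℕ) : ℤ) = 1 - τ.h
    · have := k.isLt
      rw [key k j (by omega) (by omega) (by omega), mul_zero]
    · rw [hE i k hk, zero_mul]
  · intro k _
    by_cases hk : ((k : ℕ) : ℤ) - ((j : ℕ) : ℤ) = 1 - τ.h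
    · rw [key i k (by omega) (by omega) (by omega), zero_mul]
    · rw [hE k j hk, mul_zero]

/-- The family `X` is the solution attached to the curvature `u`. -/
def IsSolution (u : ℝ → Fin n → ℝ) (X : ℝ → Loop n) : Prop :=
  IsResolvent n τ.J u X ∧ (τ.c ≠ 0 → τ.E ≠ 0 ∧ ∀ x, lamCoeff (X x) 1 = τ.E)

theorem exists_zerothCoeff {u : ℝ → Fin n → ℝ} (hu : ContDiff ℝ ∞ u) {X : ℝ → Loop n}
    (hX : τ.IsSolution u X) {k : ℕ} (hk : Odd k) :
    ∃ Q : MatOver n SmoothFn, (∀ x, evalMat n (SmoothFn.eval x) Q = lamCoeff (X x ^ k) 0) ∧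
      adj n SmoothFn Q = -Q ∧ ∀ i j, j < i →
        (matDer n SmoothFn.der Q +
          (baseChange n SmoothFn (bMat n) + toVOver (smoothCoord u hu)) * Q -
          Q * (baseChange n SmoothFn (bMat n) + toVOver (smoothCoord u hu))) i j = 0 := by
  obtain ⟨Z, hZ, h1, h2, h3⟩ := exists_zeroCurvature_of_isResolvent τ hu hX.1 hX.2
  have h4 := τ.loopInv_solution h1 h2 h3
  have h5 := τ.loopInv_pow h4 hk
  have h6 : τ.ZeroCurvature SmoothFn.der (smoothCoord u hu) (Z ^ k) :=
    bracket_pow (matDer n SmoothFn.der) (matDer_mul _) h1 k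
  refine ⟨(Z ^ k).coeff 0, fun x => ?_, τ.adj_coeff_zero h5,
    τ.coeff_zero_bracket_upper SmoothFn.der h6 h5⟩
  rw [← coeff_evalLoop, map_pow, hZ]
  rfl

end LoopType

/-! ### The series `P` and `S`. -/

section Solutions

variable {n : ℕ}

namespace LoopType

variable (τ : LoopType n)

theorem lamCoeff_J_one : lamCoeff τ.J 1 = τ.E := by
  rw [J, lamCoeff, HahnSeries.coeff_add, monomial, monomial, HahnSeries.coeff_single_same,
    HahnSeries.coeff_single_of_ne (by norm_num), zero_add]

theorem exists_diffPoly_solution (hE : τ.c ≠ 0 → τ.E ≠ 0) :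
    ∃ P : LaurentSeries (MatOver n (DiffPoly n)), ∀ u : ℝ → Fin n → ℝ, ContDiff ℝ ∞ u →
      τ.IsSolution u (fun x => evalLoop n (DiffPoly.evalHom u x) P) ∧
      ∀ x i, ((τ.ε ^ (-i) : ℤˣ) : ℤ) •
        adj n ℝ (lamCoeff (evalLoop n (DiffPoly.evalHom u x) P) i) =
          -lamCoeff (evalLoop n (DiffPoly.evalHom u x) P) i := by
  obtain ⟨P, hP⟩ := exists_diffPoly_resolvent τ
  refine ⟨P, fun u hu => ?_⟩
  obtain ⟨h1, h2, h3⟩ := hP u hu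
  refine ⟨⟨h1, fun hc => ⟨hE hc, fun x => ?_⟩⟩, h2⟩
  obtain ⟨hh, hε⟩ : τ.h = 2 * n ∧ τ.ε = 1 := by
    rcases τ.kind with ⟨h, _⟩ | ⟨_, h⟩
    · exact absurd h hc
    · exact h
  ext i j
  have hi := i.isLt
  have hj := j.isLt
  -- The principal leading term determines every entry of the coefficient of `λ` except the upper
  -- right corner, which has degree zero in `t`; it vanishes by skewness.
  by_cases hij : (i : ℕ) = 0 ∧ (j : ℕ) = 2 * n
  · have h := h2 x 1
    rw [hε, one_zpow, Units.val_one, one_smul] at h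
    rw [adj_corner h i j (Fin.ext (by rw [Fin.val_rev]; omega)), τ.E_apply i j (by omega)]
  · have h := h3 x (-1) i j (by rw [hh]; push_cast; omega)
    have h' : lamCoeff (evalLoop n (DiffPoly.evalHom u x) P) 1 i j - lamCoeff τ.J 1 i j = 0 := h
    rw [sub_eq_zero.mp h', lamCoeff_J_one]

theorem IsSolution.unique {u : ℝ → Fin n → ℝ} (hu : ContDiff ℝ ∞ u) {X Y : ℝ → Loop n}
    (hX : τ.IsSolution u X) (hY : τ.IsSolution u Y) : X = Y :=
  resolvent_unique τ hu hX.1 hY.1 hX.2 hY.2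

theorem exists_diffPoly_coeff (hE : τ.c ≠ 0 → τ.E ≠ 0) (k : ℕ) (i : ℤ) :
    ∃ p : Fin (2 * n + 1) → DiffPoly n, ∀ u : ℝ → Fin n → ℝ, ContDiff ℝ ∞ u →
      ∀ X, τ.IsSolution u X → ∀ x a,
        (lamCoeff (X x ^ k) i *ᵥ e1 n) a = (p a).evalAt u x := by
  obtain ⟨P, hP⟩ := τ.exists_diffPoly_solution hE
  refine ⟨fun a => (P ^ k).coeff (-i) a 0, fun u hu X hX x a => ?_⟩
  rw [hX.unique τ hu (hP u hu).1, ← DiffPoly.evalHom_apply, ← map_pow, lamCoeff, coeff_evalLoop,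
    e1, Matrix.mulVec_single_one]
  rfl

end LoopType

theorem betaB_ne_zero (hn : 1 ≤ n) : betaB n ≠ 0 := fun h => by
  have h1 := congrFun (congrFun h ⟨0, by omega⟩) ⟨2 * n - 1, by omega⟩
  rw [betaB, Matrix.smul_apply, Matrix.add_apply, elem_apply, elem_apply, if_pos (by simp; omega),
    if_neg (by simp)] at h1
  norm_num at h1

theorem isSolution_of_isP (hn : 1 ≤ n) {u : ℝ → Fin n → ℝ} {P : ℝ → Loop n} (h : IsP n u P) :
    (typeB n hn).IsSolution u P := ⟨h.1, fun _ => ⟨betaB_ne_zero hn, h.2.2⟩⟩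

theorem isSolution_of_isS (hn : 1 ≤ n) {u : ℝ → Fin n → ℝ} {S : ℝ → Loop n} (h : IsS n u S) :
    (typeA n hn).IsSolution u S := ⟨h.1, fun hc => absurd rfl hc⟩

theorem existsUnique_isP (hn : 1 ≤ n) {u : ℝ → Fin n → ℝ} (hu : ContDiff ℝ ∞ u) :
    ∃! P : ℝ → Loop n, IsP n u P := by
  obtain ⟨P, hP⟩ := (typeB n hn).exists_diffPoly_solution fun _ => betaB_ne_zero hn
  obtain ⟨h1, h2⟩ := hP u hu
  refine ⟨_, ⟨h1.1, fun x i => ?_, (h1.2 one_ne_zero).2⟩, fun Y hY =>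
    (isSolution_of_isP hn hY).unique _ hu h1⟩
  rw [mem_orthogonalLie_iff]
  have h := h2 x i
  rwa [show (typeB n hn).ε = 1 from rfl, one_zpow, Units.val_one, one_smul] at h

theorem neg_one_zpow_smul (i : ℤ) (M : Mat n) :
    (((-1 : ℤˣ) ^ (-i) : ℤˣ) : ℤ) • M = ((-1 : ℝ) ^ i) • M := by
  rcases Int.even_or_odd i with h | h
  · rw [h.neg_one_zpow, (even_neg.mpr h).neg_one_zpow, Units.val_one, one_smul, one_smul]
  · rw [h.neg_one_zpow, h.neg.neg_one_zpow, Units.val_neg, Units.val_one, neg_smul, neg_smul,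
      one_smul, one_smul]

theorem existsUnique_isS (hn : 1 ≤ n) {u : ℝ → Fin n → ℝ} (hu : ContDiff ℝ ∞ u) :
    ∃! S : ℝ → Loop n, IsS n u S := by
  obtain ⟨P, hP⟩ := (typeA n hn).exists_diffPoly_solution fun hc => absurd rfl hc
  obtain ⟨h1, h2⟩ := hP u hu
  refine ⟨_, ⟨h1.1, fun x i => ⟨?_, ?_⟩⟩, fun Y hY =>
    (isSolution_of_isS hn hY).unique _ hu h1⟩
  -- The trace condition follows from conjugacy to `J`, whose coefficients are trace-free.
  · obtain ⟨T, hT⟩ := h1.1.conjugate x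
    rw [hT, lamCoeff, trace_coeff_conj, LoopType.trace_J]
  · have h := h2 x i
    rw [show (typeA n hn).ε = -1 from rfl, neg_one_zpow_smul] at h
    have e : adj n ℝ (lamCoeff (evalLoop n (DiffPoly.evalHom u x) P) i) =
      Cmat n * (lamCoeff (evalLoop n (DiffPoly.evalHom u x) P) i)ᵀ * Cmat n := rfl
    rw [← e, h, neg_add_cancel]

end Solutions

/-! ### The normal form modulo `[∂ + b + u, ·]`. -/

section Gauge

open LoopType

variable {n : ℕ} {A : Type*} [CommRing A]

/-- The entries of `M` below the `k`-th superdiagonal vanish. -/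
def UpperFrom (k : ℕ) (M : MatOver n A) : Prop :=
  ∀ i j : Fin (2 * n + 1), (j : ℕ) < i + k → M i j = 0

theorem UpperFrom.add {k : ℕ} {M N : MatOver n A} (hM : UpperFrom k M) (hN : UpperFrom k N) :
    UpperFrom k (M + N) := fun i j h => by
  rw [Matrix.add_apply, hM i j h, hN i j h, add_zero]

theorem UpperFrom.sub {k : ℕ} {M N : MatOver n A} (hM : UpperFrom k M) (hN : UpperFrom k N) :
    UpperFrom k (M - N) := fun i j h => by
  rw [Matrix.sub_apply, hM i j h, hN i j h, sub_zero]

theorem UpperFrom.smul {k : ℕ} {M : MatOver n A} (a : A) (hM : UpperFrom k M) :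
    UpperFrom k (a • M) := fun i j h => by
  rw [Matrix.smul_apply, hM i j h, smul_zero]

theorem UpperFrom.mono {k l : ℕ} {M : MatOver n A} (hM : UpperFrom k M) (h : l ≤ k) :
    UpperFrom l M := fun i j hij => hM i j (by omega)

theorem UpperFrom.mul {k l : ℕ} {M N : MatOver n A} (hM : UpperFrom k M) (hN : UpperFrom l N) :
    UpperFrom (k + l) (M * N) := fun i j h => by
  rw [Matrix.mul_apply]
  refine Finset.sum_eq_zero fun p _ => ?_
  by_cases hp : (p : ℕ) < i + k
  · rw [hM i p hp, zero_mul]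
  · rw [hN p j (by omega), mul_zero]

/-- The entry of `M` in row `l` and column `l + k`, or zero outside of the matrix. -/
def diagEntry (k : ℕ) (M : MatOver n A) (l : ℕ) : A :=
  if h : l + k < 2 * n + 1 then M ⟨l, by omega⟩ ⟨l + k, h⟩ else 0

theorem diagEntry_eq {k : ℕ} (M : MatOver n A) (i j : Fin (2 * n + 1)) (h : (j : ℕ) = i + k) :
    diagEntry k M i = M i j := by
  have hj := j.isLt
  rw [diagEntry, dif_pos (by omega)]
  congr 1
  exact Fin.ext h.symm

theorem diagEntry_sub (k : ℕ) (M N : MatOver n A) (l : ℕ) :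
    diagEntry k (M - N) l = diagEntry k M l - diagEntry k N l := by
  rw [diagEntry, diagEntry, diagEntry]
  split_ifs
  · rfl
  · rw [sub_zero]

variable [Algebra ℝ A]

theorem upperFrom_toVOver (u : Fin n → A) : UpperFrom 1 (toVOver u) := fun i j h =>
  toVOver_apply_of_le u i j (Fin.le_def.mpr (by omega))

theorem upperFrom_matDer {k : ℕ} (D : Derivation ℝ A A) {M : MatOver n A} (hM : UpperFrom k M) :
    UpperFrom k (matDer n D M) := fun i j h => by
  rw [matDer_apply, hM i j h, map_zero]

theorem upperFrom_adj {k : ℕ} {M : MatOver n A} (hM : UpperFrom k M) : UpperFrom k (adj n A M) :=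
  fun i j h => by
    have := rev_pos i
    have := rev_pos j
    rw [adj_apply, hM _ _ (by omega), mul_zero]

theorem bMat_mul_apply (M : MatOver n A) (i j : Fin (2 * n + 1)) :
    (baseChange n A (bMat n) * M) i j =
      if h : 1 ≤ (i : ℕ) then M ⟨i - 1, by omega⟩ j else 0 := by
  rw [Matrix.mul_apply]
  split_ifs with h
  · rw [Finset.sum_eq_single ⟨i - 1, by omega⟩]
    · rw [baseChange_apply, bMat_apply, if_pos (by simp only; omega), map_one, one_mul]
    · intro p _ hp
      rw [baseChange_apply, bMat_apply, if_neg, map_zero, zero_mul]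
      intro h'
      exact hp (Fin.ext (by simp only; omega))
    · simp
  · refine Finset.sum_eq_zero fun p _ => ?_
    rw [baseChange_apply, bMat_apply, if_neg (by omega), map_zero, zero_mul]

theorem mul_bMat_apply (M : MatOver n A) (i j : Fin (2 * n + 1)) :
    (M * baseChange n A (bMat n)) i j =
      if h : (j : ℕ) + 1 < 2 * n + 1 then M i ⟨j + 1, h⟩ else 0 := by
  rw [Matrix.mul_apply]
  split_ifs with h
  · rw [Finset.sum_eq_single ⟨j + 1, h⟩]
    · rw [baseChange_apply, bMat_apply, if_pos rfl, map_one, mul_one]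
    · intro p _ hp
      rw [baseChange_apply, bMat_apply, if_neg, map_zero, mul_zero]
      intro h'
      exact hp (Fin.ext h')
    · simp
  · refine Finset.sum_eq_zero fun p _ => ?_
    rw [baseChange_apply, bMat_apply, if_neg (by have := p.isLt; omega), map_zero, mul_zero]

/-- The operator `[∂ + b + u, ·]`. -/
def covDer (D : Derivation ℝ A A) (u : Fin n → A) : MatOver n A →+ MatOver n A where
  toFun M := matDer n D M + (baseChange n A (bMat n) + toVOver u) * M -
    M * (baseChange n A (bMat n) + toVOver u)
  map_zero' := by simp
  map_add' M N := by rw [map_add]; noncomm_ring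

theorem covDer_apply (D : Derivation ℝ A A) (u : Fin n → A) (M : MatOver n A) :
    covDer D u M = matDer n D M + (baseChange n A (bMat n) + toVOver u) * M -
      M * (baseChange n A (bMat n) + toVOver u) := rfl

theorem adj_covDer (D : Derivation ℝ A A) (u : Fin n → A) (M : MatOver n A) :
    adj n A (covDer D u M) = covDer D u (adj n A M) := by
  have hK : adj n A (baseChange n A (bMat n) + toVOver u) =
      -(baseChange n A (bMat n) + toVOver u) := by
    rw [map_add, adj_baseChange, adj_bMat, map_neg (baseChange n A), adj_toVOver, neg_add]
  rw [covDer_apply, covDer_apply, map_sub, map_add, adj_mul, adj_mul, hK, matDer_adj]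
  noncomm_ring

/-- Only `ad b` lowers the superdiagonal; `∂` and `ad u` are corrections that later steps of the
induction absorb. -/
theorem covDer_sub_bracket_upper (D : Derivation ℝ A A) (u : Fin n → A) {k : ℕ} {M : MatOver n A}
    (hM : UpperFrom k M) : UpperFrom k (covDer D u M -
      (baseChange n A (bMat n) * M - M * baseChange n A (bMat n))) := by
  have e : covDer D u M - (baseChange n A (bMat n) * M - M * baseChange n A (bMat n)) =
      matDer n D M + toVOver u * M - M * toVOver u := by
    rw [covDer_apply]
    noncomm_ring
  rw [e]
  exact ((upperFrom_matDer D hM).add (((upperFrom_toVOver u).mul hM).mono (by omega))).sub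
    ((hM.mul (upperFrom_toVOver u)).mono (by omega))

/-- On the `k`-th superdiagonal `[b, M]` has entries `M_{i-1,j} - M_{i,j+1}`, with entries outside
of the matrix read as zero. Minus the partial sums solve this difference equation, and the vanishing
of the total sum is the boundary condition at the end. -/
theorem exists_bracket_of_sum_eq_zero {k : ℕ} (hk : k ≤ 2 * n) {Y : MatOver n A}
    (hY : UpperFrom k Y) (hs : ∑ l ∈ Finset.range (2 * n + 1 - k), diagEntry k Y l = 0) :
    ∃ M : MatOver n A, UpperFrom (k + 1) M ∧ UpperFrom (k + 1) (Y -
      (baseChange n A (bMat n) * M - M * baseChange n A (bMat n))) := by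
  let M : MatOver n A := Matrix.of fun i j =>
    if (j : ℕ) = i + (k + 1) then -∑ l ∈ Finset.range ((i : ℕ) + 1), diagEntry k Y l else 0
  have hM : ∀ i j, M i j = if (j : ℕ) = i + (k + 1) then
    -∑ l ∈ Finset.range ((i : ℕ) + 1), diagEntry k Y l else 0 := fun i j => rfl
  refine ⟨M, fun i j h => by rw [hM, if_neg (by omega)], fun i j h => ?_⟩
  rw [Matrix.sub_apply, Matrix.sub_apply, bMat_mul_apply, mul_bMat_apply]
  have hi := i.isLt
  have hj := j.isLt
  by_cases hij : (j : ℕ) = i + k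
  · have h1 : (if h : 1 ≤ (i : ℕ) then M ⟨i - 1, by omega⟩ j else 0) =
        -∑ l ∈ Finset.range (i : ℕ), diagEntry k Y l := by
      split_ifs with h0
      · rw [hM, if_pos (by simp only; omega)]
        simp only
        rw [Nat.sub_add_cancel h0]
      · rw [show (i : ℕ) = 0 by omega, Finset.sum_range_zero, neg_zero]
    have h2 : (if h : (j : ℕ) + 1 < 2 * n + 1 then M i ⟨j + 1, h⟩ else 0) =
        -∑ l ∈ Finset.range ((i : ℕ) + 1), diagEntry k Y l := by
      split_ifs with h0
      · rw [hM, if_pos (by simp only; omega)]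
      · rw [show (i : ℕ) + 1 = 2 * n + 1 - k by omega, hs, neg_zero]
    rw [h1, h2, Finset.sum_range_succ, diagEntry_eq Y i j hij]
    ring
  · rw [hY i j (by omega)]
    have h1 : (if h : 1 ≤ (i : ℕ) then M ⟨i - 1, by omega⟩ j else 0) = 0 := by
      split_ifs with h0
      · rw [hM, if_neg (by simp only; omega)]
      · rfl
    have h2 : (if h : (j : ℕ) + 1 < 2 * n + 1 then M i ⟨j + 1, h⟩ else 0) = 0 := by
      split_ifs with h0
      · rw [hM, if_neg (by simp only; omega)]
      · rfl
    rw [h1, h2, sub_zero, sub_zero]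

/-- The diagonal sum is the only obstruction to solving with `ad b`. On an odd superdiagonal
`β_{m+1}`, with its two entries `1`, corrects it with factor `s / 2`. On an even one a single entry
at the centre does; that matrix is self-adjoint and disappears when `exists_gauge` takes skew parts.
-/
theorem exists_normal_form_of_sum {k : ℕ} (hk : k ≤ 2 * n) (s : A) :
    ∃ (v : Fin n → A) (W : MatOver n A), adj n A W = W ∧ UpperFrom k (toVOver v + W) ∧
      ∑ l ∈ Finset.range (2 * n + 1 - k), diagEntry k (toVOver v + W) l = s := by
  rcases Nat.even_or_odd' k with ⟨m, rfl | rfl⟩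
  · let W : MatOver n A := Matrix.of fun i j =>
      if (i : ℕ) + m = n ∧ (j : ℕ) = n + m then s else 0
    have hW : ∀ i j, W i j = if (i : ℕ) + m = n ∧ (j : ℕ) = n + m then s else 0 := fun _ _ => rfl
    have h0 : toVOver (fun _ : Fin n => (0 : A)) = 0 :=
      Finset.sum_eq_zero fun _ _ => zero_smul _ _
    refine ⟨fun _ => 0, W, ?_, fun i j h => ?_, ?_⟩
    · ext i j
      have hi := rev_pos i
      have hj := rev_pos j
      rw [adj_apply, hW, hW]
      by_cases h : (i : ℕ) + m = n ∧ (j : ℕ) = n + m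
      · rw [if_pos h, if_pos (by omega), Even.neg_one_pow ⟨n, by omega⟩, one_mul]
      · rw [if_neg h, if_neg (by omega), mul_zero]
    · rw [h0, zero_add, hW, if_neg (by omega)]
    · rw [h0, zero_add, Finset.sum_eq_single (n - m)]
      · rw [diagEntry, dif_pos (by omega), hW, if_pos (by simp only; omega)]
      · intro l _ hl
        rw [diagEntry]
        split_ifs with h
        · rw [hW, if_neg (by simp only; omega)]
        · rfl
      · intro h
        exact absurd (Finset.mem_range.mpr (by omega)) h
  · have hm : m < n := by omega
    have hv : toVOver (Pi.single (⟨m, hm⟩ : Fin n) ((1 / 2 : ℝ) • s)) =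
        ((1 / 2 : ℝ) • s) • baseChange n A (betaMat n (m + 1)) := by
      rw [toVOver, Finset.sum_eq_single ⟨m, hm⟩]
      · rw [Pi.single_eq_same]
      · intro p _ hp
        rw [Pi.single_eq_of_ne hp, zero_smul]
      · simp
    have hV : ∀ i j : Fin (2 * n + 1),
        (((1 / 2 : ℝ) • s) • baseChange n A (betaMat n (m + 1))) i j =
          if (j : ℕ) = i + (2 * m + 1) ∧ ((i : ℕ) + (m + 1) = n ∨ (i : ℕ) + (m + 1) = n + 1) then
            (1 / 2 : ℝ) • s else 0 := fun i j => by
      rw [Matrix.smul_apply, baseChange_apply, betaMat_apply _ (by omega) hm]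
      rw [show 2 * (m + 1) - 1 = 2 * m + 1 by omega]
      split_ifs
      · rw [map_one, smul_eq_mul, mul_one]
      · rw [map_zero, smul_zero]
    refine ⟨Pi.single ⟨m, hm⟩ ((1 / 2 : ℝ) • s), 0, map_zero _, fun i j h => ?_, ?_⟩
    · rw [add_zero, hv, hV, if_neg (by omega)]
    · rw [add_zero, hv, ← Finset.sum_subset (s₁ := {n - (m + 1), n - m})]
      · rw [Finset.sum_pair (by omega), diagEntry, dif_pos (by omega), diagEntry,
          dif_pos (by omega), hV, hV, if_pos ⟨rfl, Or.inl (by simp only; omega)⟩,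
          if_pos ⟨rfl, Or.inr (by simp only; omega)⟩, ← add_smul]
        norm_num
      · intro l hl
        rw [Finset.mem_insert, Finset.mem_singleton] at hl
        rw [Finset.mem_range]
        omega
      · intro l _ hl
        rw [Finset.mem_insert, Finset.mem_singleton] at hl
        rw [diagEntry]
        split_ifs with h
        · rw [hV, if_neg (by simp only; omega)]
        · rfl

theorem toVOver_add (v w : Fin n → A) : toVOver (v + w) = toVOver v + toVOver w := by
  rw [toVOver, toVOver, toVOver, ← Finset.sum_add_distrib]
  exact Finset.sum_congr rfl fun _ _ => add_smul _ _ _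

/-- Each step clears one superdiagonal, where `m` counts those that remain. Skewness of `Y` is not
used here, at the price of the self-adjoint remainder `W`. -/
theorem exists_gauge_aux (D : Derivation ℝ A A) (u : Fin n → A) (m : ℕ) :
    ∀ k, k + m = 2 * n + 1 → ∀ Y : MatOver n A, UpperFrom k Y →
      ∃ (M : MatOver n A) (v : Fin n → A) (W : MatOver n A), UpperFrom 1 M ∧ adj n A W = W ∧
        Y = covDer D u M + toVOver v + W := by
  induction m with
  | zero =>
    intro k hk Y hY
    have h0 : toVOver (fun _ : Fin n => (0 : A)) = 0 :=
      Finset.sum_eq_zero fun _ _ => zero_smul _ _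
    refine ⟨0, fun _ => 0, 0, fun _ _ _ => rfl, map_zero _, ?_⟩
    rw [map_zero, h0, add_zero, add_zero]
    ext i j
    exact hY i j (by have := j.isLt; omega)
  | succ m ih =>
    intro k hk Y hY
    obtain ⟨v, W, hW, hvW, hs⟩ := exists_normal_form_of_sum (n := n) (k := k) (by omega)
      (∑ l ∈ Finset.range (2 * n + 1 - k), diagEntry k Y l)
    obtain ⟨M, hM, hYM⟩ := exists_bracket_of_sum_eq_zero (by omega) (hY.sub hvW) (by
      simp only [diagEntry_sub]
      rw [Finset.sum_sub_distrib, hs, sub_self])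
    obtain ⟨M', v', W', hM', hW', e⟩ := ih (k + 1) (by omega) _
      (hYM.sub (covDer_sub_bracket_upper D u hM))
    refine ⟨M + M', v + v', W + W', (hM.mono (by omega)).add hM', by rw [map_add, hW, hW'], ?_⟩
    rw [map_add, toVOver_add]
    have e' : Y = (covDer D u M' + toVOver v' + W') + covDer D u M + (toVOver v + W) := by
      rw [← e]
      abel
    rw [e']
    abel

/-- Every upper triangular element of the orthogonal Lie algebra can be brought to a multiple of
the normal forms `β_i` by subtracting an element `[∂ + b + u, M]` with `M` strictly upper
triangular. -/
theorem exists_gauge (D : Derivation ℝ A A) (u : Fin n → A) {Y : MatOver n A}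
    (hY : UpperFrom 0 Y) (hadj : adj n A Y = -Y) :
    ∃ (M : MatOver n A) (v : Fin n → A), UpperFrom 1 M ∧ adj n A M = -M ∧
      Y = covDer D u M + toVOver v := by
  obtain ⟨M, v, W, hM, hW, e⟩ := exists_gauge_aux D u (2 * n + 1) 0 (by omega) Y hY
  have e2 : Y = -covDer D u (adj n A M) + toVOver v - W := by
    have h := congrArg (adj n A) e
    rw [hadj, map_add, map_add, hW, adj_toVOver, adj_covDer] at h
    rw [← neg_neg Y, h]
    abel
  have hc : ∀ N : MatOver n A, covDer D u ((algebraMap ℝ A (1 / 2)) • N) =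
      algebraMap ℝ A (1 / 2) • covDer D u N := fun N => by
    have hd : matDer n D (algebraMap ℝ A (1 / 2) • N) = algebraMap ℝ A (1 / 2) • matDer n D N := by
      ext i j
      rw [matDer_apply, Matrix.smul_apply, Matrix.smul_apply, matDer_apply, smul_eq_mul,
        Derivation.leibniz, Derivation.map_algebraMap, smul_zero, add_zero]
    rw [covDer_apply, covDer_apply, hd, Matrix.mul_smul, Matrix.smul_mul, smul_sub, smul_add]
  -- `covDer` commutes with the adjoint, so averaging the decomposition with minus its adjoint
  -- cancels `W` and keeps `v`.
  refine ⟨algebraMap ℝ A (1 / 2) • (M - adj n A M), v, (hM.sub (upperFrom_adj hM)).smul _, ?_, ?_⟩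
  · rw [adj_smul, map_sub, adj_adj, ← smul_neg, neg_sub]
  · rw [hc, map_sub]
    have h2 : Y + Y = (covDer D u M - covDer D u (adj n A M)) + (toVOver v + toVOver v) := by
      nth_rewrite 1 [e]
      rw [e2]
      abel
    have hone : algebraMap ℝ A (1 / 2) + algebraMap ℝ A (1 / 2) = 1 := by
      rw [← map_add]
      norm_num
    have hhalf : ∀ N : MatOver n A, algebraMap ℝ A (1 / 2) • (N + N) = N := fun N => by
      rw [smul_add, ← add_smul, hone, one_smul]
    rw [← hhalf Y, h2, smul_add, hhalf]

end Gauge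

/-! ### Joint smoothness of series `∑ t^j f_j(x)` with factorial bounds. -/

section EntireSeries

open scoped Nat

/-- The functions `f_j` are of the order of `C ^ j / j!`, uniformly on bounded sets. -/
def FactorialBound (f : ℕ → ℝ → ℝ) : Prop :=
  ∀ R : ℝ, ∃ C : ℝ, 1 ≤ C ∧ ∀ j x, |x| ≤ R → |f j x| * j ! ≤ C ^ (j + 1)

/-- The sequence `f_j` satisfies factorial bounds together with its derivatives up to order `m`. -/
def FactorialClass : ℕ → (ℕ → ℝ → ℝ) → Prop
  | 0, f => FactorialBound f
  | m + 1, f => FactorialBound f ∧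
      ∃ f' : ℕ → ℝ → ℝ, (∀ j x, HasDerivAt (f j) (f' j x) x) ∧ FactorialClass m f'

theorem FactorialClass.bound {m : ℕ} {f : ℕ → ℝ → ℝ} (h : FactorialClass m f) :
    FactorialBound f := by
  cases m with
  | zero => exact h
  | succ m => exact h.1

theorem FactorialClass.of_succ {m : ℕ} {f : ℕ → ℝ → ℝ} (h : FactorialClass (m + 1) f) :
    FactorialClass m f := by
  induction m generalizing f with
  | zero => exact h.1
  | succ m ih =>
    obtain ⟨h1, f', h2, h3⟩ := h
    exact ⟨h1, f', h2, ih h3⟩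

theorem FactorialBound.add {f g : ℕ → ℝ → ℝ} (hf : FactorialBound f) (hg : FactorialBound g) :
    FactorialBound fun j x => f j x + g j x := fun R => by
  obtain ⟨C, hC, h1⟩ := hf R
  obtain ⟨C', hC', h2⟩ := hg R
  refine ⟨C + C', by linarith, fun j x hx => ?_⟩
  calc |f j x + g j x| * j ! ≤ (|f j x| + |g j x|) * j ! :=
        mul_le_mul_of_nonneg_right (abs_add_le _ _) (by positivity)
    _ = |f j x| * j ! + |g j x| * j ! := add_mul _ _ _
    _ ≤ C ^ (j + 1) + C' ^ (j + 1) := add_le_add (h1 j x hx) (h2 j x hx)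
    _ ≤ (C + C') ^ (j + 1) := pow_add_pow_le (by linarith) (by linarith) (by omega)

theorem FactorialClass.add {m : ℕ} {f g : ℕ → ℝ → ℝ} (hf : FactorialClass m f)
    (hg : FactorialClass m g) : FactorialClass m fun j x => f j x + g j x := by
  induction m generalizing f g with
  | zero => exact FactorialBound.add hf hg
  | succ m ih =>
    obtain ⟨h1, f', h2, h3⟩ := hf
    obtain ⟨k1, g', k2, k3⟩ := hg
    exact ⟨h1.add k1, _, fun j x => (h2 j x).fun_add (k2 j x), ih h3 k3⟩

theorem factorialClass_zero (m : ℕ) : FactorialClass m fun _ _ => 0 := by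
  have h : FactorialBound fun _ _ => 0 := fun R => ⟨1, le_rfl, fun j x _ => by simp⟩
  induction m with
  | zero => exact h
  | succ m ih => exact ⟨h, _, fun j x => hasDerivAt_const x 0, ih⟩

theorem FactorialClass.sum {m : ℕ} {ι : Type*} (s : Finset ι) {f : ι → ℕ → ℝ → ℝ}
    (hf : ∀ i, FactorialClass m (f i)) : FactorialClass m fun j x => ∑ i ∈ s, f i j x := by
  classical
  induction s using Finset.induction_on with
  | empty => simpa using factorialClass_zero m
  | insert i s hi ih =>
    simp only [Finset.sum_insert hi]
    exact (hf i).add ih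

theorem FactorialBound.mul_continuous {f : ℕ → ℝ → ℝ} (hf : FactorialBound f) {g : ℝ → ℝ}
    (hg : Continuous g) : FactorialBound fun j x => f j x * g x := fun R => by
  obtain ⟨C, hC, h1⟩ := hf R
  obtain ⟨B, hB⟩ := (isCompact_Icc (a := -R) (b := R)).exists_bound_of_continuousOn hg.continuousOn
  refine ⟨C * max B 1, one_le_mul_of_one_le_of_one_le hC (le_max_right _ _), fun j x hx => ?_⟩
  have hb : |g x| ≤ max B 1 := (hB x (abs_le.mp hx)).trans (le_max_left _ _)
  calc |f j x * g x| * j ! = |f j x| * j ! * |g x| := by rw [abs_mul]; ring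
    _ ≤ C ^ (j + 1) * max B 1 := mul_le_mul (h1 j x hx) hb (abs_nonneg _) (by positivity)
    _ ≤ C ^ (j + 1) * max B 1 ^ (j + 1) := mul_le_mul_of_nonneg_left
        (le_self_pow₀ (le_max_right _ _) (by omega)) (by positivity)
    _ = (C * max B 1) ^ (j + 1) := (mul_pow _ _ _).symm

theorem FactorialClass.mul_smooth {m : ℕ} {f : ℕ → ℝ → ℝ} (hf : FactorialClass m f) {g : ℝ → ℝ}
    (hg : ContDiff ℝ ∞ g) : FactorialClass m fun j x => f j x * g x := by
  induction m generalizing f g with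
  | zero => exact FactorialBound.mul_continuous hf hg.continuous
  | succ m ih =>
    have hf0 := hf.of_succ
    obtain ⟨h1, f', h2, h3⟩ := hf
    exact ⟨h1.mul_continuous hg.continuous, _,
      fun j x => (h2 j x).fun_mul (hg.differentiable (by simp) x).hasDerivAt,
      (ih h3 hg).add (ih hf0 (contDiff_deriv hg))⟩

/-- The sequence of the coefficients of the derivative of a power series. -/
def coeffDeriv (f : ℕ → ℝ → ℝ) (j : ℕ) (x : ℝ) : ℝ := (j + 1) * f (j + 1) x

/-- The sequence of the coefficients of the product of the variable and a power series. -/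
def coeffShift (f : ℕ → ℝ → ℝ) : ℕ → ℝ → ℝ
  | 0, _ => 0
  | j + 1, x => f j x

/-- The factor `j + 1` is absorbed by the next factorial, so the class is stable under `∂_t`; this
drives the induction on the order of smoothness. -/
theorem FactorialBound.coeffDeriv {f : ℕ → ℝ → ℝ} (hf : FactorialBound f) :
    FactorialBound (coeffDeriv f) := fun R => by
  obtain ⟨C, hC, h1⟩ := hf R
  refine ⟨C ^ 2, one_le_pow₀ hC, fun j x hx => ?_⟩
  calc |IsotropicFlow.coeffDeriv f j x| * j ! = |f (j + 1) x| * (j + 1)! := by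
        rw [IsotropicFlow.coeffDeriv, abs_mul, abs_of_nonneg (by positivity), Nat.factorial_succ]
        push_cast
        ring
    _ ≤ C ^ (j + 1 + 1) := h1 _ x hx
    _ ≤ C ^ (2 * (j + 1)) := pow_le_pow_right₀ hC (by omega)
    _ = (C ^ 2) ^ (j + 1) := pow_mul _ _ _

theorem FactorialClass.coeffDeriv {m : ℕ} {f : ℕ → ℝ → ℝ} (hf : FactorialClass m f) :
    FactorialClass m (coeffDeriv f) := by
  induction m generalizing f with
  | zero => exact FactorialBound.coeffDeriv hf
  | succ m ih =>
    obtain ⟨h1, f', h2, h3⟩ := hf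
    exact ⟨h1.coeffDeriv, _, fun j x => (h2 (j + 1) x).const_mul _, ih h3⟩

theorem FactorialBound.coeffShift {f : ℕ → ℝ → ℝ} (hf : FactorialBound f) :
    FactorialBound (coeffShift f) := fun R => by
  obtain ⟨C, hC, h1⟩ := hf R
  refine ⟨2 * C, by linarith, fun j x hx => ?_⟩
  cases j with
  | zero =>
    rw [IsotropicFlow.coeffShift, abs_zero, zero_mul]
    positivity
  | succ j =>
    have hj : ((j + 1 : ℕ) : ℝ) ≤ 2 ^ (j + 1) := by exact_mod_cast Nat.lt_two_pow_self.le
    calc |f j x| * (j + 1)! = |f j x| * j ! * ((j + 1 : ℕ) : ℝ) := by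
          rw [Nat.factorial_succ]
          push_cast
          ring
      _ ≤ C ^ (j + 1) * 2 ^ (j + 1) :=
          mul_le_mul (h1 j x hx) hj (by positivity) (by positivity)
      _ = (2 * C) ^ (j + 1) := by rw [mul_pow, mul_comm]
      _ ≤ (2 * C) ^ (j + 1 + 1) := pow_le_pow_right₀ (by linarith) (by omega)

theorem FactorialClass.coeffShift {m : ℕ} {f : ℕ → ℝ → ℝ} (hf : FactorialClass m f) :
    FactorialClass m (coeffShift f) := by
  induction m generalizing f with
  | zero => exact FactorialBound.coeffShift hf
  | succ m ih =>
    obtain ⟨h1, f', h2, h3⟩ := hf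
    refine ⟨h1.coeffShift, _, fun j x => ?_, ih h3⟩
    cases j with
    | zero => exact hasDerivAt_const x 0
    | succ j => exact h2 j x

/-- The sum `∑ t ^ j f_j(x)`. -/
def seriesFn (f : ℕ → ℝ → ℝ) (p : ℝ × ℝ) : ℝ := ∑' j, p.1 ^ j * f j p.2

theorem FactorialBound.abs_term_le {C t y : ℝ} {j : ℕ} (h : |y| * j ! ≤ C ^ (j + 1)) :
    |t ^ j * y| ≤ C * ((|t| * C) ^ j / j !) := by
  have hj : (0 : ℝ) < j ! := by positivity
  rw [abs_mul, abs_pow, mul_div_assoc', le_div_iff₀ hj]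
  calc |t| ^ j * |y| * j ! = |t| ^ j * (|y| * j !) := by ring
    _ ≤ |t| ^ j * C ^ (j + 1) := mul_le_mul_of_nonneg_left h (by positivity)
    _ = C * (|t| * C) ^ j := by ring

theorem FactorialBound.summable {f : ℕ → ℝ → ℝ} (hf : FactorialBound f) (t x : ℝ) :
    Summable fun j => t ^ j * f j x := by
  obtain ⟨C, _, h1⟩ := hf |x|
  exact Summable.of_norm_bounded ((Real.summable_pow_div_factorial (|t| * C)).mul_left C)
    fun j => FactorialBound.abs_term_le (h1 j x le_rfl)

theorem seriesFn_coeffDeriv {f : ℕ → ℝ → ℝ} (hf : FactorialBound f) (t x : ℝ) :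
    HasSum (fun j : ℕ => j * t ^ (j - 1) * f j x) (seriesFn (coeffDeriv f) (t, x)) := by
  rw [← hasSum_nat_add_iff' 1]
  have h := (hf.coeffDeriv.summable t x).hasSum
  simp only [Finset.range_one, Finset.sum_singleton, Nat.cast_zero, zero_mul, sub_zero]
  refine (congrArg (fun F => HasSum F _) (funext fun j => ?_)).mpr h
  rw [coeffDeriv, Nat.add_sub_cancel]
  push_cast
  ring

/-- On a ball around the origin that contains `p`, the differentials of the terms are dominated by
two exponential series, so the sum can be differentiated termwise in both variables. -/
theorem hasFDerivAt_seriesFn {f f' : ℕ → ℝ → ℝ} (hf : FactorialBound f) (hf' : FactorialBound f')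
    (hd : ∀ j x, HasDerivAt (f j) (f' j x) x) (p : ℝ × ℝ) :
    HasFDerivAt (seriesFn f) (seriesFn (coeffDeriv f) p • ContinuousLinearMap.fst ℝ ℝ ℝ +
      seriesFn f' p • ContinuousLinearMap.snd ℝ ℝ ℝ) p := by
  set R : ℝ := ‖p‖ + 1 with hR
  have hR1 : 1 ≤ R := by rw [hR]; linarith [norm_nonneg p]
  obtain ⟨C, hC, h1⟩ := hf R
  obtain ⟨C', hC', h2⟩ := hf' R
  have hterm : ∀ j (q : ℝ × ℝ), HasFDerivAt (fun q : ℝ × ℝ => q.1 ^ j * f j q.2)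
      ((j * q.1 ^ (j - 1) * f j q.2) • ContinuousLinearMap.fst ℝ ℝ ℝ +
        (q.1 ^ j * f' j q.2) • ContinuousLinearMap.snd ℝ ℝ ℝ) q := fun j q => by
    have e1 := (hasDerivAt_pow j q.1).comp_hasFDerivAt q
      (hasFDerivAt_fst (𝕜 := ℝ) (E := ℝ) (F := ℝ) (p := q))
    have e2 := (hd j q.2).comp_hasFDerivAt q
      (hasFDerivAt_snd (𝕜 := ℝ) (E := ℝ) (F := ℝ) (p := q))
    refine (e1.mul e2).congr_fderiv ?_
    ext
    · simpa using mul_comm _ _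
    · simp
  have hsum := hasFDerivAt_tsum_of_isPreconnected
    (u := fun j : ℕ => C * ((2 * R * C) ^ j / j !) + C' * ((R * C') ^ j / j !))
    (((Real.summable_pow_div_factorial _).mul_left C).add
      ((Real.summable_pow_div_factorial _).mul_left C'))
    (Metric.isOpen_ball (x := (0 : ℝ × ℝ)) (ε := R)) (convex_ball _ _).isPreconnected
    (fun j q _ => hterm j q) (fun j q hq => ?_) (x₀ := p) (x := p)
    (by rw [mem_ball_zero_iff, hR]; linarith) (hf.summable p.1 p.2)
    (by rw [mem_ball_zero_iff, hR]; linarith)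
  · refine hsum.congr_fderiv ?_
    exact (((seriesFn_coeffDeriv hf p.1 p.2).smul_const _).add
      ((hf'.summable p.1 p.2).hasSum.smul_const _)).tsum_eq
  · rw [mem_ball_zero_iff] at hq
    have hq1 : |q.1| ≤ R := (norm_fst_le q).trans hq.le
    have hq2 : |q.2| ≤ R := (norm_snd_le q).trans hq.le
    -- The factor `j` is absorbed in `2 ^ j`; for `j = 0` the exponent `j - 1` is truncated,
    -- harmlessly as the factor is zero.
    have hp1 : |(j : ℝ) * q.1 ^ (j - 1)| ≤ (2 * R) ^ j := by
      cases j with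
      | zero => simp
      | succ j =>
        have hj : ((j + 1 : ℕ) : ℝ) ≤ 2 ^ (j + 1) := by exact_mod_cast Nat.lt_two_pow_self.le
        rw [abs_mul, abs_pow, Nat.abs_cast, mul_pow, Nat.add_sub_cancel]
        refine mul_le_mul hj ?_ (by positivity) (by positivity)
        exact (pow_le_pow_left₀ (abs_nonneg _) hq1 j).trans (pow_le_pow_right₀ hR1 (by omega))
    have hj0 : (0 : ℝ) < j ! := by positivity
    refine (norm_add_le _ _).trans (add_le_add ?_ ?_)
    · rw [norm_smul]
      refine (mul_le_of_le_one_right (norm_nonneg _) (ContinuousLinearMap.norm_fst_le _ _ _)).trans ?_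
      rw [Real.norm_eq_abs, abs_mul, mul_div_assoc', le_div_iff₀ hj0, mul_assoc]
      calc |(j : ℝ) * q.1 ^ (j - 1)| * (|f j q.2| * j !) ≤ (2 * R) ^ j * C ^ (j + 1) :=
            mul_le_mul hp1 (h1 j _ hq2) (by positivity) (by positivity)
        _ = C * (2 * R * C) ^ j := by rw [mul_pow (2 * R) C j, pow_succ, ← mul_assoc, mul_comm]
    · rw [norm_smul]
      refine (mul_le_of_le_one_right (norm_nonneg _) (ContinuousLinearMap.norm_snd_le _ _ _)).trans ?_
      refine (FactorialBound.abs_term_le (h2 j _ hq2)).trans ?_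
      refine mul_le_mul_of_nonneg_left (div_le_div_of_nonneg_right (pow_le_pow_left₀ (by positivity)
        (mul_le_mul_of_nonneg_right hq1 (by linarith)) j) hj0.le) (by linarith)

theorem FactorialClass.contDiff_seriesFn {m : ℕ} {f : ℕ → ℝ → ℝ} (hf : FactorialClass (m + 1) f) :
    ContDiff ℝ m (seriesFn f) := by
  induction m generalizing f with
  | zero =>
    obtain ⟨h1, f', h2, h3⟩ := hf
    rw [Nat.cast_zero, contDiff_zero, continuous_iff_continuousAt]
    exact fun p => (hasFDerivAt_seriesFn h1 h3.bound h2 p).continuousAt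
  | succ m ih =>
    have hf0 := hf.of_succ.coeffDeriv
    obtain ⟨h1, f', h2, h3⟩ := hf
    rw [Nat.cast_add, Nat.cast_one, contDiff_succ_iff_hasFDerivAt]
    exact ⟨_, ((ih hf0).smul contDiff_const).add ((ih h3).smul contDiff_const),
      hasFDerivAt_seriesFn h1 h3.bound h2⟩

theorem contDiff_seriesFn {f : ℕ → ℝ → ℝ} (hf : ∀ m, FactorialClass m f) :
    ContDiff ℝ ∞ (seriesFn f) :=
  contDiff_infty.mpr fun m => (hf (m + 1)).contDiff_seriesFn

theorem hasDerivAt_seriesFn_right {f f' : ℕ → ℝ → ℝ} (hf : FactorialBound f)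
    (hf' : FactorialBound f') (hd : ∀ j x, HasDerivAt (f j) (f' j x) x) (t x : ℝ) :
    HasDerivAt (fun y => seriesFn f (t, y)) (seriesFn f' (t, x)) x := by
  have h := (hasFDerivAt_seriesFn hf hf' hd (t, x)).comp_hasDerivAt x
    ((hasDerivAt_const x t).prodMk (hasDerivAt_id x))
  exact h.congr_deriv (by simp)

theorem hasDerivAt_seriesFn_left {f f' : ℕ → ℝ → ℝ} (hf : FactorialBound f)
    (hf' : FactorialBound f') (hd : ∀ j x, HasDerivAt (f j) (f' j x) x) (t x : ℝ) :
    HasDerivAt (fun s => seriesFn f (s, x)) (seriesFn (coeffDeriv f) (t, x)) t := by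
  have h := (hasFDerivAt_seriesFn hf hf' hd (t, x)).comp_hasDerivAt t
    ((hasDerivAt_id t).prodMk (hasDerivAt_const t x))
  exact h.congr_deriv (by simp)

theorem seriesFn_zero (f : ℕ → ℝ → ℝ) (x : ℝ) : seriesFn f (0, x) = f 0 x := by
  rw [seriesFn, tsum_eq_single 0]
  · rw [pow_zero, one_mul]
  · intro j hj
    rw [zero_pow hj, zero_mul]

theorem seriesFn_coeffShift {f : ℕ → ℝ → ℝ} (hf : FactorialBound f) (t x : ℝ) :
    seriesFn (coeffShift f) (t, x) = t * seriesFn f (t, x) := by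
  rw [seriesFn, (hf.coeffShift.summable t x).tsum_eq_zero_add, seriesFn, ← tsum_mul_left]
  simp only [coeffShift, mul_zero, zero_add, pow_succ']
  exact tsum_congr fun j => mul_assoc _ _ _

theorem seriesFn_sum_mul {ι : Type*} [Fintype ι] {f : ι → ℕ → ℝ → ℝ}
    (hf : ∀ i, FactorialBound (f i)) (g : ι → ℝ → ℝ) (t x : ℝ) :
    seriesFn (fun j y => ∑ i, f i j y * g i y) (t, x) = ∑ i, seriesFn (f i) (t, x) * g i x := by
  simp only [seriesFn, ← tsum_mul_right]
  rw [← Summable.tsum_finsetSum fun i _ => ((hf i).summable t x).mul_right (g i x)]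
  refine tsum_congr fun j => ?_
  rw [Finset.mul_sum]
  exact Finset.sum_congr rfl fun i _ => (mul_assoc _ _ _).symm

end EntireSeries

/-! ### Linear equations `K_x = t K M` by iterated integrals. -/

section IteratedIntegrals

open scoped Nat

open MeasureTheory

variable {n : ℕ}

/-- The iterated integrals `m_0 = 1`, `m_{j+1}(x) = ∫_0^x m_j M`. -/
def iteratedIntegral (M : ℝ → Mat n) : ℕ → ℝ → Mat n
  | 0, _ => 1
  | j + 1, x => Matrix.of fun a b => ∫ s in (0 : ℝ)..x, (iteratedIntegral M j s * M s) a b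

theorem continuous_mul_apply {X Y : ℝ → Mat n} (hX : ∀ a b, Continuous fun x => X x a b)
    (hY : ∀ a b, Continuous fun x => Y x a b) (a b : Fin (2 * n + 1)) :
    Continuous fun x => (X x * Y x) a b := by
  simp only [Matrix.mul_apply]
  exact continuous_finsetSum _ fun c _ => (hX a c).mul (hY c b)

theorem continuous_iteratedIntegral {M : ℝ → Mat n} (hM : ∀ a b, Continuous fun x => M x a b)
    (j : ℕ) : ∀ a b, Continuous fun x => iteratedIntegral M j x a b := by
  induction j with
  | zero => exact fun a b => continuous_const
  | succ j ih =>
    exact fun a b => intervalIntegral.continuous_primitive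
      (fun _ _ => (continuous_mul_apply ih hM a b).intervalIntegrable _ _) 0

theorem hasDerivAt_iteratedIntegral {M : ℝ → Mat n} (hM : ∀ a b, Continuous fun x => M x a b)
    (j : ℕ) (a b : Fin (2 * n + 1)) (x : ℝ) :
    HasDerivAt (fun y => iteratedIntegral M (j + 1) y a b) ((iteratedIntegral M j x * M x) a b) x := by
  have hc := continuous_mul_apply (continuous_iteratedIntegral hM j) hM a b
  exact intervalIntegral.integral_hasDerivAt_right (hc.intervalIntegrable _ _)
    (hc.stronglyMeasurableAtFilter _ _) hc.continuousAt

/-- The Picard estimate: each integration contributes a factor `B |x| / (j + 1)`. -/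
theorem abs_iteratedIntegral_le {M : ℝ → Mat n} (hM : ∀ a b, Continuous fun x => M x a b)
    {R B : ℝ} (hB0 : 0 ≤ B) (hB : ∀ x, |x| ≤ R → ∀ b, ∑ c, |M x c b| ≤ B) (j : ℕ) :
    ∀ x, |x| ≤ R → ∀ a b, |iteratedIntegral M j x a b| ≤ B ^ j * |x| ^ j / j ! := by
  induction j with
  | zero =>
    intro x _ a b
    change |(1 : Mat n) a b| ≤ _
    rw [Matrix.one_apply]
    split_ifs <;> simp
  | succ j ih =>
    intro x hx a b
    have hc := continuous_mul_apply (continuous_iteratedIntegral hM j) hM a b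
    change |∫ s in (0 : ℝ)..x, (iteratedIntegral M j s * M s) a b| ≤ _
    have hle : ∀ s ∈ Set.uIoc 0 x,
        ‖(iteratedIntegral M j s * M s) a b‖ ≤ B ^ (j + 1) / j ! * |s - 0| ^ j := fun s hs => by
      have hsx : |s| ≤ R := by
        refine le_trans ?_ hx
        rcases Set.mem_uIoc.mp hs with h | h
        · rw [abs_of_pos h.1, abs_of_nonneg (h.1.le.trans h.2)]
          exact h.2
        · rw [abs_of_nonpos h.2, abs_of_neg (h.1.trans_le h.2)]
          linarith [h.1]
      rw [Matrix.mul_apply, sub_zero, Real.norm_eq_abs]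
      calc |∑ c, iteratedIntegral M j s a c * M s c b|
          ≤ ∑ c, |iteratedIntegral M j s a c * M s c b| := Finset.abs_sum_le_sum_abs _ _
        _ ≤ ∑ c, B ^ j * |s| ^ j / j ! * |M s c b| := Finset.sum_le_sum fun c _ => by
            rw [abs_mul]
            exact mul_le_mul_of_nonneg_right (ih s hsx a c) (abs_nonneg _)
        _ = B ^ j * |s| ^ j / j ! * ∑ c, |M s c b| := (Finset.mul_sum _ _ _).symm
        _ ≤ B ^ j * |s| ^ j / j ! * B :=
            mul_le_mul_of_nonneg_left (hB s hsx b) (by positivity)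
        _ = B ^ (j + 1) / j ! * |s| ^ j := by ring
    calc |∫ s in (0 : ℝ)..x, (iteratedIntegral M j s * M s) a b|
        = ‖∫ s in Set.uIoc 0 x, (iteratedIntegral M j s * M s) a b‖ :=
          intervalIntegral.norm_integral_eq_norm_integral_uIoc
            fun s => (iteratedIntegral M j s * M s) a b
      _ ≤ ∫ s in Set.uIoc 0 x, B ^ (j + 1) / j ! * |s - 0| ^ j := by
          refine norm_integral_le_of_norm_le ?_ ?_
          · have hcc : Continuous fun s : ℝ => B ^ (j + 1) / (j ! : ℝ) * |s - 0| ^ j := by fun_prop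
            exact (hcc.intervalIntegrable 0 x).def'
          · exact (ae_restrict_iff' measurableSet_uIoc).mpr (Filter.Eventually.of_forall hle)
      _ = B ^ (j + 1) / j ! * (|x| ^ (j + 1) / (j + 1)) := by
          rw [integral_const_mul, integral_pow_abs_sub_uIoc, sub_zero]
      _ = B ^ (j + 1) * |x| ^ (j + 1) / (j + 1)! := by
          rw [Nat.factorial_succ]
          push_cast
          field_simp

theorem factorialBound_iteratedIntegral {M : ℝ → Mat n} (hM : ∀ a b, Continuous fun x => M x a b)
    (a b : Fin (2 * n + 1)) : FactorialBound fun j x => iteratedIntegral M j x a b := fun R => by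
  have hc : Continuous fun x => ∑ b, ∑ c, |M x c b| :=
    continuous_finsetSum _ fun b _ => continuous_finsetSum _ fun c _ => (hM c b).abs
  obtain ⟨B, hB⟩ := (isCompact_Icc (a := -R) (b := R)).exists_bound_of_continuousOn hc.continuousOn
  have hB' : ∀ x, |x| ≤ R → ∀ b, ∑ c, |M x c b| ≤ |B| := fun x hx b =>
    (Finset.single_le_sum (f := fun b => ∑ c, |M x c b|)
      (fun b _ => Finset.sum_nonneg fun c _ => abs_nonneg _) (Finset.mem_univ b)).trans
      ((le_abs_self _).trans ((hB x (abs_le.mp hx)).trans (le_abs_self _)))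
  refine ⟨max 1 (|B| * |R|), le_max_left _ _, fun j x hx => ?_⟩
  have h := abs_iteratedIntegral_le hM (abs_nonneg B) hB' j x hx a b
  rw [le_div_iff₀ (by positivity), ← mul_pow] at h
  refine h.trans ?_
  calc (|B| * |x|) ^ j ≤ max 1 (|B| * |R|) ^ j := by
        refine pow_le_pow_left₀ (by positivity) (le_max_of_le_right ?_) j
        exact mul_le_mul_of_nonneg_left (hx.trans (le_abs_self R)) (abs_nonneg _)
    _ ≤ max 1 (|B| * |R|) ^ (j + 1) := pow_le_pow_right₀ (le_max_left _ _) (by omega)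

theorem hasDerivAt_iteratedIntegral_coeffShift {M : ℝ → Mat n}
    (hM : ∀ a b, Continuous fun x => M x a b) (a b : Fin (2 * n + 1)) (j : ℕ) (x : ℝ) :
    HasDerivAt (fun y => iteratedIntegral M j y a b)
      (coeffShift (fun i y => ∑ c, iteratedIntegral M i y a c * M y c b) j x) x := by
  cases j with
  | zero => exact hasDerivAt_const x _
  | succ j =>
    have h := hasDerivAt_iteratedIntegral hM j a b x
    rwa [Matrix.mul_apply] at h

/-- The `x`-derivative of the sequence is its shift multiplied by the smooth matrix `M`, so bounds
for all derivatives follow from those for the sequence itself. -/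
theorem factorialClass_iteratedIntegral {M : ℝ → Mat n}
    (hM : ∀ a b, ContDiff ℝ ∞ fun x => M x a b) (m : ℕ) (a b : Fin (2 * n + 1)) :
    FactorialClass m fun j x => iteratedIntegral M j x a b := by
  have hb := factorialBound_iteratedIntegral (fun a b => (hM a b).continuous)
  induction m generalizing a b with
  | zero => exact hb a b
  | succ m ih =>
    exact ⟨hb a b, _, hasDerivAt_iteratedIntegral_coeffShift (fun a b => (hM a b).continuous) a b,
      (FactorialClass.sum _ fun c => (ih a c).mul_smooth (hM c b)).coeffShift⟩

/-- The solution of `K_x = t K M`, `K(t, 0) = 1`. -/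
def pathExp (M : ℝ → Mat n) (t x : ℝ) : Mat n :=
  Matrix.of fun a b => seriesFn (fun j y => iteratedIntegral M j y a b) (t, x)

theorem contDiff_pathExp {M : ℝ → Mat n} (hM : ∀ a b, ContDiff ℝ ∞ fun x => M x a b)
    (a b : Fin (2 * n + 1)) :
    ContDiff ℝ ∞ fun p : ℝ × ℝ => pathExp M p.1 p.2 a b :=
  contDiff_seriesFn fun m => factorialClass_iteratedIntegral hM m a b

theorem hasDerivAt_pathExp {M : ℝ → Mat n} (hM : ∀ a b, ContDiff ℝ ∞ fun x => M x a b)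
    (t x : ℝ) (a b : Fin (2 * n + 1)) :
    HasDerivAt (fun y => pathExp M t y a b) ((t • (pathExp M t x * M x)) a b) x := by
  have hM' : ∀ a b, Continuous fun x => M x a b := fun a b => (hM a b).continuous
  have hs := FactorialClass.sum Finset.univ fun c =>
    (factorialClass_iteratedIntegral hM 0 a c).mul_smooth (hM c b)
  refine (hasDerivAt_seriesFn_right (factorialBound_iteratedIntegral hM' a b) hs.bound.coeffShift
    (hasDerivAt_iteratedIntegral_coeffShift hM' a b) t x).congr_deriv ?_
  rw [seriesFn_coeffShift hs.bound, Matrix.smul_apply, Matrix.mul_apply, smul_eq_mul]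
  congr 1
  exact seriesFn_sum_mul (f := fun c j y => iteratedIntegral M j y a c)
    (fun c => factorialBound_iteratedIntegral hM' a c) (fun c y => M y c b) t x

theorem hasDerivAt_pathExp_zero {M : ℝ → Mat n} (hM : ∀ a b, ContDiff ℝ ∞ fun x => M x a b)
    (x : ℝ) (a b : Fin (2 * n + 1)) :
    HasDerivAt (fun t => pathExp M t x a b) (iteratedIntegral M 1 x a b) 0 := by
  have hM' : ∀ a b, Continuous fun x => M x a b := fun a b => (hM a b).continuous
  have hs := FactorialClass.sum Finset.univ fun c =>
    (factorialClass_iteratedIntegral hM 0 a c).mul_smooth (hM c b)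
  refine (hasDerivAt_seriesFn_left (factorialBound_iteratedIntegral hM' a b) hs.bound.coeffShift
    (hasDerivAt_iteratedIntegral_coeffShift hM' a b) 0 x).congr_deriv ?_
  rw [seriesFn_zero, coeffDeriv]
  simp

theorem pathExp_zero_left (M : ℝ → Mat n) (x : ℝ) : pathExp M 0 x = 1 := by
  ext a b
  exact seriesFn_zero (fun j y => iteratedIntegral M j y a b) x

theorem pathExp_zero_right (M : ℝ → Mat n) (t : ℝ) : pathExp M t 0 = 1 := by
  ext a b
  change ∑' j : ℕ, t ^ j * iteratedIntegral M j 0 a b = _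
  rw [tsum_eq_single 0]
  · rw [pow_zero, one_mul]
    rfl
  · intro j hj
    obtain ⟨i, rfl⟩ := Nat.exists_eq_succ_of_ne_zero hj
    have h : iteratedIntegral M (i + 1) 0 a b = 0 := intervalIntegral.integral_same
    rw [Nat.succ_eq_add_one, h, mul_zero]

end IteratedIntegrals

/-! ### Orthogonal frames and the isotropic curves in their first columns. -/

section Frames

variable {n : ℕ}

section EntrywiseDerivative

/-- `X'` is the entrywise derivative of the matrix-valued function `X` at `x`. -/
def HasMatDerivAt (X : ℝ → Mat n) (X' : Mat n) (x : ℝ) : Prop :=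
  ∀ a b, HasDerivAt (fun y => X y a b) (X' a b) x

theorem HasMatDerivAt.mul {X Y : ℝ → Mat n} {X' Y' : Mat n} {x : ℝ} (hX : HasMatDerivAt X X' x)
    (hY : HasMatDerivAt Y Y' x) :
    HasMatDerivAt (fun y => X y * Y y) (X' * Y x + X x * Y') x := fun a b => by
  simp only [Matrix.mul_apply, Matrix.add_apply, ← Finset.sum_add_distrib]
  exact HasDerivAt.fun_sum fun c _ => (hX a c).fun_mul (hY c b)

theorem hasMatDerivAt_const (C : Mat n) (x : ℝ) : HasMatDerivAt (fun _ => C) 0 x :=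
  fun a b => hasDerivAt_const x (C a b)

theorem HasMatDerivAt.eq_const {X : ℝ → Mat n} (h : ∀ x, HasMatDerivAt X 0 x) (x y : ℝ) :
    X x = X y := by
  ext a b
  exact is_const_of_deriv_eq_zero (fun z => (h z a b).differentiableAt)
    (fun z => (h z a b).deriv) x y

end EntrywiseDerivative

section OrthogonalGroup

theorem mem_orthogonal_iff {g : Mat n} : g ∈ orthogonal n ↔ adj n ℝ g * g = 1 := by
  have e : adj n ℝ g = Cmat n * gᵀ * Cmat n := rfl
  change gᵀ * Cmat n * g = Cmat n ↔ _
  rw [e]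
  constructor
  · intro h
    rw [Matrix.mul_assoc, Matrix.mul_assoc, ← Matrix.mul_assoc gᵀ, h, Cmat_mul_Cmat]
  · intro h
    have h2 := congrArg (fun X => Cmat n * X) h
    simp only [← Matrix.mul_assoc, Cmat_mul_Cmat, Matrix.one_mul, Matrix.mul_one] at h2
    exact h2

theorem mul_adj_of_mem_orthogonal {g : Mat n} (h : g ∈ orthogonal n) : g * adj n ℝ g = 1 :=
  mul_eq_one_comm.mp (mem_orthogonal_iff.mp h)

theorem mem_orthogonal_of_mul_adj {g : Mat n} (h : g * adj n ℝ g = 1) : g ∈ orthogonal n :=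
  mem_orthogonal_iff.mpr (mul_eq_one_comm.mp h)

theorem mul_mem_orthogonal {g k : Mat n} (hg : g ∈ orthogonal n) (hk : k ∈ orthogonal n) :
    g * k ∈ orthogonal n := by
  rw [mem_orthogonal_iff] at hg hk ⊢
  rw [adj_mul, Matrix.mul_assoc, ← Matrix.mul_assoc (adj n ℝ g), hg, Matrix.one_mul, hk]

theorem HasMatDerivAt.adj {X : ℝ → Mat n} {X' : Mat n} {x : ℝ} (hX : HasMatDerivAt X X' x) :
    HasMatDerivAt (fun y => adj n ℝ (X y)) (adj n ℝ X') x := fun a b => by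
  simp only [adj_apply]
  exact (hX _ _).const_mul _

/-- The derivative of `K` times its adjoint is `t K (M - M)` times the adjoint of `K`, by skewness
of `M`. So the product is constant in `x` and equals its value `1` at `x = 0`. -/
theorem pathExp_mem_orthogonal {M : ℝ → Mat n} (hM : ∀ a b, ContDiff ℝ ∞ fun x => M x a b)
    (hadj : ∀ x, adj n ℝ (M x) = -M x) (t x : ℝ) : pathExp M t x ∈ orthogonal n := by
  have hK : ∀ y, HasMatDerivAt (fun z => pathExp M t z) (t • (pathExp M t y * M y)) y :=
    fun y a b => hasDerivAt_pathExp hM t y a b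
  refine mem_orthogonal_of_mul_adj ?_
  rw [HasMatDerivAt.eq_const (X := fun z => pathExp M t z * IsotropicFlow.adj n ℝ (pathExp M t z))
    (fun y => ?_) x 0, pathExp_zero_right, adj_one, Matrix.mul_one]
  have h := (hK y).mul (hK y).adj
  rw [adj_smul, adj_mul, hadj, Matrix.mul_smul, Matrix.smul_mul, ← smul_add, Matrix.neg_mul,
    Matrix.mul_neg, ← Matrix.mul_assoc, add_neg_cancel, smul_zero] at h
  exact h

end OrthogonalGroup

section Curve

theorem toV_apply_of_lt (w : Fin n → ℝ) (i j : Fin (2 * n + 1)) (hj : (j : ℕ) < n) :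
    toV n w i j = 0 := by
  rw [toV, Matrix.sum_apply]
  refine Finset.sum_eq_zero fun k _ => ?_
  rw [Matrix.smul_apply, betaMat_apply _ (by omega) k.isLt, if_neg (by omega), smul_zero]

theorem toV_apply_of_le (w : Fin n → ℝ) (i j : Fin (2 * n + 1)) (hj : (j : ℕ) ≤ i) :
    toV n w i j = 0 := by
  rw [toV, Matrix.sum_apply]
  refine Finset.sum_eq_zero fun k _ => ?_
  rw [Matrix.smul_apply, betaMat_apply _ (by omega) k.isLt, if_neg (by omega), smul_zero]

/-- `h` is a smooth frame in the orthogonal group with `h⁻¹ h_x = b + w`, where `w` is in `V_n`. -/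
structure IsFrame (h : ℝ → Mat n) (w : ℝ → Fin n → ℝ) : Prop where
  smooth : ∀ a b, ContDiff ℝ ∞ fun x => h x a b
  smooth_curvature : ContDiff ℝ ∞ w
  mem_orthogonal : ∀ x, h x ∈ orthogonal n
  hasMatDerivAt : ∀ x, HasMatDerivAt h (h x * (bMat n + toV n (w x))) x

namespace IsFrame

/-- The vectors `c_k` with `γ^{(k)} = h c_k`, where `γ` is the first column of the frame `h`. -/
def coords (w : ℝ → Fin n → ℝ) : ℕ → ℝ → Vec n
  | 0, _ => stdVec n ℝ 0
  | k + 1, x => fun i => deriv (fun y => coords w k y i) x +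
      ((bMat n + toV n (w x)) *ᵥ coords w k x) i

theorem contDiff_toV {w : ℝ → Fin n → ℝ} (hw : ContDiff ℝ ∞ w) (i j : Fin (2 * n + 1)) :
    ContDiff ℝ ∞ fun x => toV n (w x) i j := by
  simp only [toV, Matrix.sum_apply, Matrix.smul_apply, smul_eq_mul]
  exact ContDiff.sum fun k _ => (contDiff_pi.mp hw k).mul contDiff_const

theorem contDiff_coords {w : ℝ → Fin n → ℝ} (hw : ContDiff ℝ ∞ w) (k : ℕ) (i : Fin (2 * n + 1)) :
    ContDiff ℝ ∞ fun x => coords w k x i := by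
  induction k generalizing i with
  | zero => exact contDiff_const
  | succ k ih =>
    refine ContDiff.add (f := deriv fun y => coords w k y i) (contDiff_deriv (ih i)) ?_
    simp only [Matrix.mulVec, dotProduct, Matrix.add_apply]
    exact ContDiff.sum fun j _ => (contDiff_const.add (contDiff_toV hw i j)).mul (ih j)

theorem bMat_add_toV_mulVec (v : Fin n → ℝ) (c : Vec n) (k : ℕ)
    (hc : ∀ i : Fin (2 * n + 1), k < i → c i = 0) (i : Fin (2 * n + 1)) (hi : k ≤ i) :
    ((bMat n + toV n v) *ᵥ c) i = if h : 1 ≤ (i : ℕ) then c ⟨i - 1, by omega⟩ else 0 := by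
  rw [Matrix.add_mulVec, Pi.add_apply]
  have h2 : (toV n v *ᵥ c) i = 0 := by
    rw [Matrix.mulVec, dotProduct]
    refine Finset.sum_eq_zero fun j _ => ?_
    by_cases hj : (j : ℕ) ≤ i
    · rw [toV_apply_of_le v i j hj, zero_mul]
    · rw [hc j (by omega), mul_zero]
  rw [h2, add_zero, Matrix.mulVec, dotProduct]
  split_ifs with h
  · rw [Finset.sum_eq_single ⟨i - 1, by omega⟩]
    · rw [bMat_apply, if_pos (by simp only; omega), one_mul]
    · intro p _ hp
      rw [bMat_apply, if_neg, zero_mul]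
      intro h'
      exact hp (Fin.ext (by simp only; omega))
    · simp
  · refine Finset.sum_eq_zero fun p _ => ?_
    rw [bMat_apply, if_neg (by omega), zero_mul]

theorem coords_succ_apply (w : ℝ → Fin n → ℝ) (k : ℕ) (x : ℝ) (i : Fin (2 * n + 1)) :
    coords w (k + 1) x i = deriv (fun y => coords w k y i) x +
      ((bMat n + toV n (w x)) *ᵥ coords w k x) i := rfl

theorem coords_eq_zero (w : ℝ → Fin n → ℝ) (k : ℕ) (x : ℝ) (i : Fin (2 * n + 1)) (hi : k < i) :
    coords w k x i = 0 := by
  induction k generalizing i x with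
  | zero => exact if_neg (by omega)
  | succ k ih =>
    have h0 : (fun y => coords w k y i) = fun _ => 0 := funext fun y => ih y i (by omega)
    rw [coords_succ_apply, bMat_add_toV_mulVec _ _ k (fun j hj => ih x j hj) i (by omega), h0, deriv_const,
      zero_add, dif_pos (by omega), ih x _ (by simp only; omega)]

theorem coords_self (w : ℝ → Fin n → ℝ) (k : ℕ) (x : ℝ) (hk : k < 2 * n + 1) :
    coords w k x ⟨k, hk⟩ = 1 := by
  induction k with
  | zero =>
    change (if (0 : ℕ) = 0 then (1 : ℝ) else 0) = 1
    rw [if_pos rfl]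
  | succ k ih =>
    have h0 : (fun y => coords w k y ⟨k + 1, hk⟩) = fun _ => 0 :=
      funext fun y => coords_eq_zero w k y _ (Nat.lt_succ_self k)
    rw [coords_succ_apply, bMat_add_toV_mulVec _ _ k (fun j hj => coords_eq_zero w k x j hj) _
      (Nat.le_succ k), h0, deriv_const, zero_add, dif_pos (Nat.le_add_left 1 k)]
    exact ih (by omega)

theorem coords_of_le (w : ℝ → Fin n → ℝ) (k : ℕ) (x : ℝ) (hk : k ≤ n) :
    coords w k x = stdVec n ℝ k := by
  induction k generalizing x with
  | zero => rfl
  | succ k ih =>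
    have h0 : ∀ i, (fun y => coords w k y i) = fun _ => stdVec n ℝ k i := fun i =>
      funext fun y => by rw [ih y (by omega)]
    have h1 : toV n (w x) *ᵥ stdVec n ℝ k = 0 := by
      funext i
      have h := mulVec_stdVec (toV n (w x)) ⟨k, by omega⟩ i
      rw [h, toV_apply_of_lt _ _ _ (by simp only; omega)]
      rfl
    funext i
    rw [coords_succ_apply, h0, deriv_const, zero_add, ih x (by omega), Matrix.add_mulVec, h1, add_zero,
      bMat_mulVec_stdVec k (by omega)]

theorem iteratedDeriv_column {h : ℝ → Mat n} {w : ℝ → Fin n → ℝ} (hh : IsFrame h w) (k : ℕ) :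
    iteratedDeriv k (fun x a => h x a 0) = fun x => h x *ᵥ coords w k x := by
  induction k with
  | zero =>
    rw [iteratedDeriv_zero]
    funext x a
    exact (mulVec_stdVec_zero (h x) a).symm
  | succ k ih =>
    rw [iteratedDeriv_succ, ih]
    funext x
    refine HasDerivAt.deriv (hasDerivAt_pi.mpr fun a => ?_)
    have hc : ∀ j, HasDerivAt (fun y => coords w k y j) (deriv (fun y => coords w k y j) x) x :=
      fun j => ((contDiff_coords hh.smooth_curvature k j).differentiable (by simp) x).hasDerivAt
    have hs := HasDerivAt.fun_sum (u := Finset.univ) fun j _ => (hh.hasMatDerivAt x a j).fun_mul (hc j)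
    refine hs.congr_deriv ?_
    have e : coords w (k + 1) x = (fun i => deriv (fun y => coords w k y i) x) +
        (bMat n + toV n (w x)) *ᵥ coords w k x := rfl
    rw [e, Matrix.mulVec_add, Matrix.mulVec_mulVec, Pi.add_apply, Finset.sum_add_distrib, add_comm]
    rfl

theorem isUnit {h : ℝ → Mat n} {w : ℝ → Fin n → ℝ} (hh : IsFrame h w) (x : ℝ) :
    IsUnit (h x) :=
  IsUnit.of_mul_eq_one _ (mul_adj_of_mem_orthogonal (hh.mem_orthogonal x))

/-- In the frame `h`, the derivatives of the first column form a triangular matrix with ones on the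
diagonal, since each application of `b` moves the last nonzero coordinate down by one. -/
theorem linearIndependent_column {h : ℝ → Mat n} {w : ℝ → Fin n → ℝ} (hh : IsFrame h w) (x : ℝ) :
    LinearIndependent ℝ (fun k : Fin (2 * n + 1) =>
      iteratedDeriv (k : ℕ) (fun y a => h y a 0) x) := by
  let c : Mat n := Matrix.of fun i k => coords w k x i
  have hc : c.det = 1 := by
    rw [Matrix.det_of_isUpperTriangular (M := c) (fun i k hik => coords_eq_zero w k x i hik)]
    exact Finset.prod_eq_one fun i _ => coords_self w i x i.isLt
  have hu : IsUnit (h x * c) := (hh.isUnit x).mul ((Matrix.isUnit_iff_isUnit_det c).mpr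
    (by rw [hc]; exact isUnit_one))
  have e : (fun k : Fin (2 * n + 1) => iteratedDeriv (k : ℕ) (fun y a => h y a 0) x) =
      (h x * c).col := by
    funext k
    rw [hh.iteratedDeriv_column]
    rfl
  rw [e]
  exact Matrix.linearIndependent_cols_of_isUnit hu

theorem form_mulVec {g : Mat n} (hg : g ∈ orthogonal n) (X Y : Vec n) :
    form n (g *ᵥ X) (g *ᵥ Y) = form n X Y := by
  have hg' : gᵀ * Cmat n * g = Cmat n := hg
  rw [form, form, Matrix.mulVec_mulVec, Matrix.dotProduct_mulVec, Matrix.vecMul_mulVec,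
    ← Matrix.dotProduct_mulVec, ← Matrix.mul_assoc, hg']

theorem form_stdVec (k : ℕ) (hk : k ≤ 2 * n) (X : Vec n) :
    form n (stdVec n ℝ k) X = (-1) ^ (n + k) * X ⟨2 * n - k, by omega⟩ := by
  rw [form, dotProduct, Finset.sum_eq_single ⟨k, by omega⟩]
  · rw [stdVec, if_pos rfl, one_mul, Matrix.mulVec, dotProduct,
      Finset.sum_eq_single ⟨2 * n - k, by omega⟩]
    · rw [Cmat_apply, if_pos (Fin.ext (by rw [Fin.val_rev]; simp only; omega))]
    · intro j _ hj
      rw [Cmat_apply, if_neg, zero_mul]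
      intro e
      refine hj (Fin.ext ?_)
      rw [e, Fin.val_rev]
      simp only
      omega
    · simp
  · intro j _ hj
    rw [stdVec, if_neg (fun e => hj (Fin.ext e)), zero_mul]
  · simp

theorem form_add_right (X Y Z : Vec n) : form n X (Y + Z) = form n X Y + form n X Z := by
  rw [form, form, form, Matrix.mulVec_add, dotProduct_add]

theorem form_smul_right (a : ℝ) (X Y : Vec n) : form n X (a • Y) = a * form n X Y := by
  rw [form, form, Matrix.mulVec_smul, dotProduct_smul, smul_eq_mul]

theorem form_add_left (X Y Z : Vec n) : form n (X + Y) Z = form n X Z + form n Y Z := by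
  rw [form, form, form, add_dotProduct]

theorem form_smul_left (a : ℝ) (X Y : Vec n) : form n (a • X) Y = a * form n X Y := by
  rw [form, form, smul_dotProduct, smul_eq_mul]

theorem isIsotropicSubspace_span {ι : Type*} {v : ι → Vec n} (hv : ∀ i j, form n (v i) (v j) = 0) :
    IsIsotropicSubspace n (Submodule.span ℝ (Set.range v)) := by
  intro X hX Y hY
  induction hX using Submodule.span_induction with
  | mem X hX =>
    obtain ⟨i, rfl⟩ := hX
    induction hY using Submodule.span_induction with
    | mem Y hY =>
      obtain ⟨j, rfl⟩ := hY
      exact hv i j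
    | zero => rw [form, Matrix.mulVec_zero, dotProduct_zero]
    | add Y Z _ _ h1 h2 => rw [form_add_right, h1, h2, add_zero]
    | smul a Y _ h1 => rw [form_smul_right, h1, mul_zero]
  | zero => rw [form, zero_dotProduct]
  | add X Z _ _ h1 h2 => rw [form_add_left, h1, h2, add_zero]
  | smul a X _ h1 => rw [form_smul_left, h1, mul_zero]

theorem form_self_of_support {c : Vec n} (hc : ∀ j : Fin (2 * n + 1), n < j → c j = 0) :
    form n c c = c ⟨n, by omega⟩ * c ⟨n, by omega⟩ := by
  rw [form, dotProduct, Finset.sum_eq_single ⟨n, by omega⟩]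
  · congr 1
    rw [Matrix.mulVec, dotProduct, Finset.sum_eq_single ⟨n, by omega⟩]
    · rw [Cmat_apply, if_pos (Fin.ext (by rw [Fin.val_rev]; simp only; omega)), ← two_mul, pow_mul,
        neg_one_sq, one_pow, one_mul]
    · intro j _ hj
      rw [Cmat_apply, if_neg, zero_mul]
      intro e
      refine hj (Fin.ext ?_)
      rw [e, Fin.val_rev]
      simp only
      omega
    · simp
  · intro i _ hi
    by_cases hi' : n < (i : ℕ)
    · rw [hc i hi', zero_mul]
    · have hin : (i : ℕ) ≠ n := fun e => hi (Fin.ext e)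
      have h0 : (Cmat n *ᵥ c) i = 0 := by
        rw [Matrix.mulVec, dotProduct]
        refine Finset.sum_eq_zero fun j _ => ?_
        rw [Cmat_apply]
        split_ifs with e
        · rw [hc j (by rw [e, Fin.val_rev]; omega), mul_zero]
        · rw [zero_mul]
      rw [h0, mul_zero]
  · simp

/-- Suppose `X` lies in an isotropic space that contains the span. Pairing with the first `n`
columns of `g` kills the last `n` coordinates of `X` in the frame `g`; then `⟨X, X⟩` is the square
of the middle coordinate, which therefore vanishes too. -/
theorem maximal_isotropic_of_orthogonal {g : Mat n} (hg : g ∈ orthogonal n) :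
    Maximal (IsIsotropicSubspace n)
      (Submodule.span ℝ (Set.range fun k : Fin n => g *ᵥ stdVec n ℝ k)) := by
  have hkl : ∀ (k : Fin n) (X : Vec n), form n (g *ᵥ stdVec n ℝ k) (g *ᵥ X) =
      (-1) ^ (n + (k : ℕ)) * X ⟨2 * n - k, by omega⟩ := fun k X => by
    rw [form_mulVec hg, form_stdVec _ (by omega)]
  refine ⟨isIsotropicSubspace_span fun k l => ?_, fun W hW hle X hX => ?_⟩
  · rw [hkl, stdVec, if_neg (by simp only; omega), mul_zero]
  · set c : Vec n := adj n ℝ g *ᵥ X with hc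
    have hX' : X = g *ᵥ c := by
      rw [hc, Matrix.mulVec_mulVec, mul_adj_of_mem_orthogonal hg, Matrix.one_mulVec]
    have h1 : ∀ j : Fin (2 * n + 1), n < j → c j = 0 := fun j hj => by
      have h := hW _ (hle (Submodule.subset_span ⟨⟨2 * n - j, by omega⟩, rfl⟩)) X hX
      rw [hX', hkl] at h
      rcases mul_eq_zero.mp h with h | h
      · exact absurd h (pow_ne_zero _ (by norm_num))
      · rwa [show (⟨2 * n - (2 * n - (j : ℕ)), by omega⟩ : Fin (2 * n + 1)) = j from
          Fin.ext (by simp only; omega)] at h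
    have h2 : c ⟨n, by omega⟩ = 0 := by
      have h := hW X hX X hX
      rw [hX', form_mulVec hg, form_self_of_support h1] at h
      exact mul_self_eq_zero.mp h
    have h3 : X = ∑ k : Fin n, c ⟨k, by omega⟩ • (g *ᵥ stdVec n ℝ k) := by
      have hcs : c = ∑ k : Fin n, c ⟨k, by omega⟩ • stdVec n ℝ k := by
        funext i
        rw [Finset.sum_apply]
        by_cases hi : (i : ℕ) < n
        · rw [Finset.sum_eq_single ⟨i, hi⟩]
          · rw [Pi.smul_apply, stdVec, if_pos rfl, smul_eq_mul, mul_one]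
          · intro k _ hk
            rw [Pi.smul_apply, stdVec, if_neg (fun e => hk (Fin.ext e.symm)), smul_zero]
          · simp
        · rw [Finset.sum_eq_zero fun k _ => ?_]
          · rcases Nat.lt_or_ge n i with h | h
            · exact h1 i h
            · rw [show i = ⟨n, by omega⟩ from Fin.ext (by simp only; omega), h2]
          · rw [Pi.smul_apply, stdVec, if_neg (by omega), smul_zero]
      conv_lhs => rw [hX', hcs]
      rw [Matrix.mulVec_sum]
      exact Finset.sum_congr rfl fun k _ => Matrix.mulVec_smul _ _ _
    rw [h3]
    exact Submodule.sum_mem _ fun k _ => Submodule.smul_mem _ _ (Submodule.subset_span ⟨k, rfl⟩)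

theorem column_mem_isotropicCurves {h : ℝ → Mat n} {w : ℝ → Fin n → ℝ} (hh : IsFrame h w) :
    (fun x a => h x a 0) ∈ isotropicCurves n := by
  have hk : ∀ k ≤ n, ∀ x, iteratedDeriv k (fun x a => h x a 0) x = h x *ᵥ stdVec n ℝ k :=
    fun k hk x => by
      rw [← coords_of_le w k x hk]
      exact congrFun (hh.iteratedDeriv_column k) x
  refine ⟨⟨contDiff_pi.mpr fun a => hh.smooth a 0, hh.linearIndependent_column, fun x => ?_⟩,
    fun x => ?_⟩
  · have e : (fun k : Fin n => iteratedDeriv (k : ℕ) (fun x a => h x a 0) x) =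
        fun k : Fin n => h x *ᵥ stdVec n ℝ k := funext fun k => hk k k.isLt.le x
    rw [e]
    exact maximal_isotropic_of_orthogonal (hh.mem_orthogonal x)
  · rw [hk n le_rfl, form_mulVec (hh.mem_orthogonal x), form_stdVec _ (by omega), stdVec,
      if_pos (by simp only; omega), mul_one, ← two_mul, pow_mul, neg_one_sq, one_pow]

end IsFrame

end Curve

end Frames

/-! ### Deformation of frames and tangency of the flows. -/

section Tangency

variable {n : ℕ}

section SmoothMatrices

open LoopType

theorem hasMatDerivAt_evalMat (N : MatOver n SmoothFn) (x : ℝ) :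
    HasMatDerivAt (fun y => evalMat n (SmoothFn.eval y) N)
      (evalMat n (SmoothFn.eval x) (matDer n SmoothFn.der N)) x := fun a b =>
  (SmoothFn.differentiable (N a b) x).hasDerivAt

theorem contDiff_evalMat (N : MatOver n SmoothFn) (a b : Fin (2 * n + 1)) :
    ContDiff ℝ ∞ fun x => evalMat n (SmoothFn.eval x) N a b := SmoothFn.contDiff (N a b)

theorem ext_evalMat {M N : MatOver n SmoothFn}
    (h : ∀ x, evalMat n (SmoothFn.eval x) M = evalMat n (SmoothFn.eval x) N) : M = N :=
  Matrix.ext fun a b => SmoothFn.ext_eval fun x => congrFun (congrFun (h x) a) b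

theorem iteratedIntegral_one (M : MatOver n SmoothFn) (x : ℝ) :
    iteratedIntegral (fun y => evalMat n (SmoothFn.eval y) (matDer n SmoothFn.der M)) 1 x =
      evalMat n (SmoothFn.eval x) M - evalMat n (SmoothFn.eval 0) M := by
  ext a b
  change ∫ s in (0 : ℝ)..x, ((1 : Mat n) * _) a b = _
  simp only [Matrix.one_mul]
  refine intervalIntegral.integral_eq_sub_of_hasDerivAt
    (fun s _ => hasMatDerivAt_evalMat M s a b) ?_
  exact (contDiff_evalMat _ a b).continuous.intervalIntegrable _ _

theorem iteratedIntegral_one_const (W : Mat n) : iteratedIntegral (fun _ => W) 1 1 = W := by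
  ext a b
  change ∫ s in (0 : ℝ)..1, ((1 : Mat n) * W) a b = _
  rw [intervalIntegral.integral_const, Matrix.one_mul, sub_zero, one_smul]

theorem contDiff_mul_apply {E : Type*} [NormedAddCommGroup E] [NormedSpace ℝ E] {X Y : E → Mat n}
    (hX : ∀ a b, ContDiff ℝ ∞ fun p => X p a b) (hY : ∀ a b, ContDiff ℝ ∞ fun p => Y p a b)
    (a b : Fin (2 * n + 1)) : ContDiff ℝ ∞ fun p => (X p * Y p) a b := by
  simp only [Matrix.mul_apply]
  exact ContDiff.sum fun c _ => (hX a c).mul (hY c b)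

theorem IsMovingFrame.isFrame {γ : ℝ → Vec n} {g : ℝ → Mat n} {u : ℝ → Fin n → ℝ}
    (hg : IsMovingFrame n γ g u) : IsFrame g u where
  smooth := hg.smooth_frame
  smooth_curvature := hg.smooth_curvature
  mem_orthogonal := hg.mem_orthogonal
  hasMatDerivAt x := by
    have hinv : (g x)⁻¹ = adj n ℝ (g x) :=
      Matrix.inv_eq_right_inv (mul_adj_of_mem_orthogonal (hg.mem_orthogonal x))
    have h : g x * (bMat n + toV n (u x)) = matDeriv g x := by
      rw [← hg.deriv_eq x, hinv, ← Matrix.mul_assoc,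
        mul_adj_of_mem_orthogonal (hg.mem_orthogonal x), Matrix.one_mul]
    rw [h]
    exact fun a b => ((hg.smooth_frame a b).differentiable (by simp) x).hasDerivAt

/-- Deformation of a frame by a solution of `K_x = t K M`. -/
theorem IsFrame.deform {g : ℝ → Mat n} {u w : ℝ → Fin n → ℝ} (hg : IsFrame g u)
    (hw : ContDiff ℝ ∞ w) {M : ℝ → Mat n} (hM : ∀ a b, ContDiff ℝ ∞ fun x => M x a b)
    (hMadj : ∀ x, adj n ℝ (M x) = -M x) (hMg : ∀ x, M x * g x = g x * toV n (w x)) {k : Mat n}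
    (hk : k ∈ orthogonal n) (t : ℝ) :
    IsFrame (fun x => k * pathExp M t x * g x) fun x => u x + t • w x where
  smooth := contDiff_mul_apply (contDiff_mul_apply (fun _ _ => contDiff_const)
    (fun a b => (contDiff_pathExp hM a b).comp (contDiff_const.prodMk contDiff_id))) hg.smooth
  smooth_curvature := hg.smooth_curvature.add (hw.const_smul t)
  mem_orthogonal x := mul_mem_orthogonal (mul_mem_orthogonal hk
    (pathExp_mem_orthogonal hM hMadj t x)) (hg.mem_orthogonal x)
  hasMatDerivAt x := by
    have hK : HasMatDerivAt (fun y => pathExp M t y) (t • (pathExp M t x * M x)) x :=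
      hasDerivAt_pathExp hM t x
    have h := ((hasMatDerivAt_const k x).mul hK).mul (hg.hasMatDerivAt x)
    have e : toV n (u x + t • w x) = toV n (u x) + t • toV n (w x) := by
      simp only [toV, Pi.add_apply, Pi.smul_apply, smul_eq_mul, add_smul, Finset.sum_add_distrib,
        Finset.smul_sum, smul_smul]
    have e2 : (0 * pathExp M t x + k * t • (pathExp M t x * M x)) * g x +
        k * pathExp M t x * (g x * (bMat n + toV n (u x))) =
        k * pathExp M t x * g x * (bMat n + toV n (u x + t • w x)) := by
      rw [e, Matrix.zero_mul, zero_add, Matrix.mul_smul, Matrix.smul_mul, Matrix.mul_assoc k,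
        Matrix.mul_assoc (pathExp M t x), hMg]
      simp only [Matrix.mul_add, Matrix.mul_smul, Matrix.mul_assoc]
      abel
    rwa [e2] at h

/-- The deformation is `exp(t N(0)) K(t, x) g(x)` with `K_x = t K N_x`, a frame of curvature `u + t
w`. At `t = 0` the factor `K` contributes `N(x) - N(0)` to the velocity, and the constant left
factor restores `N(0)`. -/
theorem isTangent_of_isFrame {γ : ℝ → Vec n} {g : ℝ → Mat n} {u w : ℝ → Fin n → ℝ}
    (hg : IsFrame g u) (hγ : ∀ x a, g x a 0 = γ x a) (hw : ContDiff ℝ ∞ w)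
    {N : MatOver n SmoothFn} (hN : adj n SmoothFn N = -N)
    (hNg : ∀ x, evalMat n (SmoothFn.eval x) (matDer n SmoothFn.der N) * g x =
      g x * toV n (w x)) :
    IsTangent n γ fun x a => (evalMat n (SmoothFn.eval x) N * g x) a 0 := by
  have hdN : adj n SmoothFn (matDer n SmoothFn.der N) = -matDer n SmoothFn.der N := by
    rw [← matDer_adj, hN, map_neg]
  let M : ℝ → Mat n := fun x => evalMat n (SmoothFn.eval x) (matDer n SmoothFn.der N)
  -- `pathExp W t 1` is the matrix exponential of `t N(0)`, obtained from the same equation with a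
  -- constant coefficient.
  let W : ℝ → Mat n := fun _ => evalMat n (SmoothFn.eval 0) N
  have hM : ∀ a b, ContDiff ℝ ∞ fun x => M x a b := contDiff_evalMat _
  have hMadj : ∀ x, adj n ℝ (M x) = -M x := fun x => by
    change adj n ℝ (evalMat n _ _) = -evalMat n _ _
    rw [← evalMat_adj, hdN, map_neg]
  have hW : ∀ a b, ContDiff ℝ ∞ fun x => W x a b := fun a b => contDiff_const
  have hWadj : ∀ x, adj n ℝ (W x) = -W x := fun x => by
    change adj n ℝ (evalMat n _ _) = -evalMat n _ _
    rw [← evalMat_adj, hN, map_neg]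
  refine ⟨fun t x a => (pathExp W t 1 * pathExp M t x * g x) a 0, contDiff_pi.mpr fun a => ?_,
    fun t => IsFrame.column_mem_isotropicCurves
      (hg.deform hw hM hMadj hNg (pathExp_mem_orthogonal hW hWadj t 1) t), ?_, fun x => ?_⟩
  · exact contDiff_mul_apply (contDiff_mul_apply
      (X := fun p : ℝ × ℝ => pathExp W p.1 1) (Y := fun p : ℝ × ℝ => pathExp M p.1 p.2)
      (fun a b => (contDiff_pathExp hW a b).comp (contDiff_fst.prodMk contDiff_const))
      (contDiff_pathExp hM)) (fun a b => (hg.smooth a b).comp contDiff_snd) a 0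
  · funext x a
    have e : pathExp W 0 1 * pathExp M 0 x * g x = g x := by
      rw [pathExp_zero_left, pathExp_zero_left, Matrix.one_mul, Matrix.one_mul]
    exact (congrFun (congrFun e a) 0).trans (hγ x a)
  · refine hasDerivAt_pi.mpr fun a => ?_
    have h1 : HasMatDerivAt (fun t => pathExp W t 1) (iteratedIntegral W 1 1) 0 :=
      hasDerivAt_pathExp_zero hW 1
    have h2 : HasMatDerivAt (fun t => pathExp M t x) (iteratedIntegral M 1 x) 0 :=
      hasDerivAt_pathExp_zero hM x
    refine ((h1.mul h2).mul (hasMatDerivAt_const (g x) 0) a 0).congr_deriv ?_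
    rw [pathExp_zero_left, pathExp_zero_left, Matrix.mul_one, Matrix.one_mul, Matrix.mul_zero,
      add_zero, iteratedIntegral_one_const, iteratedIntegral_one, add_sub_cancel]

/-- For a frame the adjoint of `G` is `G⁻¹`; the formula then says that conjugation by `G` carries
`∂ + ad(b + u)` to `∂`. -/
theorem matDer_conj {A : Type*} [CommRing A] [Algebra ℝ A] (D : Derivation ℝ A A) (u : Fin n → A)
    {G : MatOver n A} (hG : matDer n D G = G * (baseChange n A (bMat n) + toVOver u))
    (Z : MatOver n A) : matDer n D (G * Z * adj n A G) = G * covDer D u Z * adj n A G := by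
  have hU : adj n A (baseChange n A (bMat n) + toVOver u) =
      -(baseChange n A (bMat n) + toVOver u) := by
    rw [map_add, adj_baseChange, adj_bMat, map_neg (baseChange n A), adj_toVOver, neg_add]
  rw [covDer_apply, matDer_mul, matDer_mul, matDer_adj, hG, adj_mul, hU]
  generalize baseChange n A (bMat n) + toVOver u = U
  generalize matDer n D Z = Z'
  noncomm_ring

/-- A frame `g` with curvature `u` can be deformed in the direction of every `g Z`, where `Z` is in
the orthogonal Lie algebra and `[∂ + b + u, Z]` is in `V_n`. -/
theorem isTangent_of_covDer {γ : ℝ → Vec n} {g : ℝ → Mat n} {u : ℝ → Fin n → ℝ}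
    (hg : IsMovingFrame n γ g u) {Z : MatOver n SmoothFn} {v : Fin n → SmoothFn}
    (hZ : adj n SmoothFn Z = -Z)
    (hv : covDer SmoothFn.der (smoothCoord u hg.smooth_curvature) Z = toVOver v) :
    IsTangent n γ fun x => g x *ᵥ (evalMat n (SmoothFn.eval x) Z *ᵥ e1 n) := by
  let G : MatOver n SmoothFn := Matrix.of fun a b => ⟨fun x => g x a b, hg.smooth_frame a b⟩
  have hGx : ∀ x, evalMat n (SmoothFn.eval x) G = g x := fun x => rfl
  have hGG : adj n SmoothFn G * G = 1 := ext_evalMat fun x => by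
    rw [map_mul, evalMat_adj, hGx, map_one, mem_orthogonal_iff.mp (hg.mem_orthogonal x)]
  have hdG : matDer n SmoothFn.der G =
      G * (baseChange n SmoothFn (bMat n) + toVOver (smoothCoord u hg.smooth_curvature)) :=
    ext_evalMat fun x => by
      rw [map_mul, map_add, evalMat_baseChange, evalMat_toVOver, hGx]
      exact Matrix.ext fun a b => (hg.isFrame.hasMatDerivAt x a b).deriv
  have hdN := matDer_conj SmoothFn.der _ hdG Z
  have hN : adj n SmoothFn (G * Z * adj n SmoothFn G) = -(G * Z * adj n SmoothFn G) := by
    rw [adj_mul, adj_mul, adj_adj, hZ, Matrix.neg_mul, Matrix.mul_neg, Matrix.mul_assoc]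
  have h := isTangent_of_isFrame (γ := γ) hg.isFrame (fun x a => congrFun (hg.column x 0 (Nat.zero_le n)) a)
    (w := fun x k => SmoothFn.eval x (v k))
    (contDiff_pi.mpr fun k => SmoothFn.contDiff (v k)) hN fun x => by
      rw [hdN, hv, ← hGx, ← map_mul, Matrix.mul_assoc, hGG, Matrix.mul_one, map_mul,
        evalMat_toVOver]
  have e : ∀ x, (fun a => (evalMat n (SmoothFn.eval x) (G * Z * adj n SmoothFn G) * g x) a 0) =
      g x *ᵥ (evalMat n (SmoothFn.eval x) Z *ᵥ e1 n) := fun x => by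
    rw [← hGx, ← map_mul, Matrix.mul_assoc, hGG, Matrix.mul_one, map_mul, Matrix.mulVec_mulVec, e1,
      Matrix.mulVec_single_one]
    rfl
  simp only [← e]
  exact h

/-- Subtracting the strictly upper triangular `η` of `exists_gauge` puts `[∂ + b + u, Q - η]` into
`V_n` without changing the first column, which is all that the flow sees. -/
theorem isTangent_of_zerothCoeff {γ : ℝ → Vec n} {g : ℝ → Mat n} {u : ℝ → Fin n → ℝ}
    (hg : IsMovingFrame n γ g u) {Q : MatOver n SmoothFn} (hQ : adj n SmoothFn Q = -Q)
    (hQu : UpperFrom 0 (covDer SmoothFn.der (smoothCoord u hg.smooth_curvature) Q)) :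
    IsTangent n γ fun x => g x *ᵥ (evalMat n (SmoothFn.eval x) Q *ᵥ e1 n) := by
  obtain ⟨η, v, hη, hηadj, e⟩ := exists_gauge SmoothFn.der
    (smoothCoord u hg.smooth_curvature) hQu (by rw [adj_covDer, hQ, map_neg])
  have h := isTangent_of_covDer hg (Z := Q - η) (v := v)
    (by rw [map_sub, hQ, hηadj, neg_sub_neg, neg_sub])
    (by rw [map_sub, e, add_sub_cancel_left])
  have h0 : ∀ x, evalMat n (SmoothFn.eval x) (Q - η) *ᵥ e1 n =
      evalMat n (SmoothFn.eval x) Q *ᵥ e1 n := fun x => by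
    rw [e1, Matrix.mulVec_single_one, Matrix.mulVec_single_one]
    funext a
    rw [Matrix.col_apply, Matrix.col_apply, evalMat_apply, evalMat_apply, Matrix.sub_apply,
      hη a 0 (by rw [Fin.val_zero]; omega), sub_zero]
  simpa only [h0] using h

end SmoothMatrices

theorem LoopType.isIsotropicCurveFlow (τ : LoopType n) (hE : τ.c ≠ 0 → τ.E ≠ 0) {k : ℕ}
    (hk : Odd k) {X : (ℝ → Fin n → ℝ) → ℝ → Loop n}
    (hX : ∀ u, ContDiff ℝ ∞ u → τ.IsSolution u (X u)) :
    IsIsotropicCurveFlow n fun u x => lamCoeff (X u x ^ k) 0 *ᵥ e1 n := by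
  refine ⟨?_, fun γ _ g u hg => ?_⟩
  · obtain ⟨p, hp⟩ := τ.exists_diffPoly_coeff hE k 0
    exact ⟨p, fun u hu x a => hp u hu (X u) (hX u hu) x a⟩
  · obtain ⟨Q, h1, h2, h3⟩ := τ.exists_zerothCoeff hg.smooth_curvature
      (hX u hg.smooth_curvature) hk
    have h := isTangent_of_zerothCoeff hg h2 fun i j hij => h3 i j (Fin.lt_def.mpr (by omega))
    simpa only [h1] using h

end Tangency

end IsotropicFlow

end

/-! ### The main theorem. -/

open IsotropicFlow

theorem mainTheorem2 (n j : ℕ) (hn : 1 ≤ n) (hj : 1 ≤ j) :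
    (∀ u : ℝ → Fin n → ℝ, ContDiff ℝ ∞ u → ∃! P : ℝ → Loop n, IsP n u P) ∧
    (∀ u : ℝ → Fin n → ℝ, ContDiff ℝ ∞ u → ∃! S : ℝ → Loop n, IsS n u S) ∧
    (∀ P : (ℝ → Fin n → ℝ) → ℝ → Loop n,
      (∀ u, ContDiff ℝ ∞ u → IsP n u (P u)) →
      IsIsotropicCurveFlow n (fun u x => lamCoeff (P u x ^ (2 * j - 1)) 0 *ᵥ e1 n)) ∧
    (∀ S : (ℝ → Fin n → ℝ) → ℝ → Loop n,
      (∀ u, ContDiff ℝ ∞ u → IsS n u (S u)) →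
      IsIsotropicCurveFlow n (fun u x => lamCoeff (S u x ^ (2 * j - 1)) 0 *ᵥ e1 n)) := by
  refine ⟨fun u hu => existsUnique_isP hn hu, fun u hu => existsUnique_isS hn hu, ?_, ?_⟩
  · exact fun P hP => (typeB n hn).isIsotropicCurveFlow (fun _ => betaB_ne_zero hn)
      -- `2j - 1 = 2 (j - 1) + 1` is odd, which keeps the power skew under the involution.
      ⟨j - 1, by omega⟩ fun u hu => isSolution_of_isP hn (hP u hu)
  · exact fun S hS => (typeA n hn).isIsotropicCurveFlow (fun hc => absurd rfl hc)
      ⟨j - 1, by omega⟩ fun u hu => isSolution_of_isS hn (hS u hu)
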